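/- Let $\mathsf C$ be a closed symmetric monoidal quasi-abelian category with all finite limits and colimits and with enough projectives, and assume that every projective object of $\mathsf C$ is flat. Here a morphism is strict if the canonical morphism from its coimage to its image is an isomorphism; quasi-abelian means additive, with kernels and cokernels, strict epimorphisms being stable under pullback and strict monomorphisms under pushout; an object $P$ is projective if $\mathrm{Hom}(P,-)$ takes strict epimorphisms to surjections; there are enough projectives if every object is the target of a strict epimorphism from a projective; and $V$ is flat if $V\otimes-$ commutes with finite limits. For a commutative monoid $A$ in $\mathsf C$ let $\mathrm{Mod}(A)$ be the category of $A$-modules in $\mathsf C$. A sequence $E'\xrightarrow{e'}E\xrightarrow{e}E''$ with $ee'=0$ is strictly exact if $e'$ is strict and $\operatorname{im}e'\to\ker e$ is an isomorphism. Let $D(A)=K(\mathrm{Mod}(A))/N(\mathrm{Mod}(A))$ be the quotient of the homotopy category of cochain complexes by the strictly exact complexes, and $D^-(A)\subset D(A)$ the full subcategory of objects represented by bounded above complexes. Let $\mathrm{Aff}(\mathsf C)$ be the opposite of the category of commutative monoids in $\mathsf C$. A morphism $p:\mathrm{Spec}(B)\to\mathrm{Spec}(A)$ gives the restriction functor $p_*:\mathrm{Mod}(B)\to\mathrm{Mod}(A)$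 and the functor $p^*=(-)\otimes_A B:\mathrm{Mod}(A)\to\mathrm{Mod}(B)$; $p$ is a homotopy monomorphism (and $A\to B$ a homotopy epimorphism) if the induced functor $p_*:D^-(B)\to D^-(A)$ is fully faithful. For an $A$-module $M$, $M\otimes_A^{\mathbb L}B=\mathbb Lp^*M$ is computed by applying $p^*$ to a resolution of $M$ by projective $A$-modules. Let $\mathsf A\subset\mathrm{Aff}(\mathsf C)$ be a homotopy Zariski transversal full subcategory: $\mathsf A$ is closed under fiber products, and for every homotopy monomorphism $\mathrm{Spec}(B)\to\mathrm{Spec}(A)$ and every morphism $\mathrm{Spec}(C)\to\mathrm{Spec}(A)$ in $\mathsf A$ the natural morphism $C\otimes_A^{\mathbb L}B\to C\otimes_AB$ is an isomorphism. For $X=\mathrm{Spec}(A)\in\mathsf A$ let $\mathrm{Mod}^{RR}_{\mathsf A}(X)\subset\mathrm{Mod}(A)$ be the full subcategory of RR-quasi-coherent modules, i.e. of those $M$ for which $M\otimes^{\mathbb L}_AB\to M\otimes_AB$ is an isomorphism for every homotopy epimorphism $A\to B$ with $\mathrm{Spec}(B)\in\mathsf A$. Then: 1. If $p:Y\to X$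 is a homotopy monomorphism in $\mathsf A$, then $p^*$ maps $\mathrm{Mod}^{RR}_{\mathsf A}(X)$ into $\mathrm{Mod}^{RR}_{\mathsf A}(Y)$. 2. Call a family $\{p_i:X_i\to X\}_{i\in I}$ in $\mathsf A$ a covering if every $p_i$ is a homotopy monomorphism and there is a finite subset $J\subset I$ such that the functors $p_i^*:\mathrm{Mod}^{RR}_{\mathsf A}(X)\to\mathrm{Mod}^{RR}_{\mathsf A}(X_i)$, $i\in J$, form a conservative family (a morphism $f$ of $\mathrm{Mod}^{RR}_{\mathsf A}(X)$ is an isomorphism if and only if all $p_i^*f$, $i\in J$, are). The category $\mathsf A$ has fiber products, and the coverings form a pretopology on $\mathsf A$ (the formal homotopy Zariski topology): families consisting of one isomorphism are coverings, base changes of coverings are coverings, and composing a covering of $X$ with coverings of its members gives a covering of $X$. -/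

import Mathlib

open CategoryTheory CategoryTheory.Limits CategoryTheory.MonoidalCategory
open scoped MonObj ModObj

universe v u v' u'

noncomputable section

namespace RelGeom

section QuasiAbelian

variable {E : Type u} [Category.{v} E] [Preadditive E] [HasKernels E] [HasCokernels E]

/-- A morphism is strict if the canonical morphism from its coimage to its image is invertible. -/
def IsStrict {X Y : E} (f : X ⟶ Y) : Prop := IsIso (Abelian.coimageImageComparison f)

def IsStrictEpi {X Y : E} (f : X ⟶ Y) : Prop := IsStrict f ∧ Epi f

def IsStrictMono {X Y : E} (f : X ⟶ Y) : Prop := IsStrict f ∧ Mono f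

/-- The canonical morphism from the image of `f` to the kernel of `g` when `f ≫ g = 0`. -/
def imageToKer {X Y Z : E} (f : X ⟶ Y) (g : Y ⟶ Z) (w : f ≫ g = 0) :
    Abelian.image f ⟶ kernel g :=
  kernel.lift g (Abelian.image.ι f) (by
    rw [← cokernel.π_desc f g w, kernel.condition_assoc, zero_comp])

/-- Strict exactness of `X₁ ⟶ X₂ ⟶ X₃`. -/
def StrictlyExact (S : ShortComplex E) : Prop :=
  IsStrict S.f ∧ IsIso (imageToKer S.f S.g S.zero)

variable (E) in
/-- Quasi-abelian categories. -/
structure QuasiAbelian : Prop where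
  strictEpi_baseChange {P X Y Z : E} {f' : P ⟶ Y} {g' : P ⟶ X} {f : X ⟶ Z} {g : Y ⟶ Z} :
    IsPullback g' f' f g → IsStrictEpi f → IsStrictEpi f'
  strictMono_cobaseChange {X Y Z Q : E} {f : X ⟶ Y} {g : X ⟶ Z} {g' : Y ⟶ Q} {f' : Z ⟶ Q} :
    IsPushout f g g' f' → IsStrictMono f → IsStrictMono f'

/-- An object is projective if it lifts against strict epimorphisms. -/
def IsProj (P : E) : Prop :=
  ∀ ⦃X Y : E⦄ (e : X ⟶ Y), IsStrictEpi e → ∀ f : P ⟶ Y, ∃ g : P ⟶ X, g ≫ e = f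

variable (E) in
def EnoughProj : Prop := ∀ X : E, ∃ (P : E) (e : P ⟶ X), IsProj P ∧ IsStrictEpi e

def StrictlyAcyclic (K : CochainComplex E ℤ) : Prop := ∀ i : ℤ, StrictlyExact (K.sc i)

end QuasiAbelian

section PreserveExact

variable {E : Type u} [Category.{v} E] [Preadditive E] [HasKernels E] [HasCokernels E]
  {E' : Type u'} [Category.{v'} E'] [Preadditive E'] [HasKernels E'] [HasCokernels E']
  (F : E ⥤ E') [F.Additive]
  [∀ {X Y : E} (f : X ⟶ Y), PreservesLimit (parallelPair f 0) F]
  [∀ {X Y : E} (f : X ⟶ Y), PreservesColimit (parallelPair f 0) F]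

theorem IsStrict.map {X Y : E} {f : X ⟶ Y} (hf : IsStrict f) : IsStrict (F.map f) := by
  have : IsIso (Abelian.coimageImageComparison f) := hf
  exact (MorphismProperty.isomorphisms E').arrow_mk_iso_iff
    (Abelian.PreservesCoimageImageComparison.iso F f) |>.1
      (show IsIso (F.map (Abelian.coimageImageComparison f)) from inferInstance)

theorem StrictlyExact.map {S : ShortComplex E} (hS : StrictlyExact S) :
    StrictlyExact (S.map F) := by
  refine ⟨hS.1.map F, ?_⟩
  have : IsIso (imageToKer S.f S.g S.zero) := hS.2
  have w : F.map S.f ≫ F.map S.g = 0 := by rw [← F.map_comp, S.zero, F.map_zero]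
  have key : imageToKer (F.map S.f) (F.map S.g) w =
      (Abelian.PreservesImage.iso F S.f).inv ≫ F.map (imageToKer S.f S.g S.zero) ≫
        (PreservesKernel.iso F S.g).hom := by
    rw [← cancel_mono (kernel.ι (F.map S.g))]
    simp [imageToKer]
  change IsIso (imageToKer (F.map S.f) (F.map S.g) w)
  rw [key]
  infer_instance

theorem StrictlyAcyclic.map {K : CochainComplex E ℤ} (hK : StrictlyAcyclic K) :
    StrictlyAcyclic ((F.mapHomologicalComplex _).obj K) :=
  fun i => (hK i).map F

end PreserveExact

section Derived

variable (E : Type u) [Category.{v} E] [Preadditive E] [HasKernels E] [HasCokernels E]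
  [HasZeroObject E] [HasBinaryBiproducts E]

/-- The homotopy category of (unbounded) cochain complexes. -/
abbrev KCat := HomotopyCategory E (ComplexShape.up ℤ)

/-- The complexes that are strictly exact. -/
def acyclics : ObjectProperty (KCat E) := fun K => StrictlyAcyclic K.as

/-- `D(E) = K(E)/N(E)`. -/
abbrev DCat := (acyclics E).trW.Localization

abbrev toD : KCat E ⥤ DCat E := (acyclics E).trW.Q

/-- The objects of `D(E)` represented by bounded above complexes -/
def boundedAbove : ObjectProperty (DCat E) := fun X =>
  ∃ (K : CochainComplex E ℤ) (n : ℤ), K.IsStrictlyLE n ∧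
    Nonempty (X ≅ (toD E).obj ((HomotopyCategory.quotient _ _).obj K))

abbrev DMinus := (boundedAbove E).FullSubcategory

variable {E}

def StrictQuasiIso {K L : CochainComplex E ℤ} (φ : K ⟶ L) : Prop :=
  StrictlyAcyclic (CochainComplex.mappingCone φ)

variable {E' : Type u'} [Category.{v'} E'] [Preadditive E'] [HasKernels E'] [HasCokernels E']
  [HasZeroObject E'] [HasBinaryBiproducts E']
  (F : E ⥤ E') [F.Additive]
  [∀ {X Y : E} (f : X ⟶ Y), PreservesLimit (parallelPair f 0) F]
  [∀ {X Y : E} (f : X ⟶ Y), PreservesColimit (parallelPair f 0) F]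

theorem mapK_inverts : (acyclics E).trW.IsInvertedBy
    (F.mapHomotopyCategory (ComplexShape.up ℤ) ⋙ toD E') := by
  rintro X Y f ⟨Z, g, h, hT, hZ⟩
  have : (acyclics E').trW ((F.mapHomotopyCategory (ComplexShape.up ℤ)).map f) :=
    ObjectProperty.trW.mk _ 
      ((F.mapHomotopyCategory (ComplexShape.up ℤ)).map_distinguished _ hT)
      (show StrictlyAcyclic _ from StrictlyAcyclic.map F hZ)
  exact (acyclics E').trW.Q_inverts _ this

def mapD : DCat E ⥤ DCat E' :=
  Localization.Construction.lift (F.mapHomotopyCategory (ComplexShape.up ℤ) ⋙ toD E')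
    (mapK_inverts F)

theorem toD_mapD : toD E ⋙ mapD F = F.mapHomotopyCategory (ComplexShape.up ℤ) ⋙ toD E' :=
  Localization.Construction.fac _ _

def mapDMinus : DMinus E ⥤ DMinus E' :=
  (boundedAbove E').lift ((boundedAbove E).ι ⋙ mapD F) (by
    rintro ⟨X, K, n, hK, ⟨e⟩⟩
    refine ⟨(F.mapHomologicalComplex _).obj K, n, ?_,
      ⟨(mapD F).mapIso e ≪≫ eqToIso (Functor.congr_obj (toD_mapD F) _)⟩⟩
    rw [CochainComplex.isStrictlyLE_iff] at hK ⊢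
    exact fun i hi => F.map_isZero (hK i hi))

end Derived

section Modules

set_option linter.unusedSectionVars false

variable {C : Type u} [Category.{v} C] [Preadditive C] [HasFiniteLimits C] [HasFiniteColimits C]
  [MonoidalCategory C] [SymmetricCategory C] [MonoidalClosed C]

instance tensorLeft_additive (X : C) : (tensorLeft X).Additive :=
  have : HasBinaryBiproducts C := HasBinaryBiproducts.of_hasBinaryProducts
  have : PreservesBinaryBiproducts (tensorLeft X) :=
    preservesBinaryBiproducts_of_preservesBinaryCoproducts _
  Functor.additive_of_preservesBinaryBiproducts _

instance monoidalPreadditive : MonoidalPreadditive C where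
  whiskerLeft_zero {X _ _} := (tensorLeft X).map_zero _ _
  zero_whiskerRight {X Y Z} := by
    rw [← cancel_mono (β_ Z X).hom]
    simpa using (tensorLeft X).map_zero Y Z
  whiskerLeft_add {X _ _} f g := (tensorLeft X).map_add
  add_whiskerRight {X Y Z} f g := by
    rw [← cancel_mono (β_ Z X).hom, Preadditive.add_comp]
    simp only [BraidedCategory.braiding_naturality_left]
    rw [← Preadditive.comp_add]
    exact congrArg _ (tensorLeft X).map_add

variable {A : C} [MonObj A]

/-- The action morphism of a module. -/
def act (M : CategoryTheory.Mod C A) : A ⊗ M.X ⟶ M.X := γ[A, M.X]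

@[simp]
theorem one_act (M : CategoryTheory.Mod C A) : η[A] ▷ M.X ≫ act M = (λ_ M.X).hom :=
  ModObj.one_smul (M := A) M.X

@[simp]
theorem mul_act (M : CategoryTheory.Mod C A) :
    μ[A] ▷ M.X ≫ act M = (α_ A A M.X).hom ≫ A ◁ act M ≫ act M :=
  ModObj.mul_smul (M := A) M.X

theorem act_hom {M N : CategoryTheory.Mod C A} (f : M ⟶ N) :
    A ◁ f.hom ≫ act N = act M ≫ f.hom :=
  (IsModHom.smul_hom (A := A) (f := f.hom)).symm

/-- The module with underlying object `X` and action `a`. -/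
def mkMod (X : C) (a : A ⊗ X ⟶ X) (h₁ : η[A] ▷ X ≫ a = (λ_ X).hom)
    (h₂ : μ[A] ▷ X ≫ a = (α_ A A X).hom ≫ A ◁ a ≫ a) : CategoryTheory.Mod C A :=
  @CategoryTheory.Mod.mk C _ _ C _ _ A _ X { smul := a, one_smul := h₁, mul_smul := h₂ }

/-- A morphism of `C` that is compatible with the actions. -/
def mkHom {M N : CategoryTheory.Mod C A} (f : M.X ⟶ N.X)
    (hf : A ◁ f ≫ act N = act M ≫ f) : M ⟶ N :=
  Mod.Hom.mk' f hf.symm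

theorem modHom_ext {M N : CategoryTheory.Mod C A} {f g : M ⟶ N} (h : f.hom = g.hom) : f = g :=
  Mod.hom_ext _ _ h

instance modHomGroup (M N : CategoryTheory.Mod C A) : AddCommGroup (M ⟶ N) :=
  letI : Zero (M ⟶ N) := ⟨mkHom 0 (by simp)⟩
  letI : Add (M ⟶ N) := ⟨fun f g => mkHom (f.hom + g.hom) (by simp [act_hom])⟩
  letI : Neg (M ⟶ N) := ⟨fun f => mkHom (-f.hom) (by
    have : A ◁ (-f.hom) = -(A ◁ f.hom) := (tensorLeft A).map_neg
    simp [this, act_hom])⟩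
  { nsmul := nsmulRec
    zsmul := zsmulRec
    add_assoc f g h := modHom_ext (add_assoc f.hom g.hom h.hom)
    zero_add f := modHom_ext (zero_add f.hom)
    add_zero f := modHom_ext (add_zero f.hom)
    neg_add_cancel f := modHom_ext (neg_add_cancel f.hom)
    add_comm f g := modHom_ext (add_comm f.hom g.hom) }

@[simp]
theorem mod_add_hom {M N : CategoryTheory.Mod C A} (f g : M ⟶ N) :
    (f + g).hom = f.hom + g.hom := rfl

@[simp]
theorem mod_zero_hom {M N : CategoryTheory.Mod C A} : (0 : M ⟶ N).hom = 0 := rfl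

instance modPreadditive : Preadditive (CategoryTheory.Mod C A) where
  add_comp _ _ _ f g h := modHom_ext (by simp)
  comp_add _ _ _ f g h := modHom_ext (by simp)

variable (A) in
/-- The zero module. -/
def zeroMod : CategoryTheory.Mod C A :=
  mkMod (⊤_ C) (terminal.from _) (Subsingleton.elim _ _) (Subsingleton.elim _ _)

instance modHasZeroObject : HasZeroObject (CategoryTheory.Mod C A) :=
  ⟨zeroMod A, (IsZero.iff_id_eq_zero _).2
    (modHom_ext (Subsingleton.elim (α := (⊤_ C) ⟶ (⊤_ C)) _ _))⟩

section Prod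

variable (M N : CategoryTheory.Mod C A)

/-- The componentwise action on the product. -/
def prodAct : A ⊗ (M.X ⨯ N.X) ⟶ M.X ⨯ N.X :=
  prod.lift (A ◁ prod.fst ≫ act M) (A ◁ prod.snd ≫ act N)

@[simp]
theorem prodAct_fst : prodAct M N ≫ prod.fst = A ◁ prod.fst ≫ act M := prod.lift_fst _ _

@[simp]
theorem prodAct_snd : prodAct M N ≫ prod.snd = A ◁ prod.snd ≫ act N := prod.lift_snd _ _

/-- The product of two modules. -/
def prodMod : CategoryTheory.Mod C A :=
  mkMod (M.X ⨯ N.X) (prodAct M N)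
    (by
      apply Limits.prod.hom_ext
      · rw [Category.assoc, prodAct_fst, ← whisker_exchange_assoc]; simp
      · rw [Category.assoc, prodAct_snd, ← whisker_exchange_assoc]; simp)
    (by
      apply Limits.prod.hom_ext
      · simp only [Category.assoc, prodAct_fst]
        rw [← whisker_exchange_assoc, mul_act, ← whiskerLeft_comp_assoc, prodAct_fst]; simp
      · simp only [Category.assoc, prodAct_snd]
        rw [← whisker_exchange_assoc, mul_act, ← whiskerLeft_comp_assoc, prodAct_snd]; simp)

def prodModFst : prodMod M N ⟶ M :=
  mkHom (prod.fst : M.X ⨯ N.X ⟶ M.X) (prodAct_fst M N).symm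

def prodModSnd : prodMod M N ⟶ N :=
  mkHom (prod.snd : M.X ⨯ N.X ⟶ N.X) (prodAct_snd M N).symm

theorem lift_prodAct {X : C} (f : X ⟶ M.X) (g : X ⟶ N.X) :
    A ◁ prod.lift f g ≫ prodAct M N = prod.lift (A ◁ f ≫ act M) (A ◁ g ≫ act N) := by
  apply Limits.prod.hom_ext
  · rw [Category.assoc, prodAct_fst, prod.lift_fst, ← whiskerLeft_comp_assoc, prod.lift_fst]
  · rw [Category.assoc, prodAct_snd, prod.lift_snd, ← whiskerLeft_comp_assoc, prod.lift_snd]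

variable {M N} in
def prodModLift {T : CategoryTheory.Mod C A} (f : T ⟶ M) (g : T ⟶ N) : T ⟶ prodMod M N :=
  mkHom (prod.lift f.hom g.hom : T.X ⟶ M.X ⨯ N.X) ((lift_prodAct M N _ _).trans
    ((congrArg₂ prod.lift (act_hom f) (act_hom g)).trans (prod.comp_lift _ _ _).symm))

instance modHasBinaryProducts : HasBinaryProducts (CategoryTheory.Mod C A) :=
  have (M N : CategoryTheory.Mod C A) : HasLimit (pair M N) :=
    ⟨⟨⟨BinaryFan.mk (prodModFst M N) (prodModSnd M N), BinaryFan.IsLimit.mk _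
      (fun f g => prodModLift f g)
      (fun _ _ => modHom_ext (prod.lift_fst _ _))
      (fun _ _ => modHom_ext (prod.lift_snd _ _))
      (fun _ _ _ h₁ h₂ => modHom_ext (Limits.prod.hom_ext
        ((congrArg Mod.Hom.hom h₁).trans (prod.lift_fst _ _).symm)
        ((congrArg Mod.Hom.hom h₂).trans (prod.lift_snd _ _).symm)))⟩⟩⟩
  hasBinaryProducts_of_hasLimit_pair _

instance modHasBinaryBiproducts : HasBinaryBiproducts (CategoryTheory.Mod C A) :=
  HasBinaryBiproducts.of_hasBinaryProducts

end Prod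

section KerCoker

variable {M N : CategoryTheory.Mod C A} (f : M ⟶ N)

/-- The action on the kernel. -/
def kerAct : A ⊗ kernel f.hom ⟶ kernel f.hom :=
  kernel.lift f.hom (A ◁ kernel.ι f.hom ≫ act M) (by
    rw [Category.assoc, ← act_hom, ← whiskerLeft_comp_assoc, kernel.condition]
    simp)

@[simp]
theorem kerAct_ι : kerAct f ≫ kernel.ι f.hom = A ◁ kernel.ι f.hom ≫ act M :=
  kernel.lift_ι _ _ _

/-- The kernel of a morphism of modules, with underlying object the kernel in `C`. -/
def kerMod : CategoryTheory.Mod C A :=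
  mkMod (kernel f.hom) (kerAct f)
    (by
      rw [← cancel_mono (kernel.ι f.hom), Category.assoc, kerAct_ι, ← whisker_exchange_assoc]
      simp)
    (by
      rw [← cancel_mono (kernel.ι f.hom)]
      simp only [Category.assoc, kerAct_ι]
      rw [← whisker_exchange_assoc, mul_act, ← whiskerLeft_comp_assoc, kerAct_ι]
      simp)

def kerModι : kerMod f ⟶ M :=
  mkHom (kernel.ι f.hom : kernel f.hom ⟶ M.X) (kerAct_ι f).symm

theorem kerModι_comp : kerModι f ≫ f = 0 := modHom_ext (kernel.condition f.hom)

theorem lift_kerAct {X : C} (g : X ⟶ M.X) (hg : g ≫ f.hom = 0) :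
    (A ◁ kernel.lift f.hom g hg ≫ kerAct f) ≫ kernel.ι f.hom = A ◁ g ≫ act M := by
  rw [Category.assoc, kerAct_ι, ← whiskerLeft_comp_assoc, kernel.lift_ι]

theorem kerAct_lift {T : CategoryTheory.Mod C A} (g : T ⟶ M) (hg : g.hom ≫ f.hom = 0) :
    A ◁ kernel.lift f.hom g.hom hg ≫ kerAct f = act T ≫ kernel.lift f.hom g.hom hg := by
  rw [← cancel_mono (kernel.ι f.hom), lift_kerAct, act_hom, Category.assoc, kernel.lift_ι]

def kerModLift {T : CategoryTheory.Mod C A} (g : T ⟶ M) (hg : g.hom ≫ f.hom = 0) :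
    T ⟶ kerMod f :=
  mkHom (kernel.lift f.hom g.hom hg : T.X ⟶ kernel f.hom) (kerAct_lift f g hg)

def kerModIsLimit : IsLimit (KernelFork.ofι (kerModι f) (kerModι_comp f)) :=
  KernelFork.IsLimit.ofι _ _
    (fun g hg => kerModLift f g (congrArg Mod.Hom.hom hg))
    (fun _ _ => modHom_ext (kernel.lift_ι _ _ _))
    (fun _ _ _ hm => modHom_ext ((cancel_mono (kernel.ι f.hom)).1
      ((congrArg Mod.Hom.hom hm).trans (kernel.lift_ι _ _ _).symm)))

instance modHasKernels : HasKernels (CategoryTheory.Mod C A) where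
  has_limit f := ⟨⟨⟨_, kerModIsLimit f⟩⟩⟩

/-- Tensoring with `A` preserves the cokernel of `f`. -/
def whiskerCokerIsColimit : IsColimit (CokernelCofork.ofπ (f := A ◁ f.hom) (A ◁ cokernel.π f.hom)
    (by rw [← whiskerLeft_comp, cokernel.condition, MonoidalPreadditive.whiskerLeft_zero])) :=
  CokernelCofork.mapIsColimit _ (cokernelIsCokernel f.hom) (tensorLeft A)

/-- The action on the cokernel. -/
def cokerAct : A ⊗ cokernel f.hom ⟶ cokernel f.hom :=
  (whiskerCokerIsColimit f).desc (CokernelCofork.ofπ (act N ≫ cokernel.π f.hom) (by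
    rw [← Category.assoc, act_hom, Category.assoc, cokernel.condition, comp_zero]))

@[simp]
theorem whisker_cokerAct : A ◁ cokernel.π f.hom ≫ cokerAct f = act N ≫ cokernel.π f.hom :=
  (whiskerCokerIsColimit f).fac _ WalkingParallelPair.one

theorem whisker_coker_cancel (X : C) {Z : C} {a b : X ⊗ cokernel f.hom ⟶ Z}
    (h : X ◁ cokernel.π f.hom ≫ a = X ◁ cokernel.π f.hom ≫ b) : a = b := by
  have : Epi (X ◁ cokernel.π f.hom) :=
    inferInstanceAs (Epi ((tensorLeft X).map (cokernel.π f.hom)))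
  exact (cancel_epi _).1 h

/-- The cokernel of a morphism of modules, with underlying object the cokernel in `C`. -/
def cokerMod : CategoryTheory.Mod C A :=
  mkMod (cokernel f.hom) (cokerAct f)
    (by
      apply whisker_coker_cancel
      rw [whisker_exchange_assoc, whisker_cokerAct, reassoc_of% (one_act N)]
      simp)
    (by
      apply whisker_coker_cancel
      rw [whisker_exchange_assoc, whisker_cokerAct, reassoc_of% (mul_act N)]
      have : (A ⊗ A) ◁ cokernel.π f.hom ≫ (α_ A A _).hom =
        (α_ A A _).hom ≫ A ◁ A ◁ cokernel.π f.hom := by simp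
      rw [reassoc_of% this, ← whiskerLeft_comp_assoc, whisker_cokerAct]
      simp)

def cokerModπ : N ⟶ cokerMod f :=
  mkHom (cokernel.π f.hom : N.X ⟶ cokernel f.hom) (whisker_cokerAct f)

theorem comp_cokerModπ : f ≫ cokerModπ f = 0 := modHom_ext (cokernel.condition f.hom)

theorem whisker_desc {X : C} (g : N.X ⟶ X) (hg : f.hom ≫ g = 0) :
    A ◁ cokernel.π f.hom ≫ A ◁ cokernel.desc f.hom g hg = A ◁ g := by
  rw [← whiskerLeft_comp, cokernel.π_desc]

theorem cokerAct_desc {T : CategoryTheory.Mod C A} (g : N ⟶ T) (hg : f.hom ≫ g.hom = 0) :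
    A ◁ cokernel.desc f.hom g.hom hg ≫ act T = cokerAct f ≫ cokernel.desc f.hom g.hom hg := by
  apply whisker_coker_cancel
  rw [reassoc_of% (whisker_desc f g.hom hg), act_hom, reassoc_of% (whisker_cokerAct f), cokernel.π_desc]

def cokerModDesc {T : CategoryTheory.Mod C A} (g : N ⟶ T) (hg : f.hom ≫ g.hom = 0) :
    cokerMod f ⟶ T :=
  mkHom (cokernel.desc f.hom g.hom hg : cokernel f.hom ⟶ T.X) (cokerAct_desc f g hg)

def cokerModIsColimit : IsColimit (CokernelCofork.ofπ (cokerModπ f) (comp_cokerModπ f)) :=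
  CokernelCofork.IsColimit.ofπ _ _
    (fun g hg => cokerModDesc f g (congrArg Mod.Hom.hom hg))
    (fun _ _ => modHom_ext (cokernel.π_desc _ _ _))
    (fun _ _ _ hm => modHom_ext ((cancel_epi (cokernel.π f.hom)).1
      ((congrArg Mod.Hom.hom hm).trans (cokernel.π_desc _ _ _).symm)))

instance modHasCokernels : HasCokernels (CategoryTheory.Mod C A) where
  has_colimit f := ⟨⟨⟨_, cokerModIsColimit f⟩⟩⟩

end KerCoker

instance modHasCoequalizers : HasCoequalizers (CategoryTheory.Mod C A) :=
  Preadditive.hasCoequalizers_of_hasCokernels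


section Restriction

variable {B : C} [MonObj B] (φ : A ⟶ B) [IsMonHom φ]

instance comap_additive : (Mod.comap (D := C) φ).Additive where
  map_add := modHom_ext rfl

instance forget_additive : (Mod.forget (D := C) A).Additive where
  map_add := rfl

instance forget_preservesKernel {M N : CategoryTheory.Mod C A} (f : M ⟶ N) :
    PreservesLimit (parallelPair f 0) (Mod.forget (D := C) A) :=
  preservesLimit_of_preserves_limit_cone (kerModIsLimit f)
    ((isLimitMapConeForkEquiv' _ (kerModι_comp f)).symm (kernelIsKernel f.hom))

instance forget_preservesCokernel {M N : CategoryTheory.Mod C A} (f : M ⟶ N) :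
    PreservesColimit (parallelPair f 0) (Mod.forget (D := C) A) :=
  preservesColimit_of_preserves_colimit_cocone (cokerModIsColimit f)
    ((isColimitMapCoconeCoforkEquiv' _ (comp_cokerModπ f)).symm (cokernelIsCokernel f.hom))

instance forget_reflectsIso : (Mod.forget (D := C) A).ReflectsIsomorphisms where
  reflects {M N} f hf := by
    have : IsIso f.hom := hf
    refine ⟨mkHom (inv f.hom) ?_, modHom_ext (IsIso.hom_inv_id f.hom),
      modHom_ext (IsIso.inv_hom_id f.hom)⟩
    rw [IsIso.eq_comp_inv, Category.assoc, ← act_hom, ← whiskerLeft_comp_assoc]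
    simp

instance comap_preservesKernel {M N : CategoryTheory.Mod C B} (f : M ⟶ N) :
    PreservesLimit (parallelPair f 0) (Mod.comap (D := C) φ) :=
  have : PreservesLimit (parallelPair f 0) (Mod.comap (D := C) φ ⋙ Mod.forget A) :=
    inferInstanceAs (PreservesLimit (parallelPair f 0) (Mod.forget B))
  have : ReflectsLimit (parallelPair ((Mod.comap (D := C) φ).map f) 0)
      (Mod.forget (D := C) A) := reflectsLimit_of_reflectsIsomorphisms _ _
  have : ReflectsLimit (parallelPair f 0 ⋙ Mod.comap (D := C) φ) (Mod.forget (D := C) A) :=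
    reflectsLimit_of_iso_diagram (K₁ := parallelPair ((Mod.comap (D := C) φ).map f) 0)
      (K₂ := parallelPair f 0 ⋙ Mod.comap (D := C) φ) _
      (parallelPair.ext (Iso.refl _) (Iso.refl _) (by simp) (by simp))
  preservesLimit_of_reflects_of_preserves (Mod.comap (D := C) φ) (Mod.forget A)

instance comap_preservesCokernel {M N : CategoryTheory.Mod C B} (f : M ⟶ N) :
    PreservesColimit (parallelPair f 0) (Mod.comap (D := C) φ) :=
  have : PreservesColimit (parallelPair f 0) (Mod.comap (D := C) φ ⋙ Mod.forget A) :=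
    inferInstanceAs (PreservesColimit (parallelPair f 0) (Mod.forget B))
  have : ReflectsColimit (parallelPair ((Mod.comap (D := C) φ).map f) 0)
      (Mod.forget (D := C) A) := reflectsColimit_of_reflectsIsomorphisms _ _
  have : ReflectsColimit (parallelPair f 0 ⋙ Mod.comap (D := C) φ) (Mod.forget (D := C) A) :=
    reflectsColimit_of_iso_diagram (K₁ := parallelPair ((Mod.comap (D := C) φ).map f) 0)
      (K₂ := parallelPair f 0 ⋙ Mod.comap (D := C) φ) _
      (parallelPair.ext (Iso.refl _) (Iso.refl _) (by simp) (by simp))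
  preservesColimit_of_reflects_of_preserves (Mod.comap (D := C) φ) (Mod.forget A)

variable (B) in
/-- The action on `B ⊗ V`. -/
def freeAct (V : C) : B ⊗ B ⊗ V ⟶ B ⊗ V := (α_ B B V).inv ≫ μ[B] ▷ V

theorem freeAct_natural {V W : C} (f : V ⟶ W) :
    B ◁ B ◁ f ≫ freeAct B W = freeAct B V ≫ B ◁ f := by
  simp only [freeAct, Category.assoc, ← whisker_exchange]
  simp

variable (B) in
/-- The free `B`-module `B ⊗ V`. -/
def freeMod (V : C) : CategoryTheory.Mod C B :=
  mkMod (B ⊗ V) (freeAct B V)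
    (by
      have : η[B] ▷ (B ⊗ V) ≫ (α_ B B V).inv = (α_ _ B V).inv ≫ η[B] ▷ B ▷ V := by simp
      rw [freeAct, reassoc_of% this, ← comp_whiskerRight, MonObj.one_mul]
      simp)
    (by
      have : μ[B] ▷ (B ⊗ V) ≫ (α_ B B V).inv = (α_ _ B V).inv ≫ μ[B] ▷ B ▷ V := by simp
      rw [freeAct, reassoc_of% this, ← comp_whiskerRight, MonObj.mul_assoc]
      simp)

variable (B) in
def freeMap {V W : C} (f : V ⟶ W) : freeMod B V ⟶ freeMod B W :=
  mkHom (B ◁ f : B ⊗ V ⟶ B ⊗ W) (freeAct_natural f)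

/-- The morphism `B ⊗ A ⊗ V ⟶ B ⊗ V` given by the action of `A` on `B` through `φ`. -/
def scale (V : C) : B ⊗ A ⊗ V ⟶ B ⊗ V := (α_ B A V).inv ≫ (B ◁ φ ≫ μ[B]) ▷ V

theorem scale_linear (V : C) :
    B ◁ scale φ V ≫ freeAct B V = freeAct B (A ⊗ V) ≫ scale φ V := by
  have h : (B ◁ (B ◁ φ ≫ μ[B])) ≫ μ[B] =
      (α_ B B A).inv ≫ μ[B] ▷ A ≫ B ◁ φ ≫ μ[B] := by
    rw [← whisker_exchange_assoc, MonObj.mul_assoc]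
    simp
  have h₁ : B ◁ (B ◁ φ ≫ μ[B]) ▷ V ≫ (α_ B B V).inv =
      (α_ B (B ⊗ A) V).inv ≫ (B ◁ (B ◁ φ ≫ μ[B])) ▷ V := by simp
  have h₂ : μ[B] ▷ (A ⊗ V) ≫ (α_ B A V).inv = (α_ (B ⊗ B) A V).inv ≫ μ[B] ▷ A ▷ V := by simp
  rw [scale, freeAct, freeAct, whiskerLeft_comp, Category.assoc, reassoc_of% h₁,
    ← comp_whiskerRight, h, Category.assoc, reassoc_of% h₂, ← comp_whiskerRight]
  simp only [comp_whiskerRight]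
  monoidal

theorem scale_natural {V W : C} (f : V ⟶ W) :
    scale φ V ≫ B ◁ f = B ◁ A ◁ f ≫ scale φ W := by
  rw [scale, scale, Category.assoc, ← whisker_exchange]
  simp

def freeScale (V : C) : freeMod B (A ⊗ V) ⟶ freeMod B V :=
  mkHom (scale φ V : B ⊗ A ⊗ V ⟶ B ⊗ V) (scale_linear φ V)

/-- The `B`-module `B ⊗_A M`, the coequalizer of the two canonical morphisms
`B ⊗ A ⊗ M ⟶ B ⊗ M`. -/
def extendObj (M : CategoryTheory.Mod C A) : CategoryTheory.Mod C B :=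
  coequalizer (freeMap B (act M)) (freeScale φ M.X)

def toExtend (M : CategoryTheory.Mod C A) : freeMod B M.X ⟶ extendObj φ M :=
  coequalizer.π _ _

instance toExtend_epi (M : CategoryTheory.Mod C A) : Epi (toExtend φ M) :=
  inferInstanceAs (Epi (coequalizer.π _ _))

theorem freeMap_comp {U V W : C} (f : U ⟶ V) (g : V ⟶ W) :
    freeMap B (f ≫ g) = freeMap B f ≫ freeMap B g := modHom_ext (whiskerLeft_comp _ _ _)

theorem freeMap_id (V : C) : freeMap B (𝟙 V) = 𝟙 _ := modHom_ext (whiskerLeft_id _ _)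

theorem freeMap_add {V W : C} (f g : V ⟶ W) :
    freeMap B (f + g) = freeMap B f + freeMap B g :=
  modHom_ext (MonoidalPreadditive.whiskerLeft_add _ _)

theorem freeScale_natural {V W : C} (f : V ⟶ W) :
    freeScale φ V ≫ freeMap B f = freeMap B (A ◁ f) ≫ freeScale φ W :=
  modHom_ext (scale_natural φ f)

theorem toExtend_condition (M : CategoryTheory.Mod C A) :
    freeMap B (act M) ≫ toExtend φ M = freeScale φ M.X ≫ toExtend φ M :=
  coequalizer.condition _ _

def extendMap {M N : CategoryTheory.Mod C A} (f : M ⟶ N) : extendObj φ M ⟶ extendObj φ N :=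
  coequalizer.desc (freeMap B f.hom ≫ toExtend φ N) (by
    rw [← Category.assoc, ← freeMap_comp, ← act_hom, freeMap_comp, Category.assoc,
      toExtend_condition, ← Category.assoc, ← Category.assoc, freeScale_natural])

theorem toExtend_map {M N : CategoryTheory.Mod C A} (f : M ⟶ N) :
    toExtend φ M ≫ extendMap φ f = freeMap B f.hom ≫ toExtend φ N :=
  coequalizer.π_desc _ _

/-- Extension of scalars `M ↦ B ⊗_A M`. -/
def extendScalars : CategoryTheory.Mod C A ⥤ CategoryTheory.Mod C B where
  obj M := extendObj φ M
  map f := extendMap φ f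
  map_id M := by
    rw [← cancel_epi (toExtend φ M), toExtend_map, Category.comp_id]
    exact (congrArg (· ≫ toExtend φ M) (freeMap_id _)).trans (Category.id_comp _)
  map_comp {L M N} f g := by
    rw [← cancel_epi (toExtend φ L), toExtend_map, ← Category.assoc, toExtend_map,
      Category.assoc, toExtend_map, ← Category.assoc, ← freeMap_comp]
    rfl

instance extendScalars_additive : (extendScalars φ).Additive where
  map_add {M N f g} := by
    change extendMap φ (f + g) = extendMap φ f + extendMap φ g
    rw [← cancel_epi (toExtend φ M), Preadditive.comp_add, toExtend_map, toExtend_map,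
      toExtend_map, ← Preadditive.add_comp, ← freeMap_add]
    rfl

end Restriction

end Modules

section Geometry

variable (C : Type u) [Category.{v} C] [Preadditive C] [HasFiniteLimits C] [HasFiniteColimits C]
  [MonoidalCategory C] [SymmetricCategory C] [MonoidalClosed C]

/-- Every projective object is flat: tensoring with it commutes with finite limits. -/
def ProjFlat : Prop := ∀ P : C, IsProj P → PreservesFiniteLimits (tensorLeft P)

/-- Affine schemes: the opposite of the category of commutative monoids. -/
abbrev Aff := (CommMon C)ᵒᵖ

variable {C}

/-- The category of modules over the ring of functions of `X`. -/
abbrev ModOn (X : Aff C) := CategoryTheory.Mod C X.unop.X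

variable {X Y : Aff C} (p : Y ⟶ X)

/-- The morphism from the ring of `X` to the ring of `Y`. -/
abbrev ringHom : X.unop.X ⟶ Y.unop.X := p.unop.hom.hom

instance ringHom_isMonHom : IsMonHom (ringHom p) := p.unop.hom.isMonHom_hom

abbrev pushforward : ModOn Y ⥤ ModOn X := Mod.comap (ringHom p)

abbrev pullbackFunctor : ModOn X ⥤ ModOn Y := extendScalars (ringHom p)

/-- `p` is a homotopy monomorphism if `p_* : D⁻(Y) ⥤ D⁻(X)` is fully faithful. -/
def IsHomotopyMono : Prop :=
  (mapDMinus (pushforward p)).Full ∧ (mapDMinus (pushforward p)).Faithful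

/-- The canonical morphism `Lp^* M ⟶ p^* M` is an isomorphism. The derived pullback is computed
by a projective resolution `P ⟶ M`, and the canonical morphism is then the image of the
augmentation under `p^*`. -/
def Transversal (M : ModOn X) : Prop :=
  ∃ (P : CochainComplex (ModOn X) ℤ)
    (π : P ⟶ (HomologicalComplex.single (ModOn X) (ComplexShape.up ℤ) 0).obj M),
    P.IsStrictlyLE 0 ∧ (∀ i, IsProj (P.X i)) ∧ StrictQuasiIso π ∧
      StrictQuasiIso (((pullbackFunctor p).mapHomologicalComplex (ComplexShape.up ℤ)).map π)

/-- Homotopy Zariski transversal full subcategories. -/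
structure IsHomotopyZariskiTransversal (A : ObjectProperty (Aff C)) : Prop where
  fiberProduct {X Y Z : Aff C} (f : X ⟶ Z) (g : Y ⟶ Z) : A X → A Y → A Z →
    ∃ (W : Aff C) (fst : W ⟶ X) (snd : W ⟶ Y), A W ∧ IsPullback fst snd f g
  transversal {X Y Z : Aff C} (p : Y ⟶ X) (q : Z ⟶ X) : A X → A Y → A Z → IsHomotopyMono p →
    Transversal p ((pushforward q).obj (Mod.regular Z.unop.X))

/-- RR-quasi-coherent modules. -/
def IsRR (A : ObjectProperty (Aff C)) (X : Aff C) : ObjectProperty (ModOn X) := fun M =>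
  ∀ ⦃Y : Aff C⦄ (p : Y ⟶ X), A Y → IsHomotopyMono p → Transversal p M

/-- A family of functors on a category is conservative if it jointly detects isomorphisms. -/
def ConservativeFamily {D : Type u'} [Category.{v'} D] {I : Type*} {E : I → Type*}
    [∀ i, Category (E i)] (F : ∀ i, D ⥤ E i) : Prop :=
  ∀ ⦃M N : D⦄ (f : M ⟶ N), IsIso f ↔ ∀ i, IsIso ((F i).map f)

/-- The covering families of the formal homotopy Zariski topology. -/
def IsCoveringFamily (A : ObjectProperty (Aff C)) {X : A.FullSubcategory} {I : Type*}
    {Y : I → A.FullSubcategory} (p : ∀ i, Y i ⟶ X) : Prop :=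
  (∀ i, IsHomotopyMono (p i).hom) ∧
    ∃ J : Finset I, ConservativeFamily
      (fun i : J => (IsRR A X.obj).ι ⋙ pullbackFunctor (p i).hom)

end Geometry

end RelGeom

set_option linter.unusedSectionVars false

/-! ### Strict epimorphisms and strict exactness, tested on projectives -/

namespace RelGeom

section StrictMorphisms

variable {E : Type u} [Category.{v} E] [Preadditive E] [HasKernels E] [HasCokernels E]

/-! Everything is tested on projectives. In a quasi-abelian category with enough projectives, a
morphism is a strict epimorphism exactly when all projectives lift along it, so a complex is
strictly exact iff the morphisms into it from each projective form an exact complex. Module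
categories inherit this through the forgetful functor (`DetectedByProj`, `modDetectedByProj`). Hence
the acyclic complexes are the right orthogonal of the shifted projectives
(`acyclics_eq_rightOrthogonal`), the derived category is a Verdier quotient, and morphisms in it out
of a bounded above complex of projectives are homotopy classes.

`GoodObj F M` says that `LF M ⟶ F M` is invertible. For right exact `F`, bounded above complexes of
good objects compute `LF` (`Good.of_goodObj`). By adjunction, restriction is fully faithful on `D⁻`
iff the derived counit `LF (G K) ⟶ K` is an isomorphism for every bounded above `K`
(`strictQuasiIso_of_full_faithful`, `full_faithful_of_strictQuasiIso`).

Pullback of RR modules: let `P` be a projective resolution of `M`. As `M` is RR, `p^* P` is a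
projective resolution of `p^* M`; as `q ≫ p` is again a homotopy monomorphism, `q^* p^* P ≅ (q ≫
p)^* P` resolves `q^* p^* M` (`IsRR.pullback`).

The topology rests on derived base change. A pushout of commutative monoids is a relative tensor
product, so `p^* q_* ≅ fst_* snd^*` holds before deriving (`isIso_baseChange`). To derive it over `R
⟶ T`, resolve `T`-modules by free modules `T ⊗ V` with `V` projective: since `V` is flat, goodness
of `T` over `R`, which is the transversality hypothesis, passes to `T ⊗ V`
(`goodObj_comap_freeMod`). Therefore homotopy monomorphisms are stable under base change
(`IsHomotopyEpi.baseChange`) and pushforward preserves RR modules (`IsRR.pushforward`).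

A base-changed covering is then conservative: if `g` becomes invertible on all the fibre products,
then by base change its pushforward becomes invertible on each member of the given covering, so the
pushforward of `g` is an isomorphism, and so is `g`. Composites of coverings are conservative
because pullback to a member preserves RR modules. -/

theorem isStrictEpi_iff {X Y : E} (f : X ⟶ Y) :
    IsStrictEpi f ↔ Epi f ∧ ∀ ⦃T : E⦄ (t : X ⟶ T), kernel.ι f ≫ t = 0 → ∃ s, f ≫ s = t := by
  constructor
  · rintro ⟨hf, hepi⟩
    refine ⟨hepi, fun T t ht => ?_⟩
    have : IsIso (Abelian.coimageImageComparison f) := hf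
    have h0 : cokernel.π f = 0 := by rw [← cancel_epi f]; simp
    have : IsIso (Abelian.image.ι f) := by
      refine ⟨kernel.lift _ (𝟙 Y) (by rw [h0, comp_zero]), ?_, by simp⟩
      rw [← cancel_mono (kernel.ι _)]
      simp
    -- As `f` is epi, its image is all of `Y`; strictness then identifies `Y` with the coimage,
    -- through which `t` factors.
    refine ⟨inv (Abelian.image.ι f) ≫ inv (Abelian.coimageImageComparison f) ≫
      cokernel.desc _ t ht, ?_⟩
    have h := Abelian.coimage_image_factorisation f
    have h' : f ≫ inv (Abelian.image.ι f) ≫ inv (Abelian.coimageImageComparison f) =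
        Abelian.coimage.π f := by
      rw [← Category.assoc, IsIso.comp_inv_eq, IsIso.comp_inv_eq, Category.assoc, h]
    rw [reassoc_of% h']
    simp
  · rintro ⟨hepi, hd⟩
    refine ⟨?_, hepi⟩
    obtain ⟨s, hs⟩ := hd (Abelian.coimage.π f) (cokernel.condition _)
    have h := Abelian.coimage_image_factorisation f
    have hs' : s ≫ Abelian.coimageImageComparison f ≫ Abelian.image.ι f = 𝟙 _ := by
      rw [← cancel_epi f, reassoc_of% hs, h, Category.comp_id]
    refine ⟨Abelian.image.ι f ≫ s, ?_, ?_⟩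
    · rw [← cancel_epi (Abelian.coimage.π f), reassoc_of% h, hs, Category.comp_id]
    · rw [← cancel_mono (Abelian.image.ι f)]
      simp [hs']

theorem IsStrictEpi.desc {X Y T : E} {f : X ⟶ Y} (hf : IsStrictEpi f) (t : X ⟶ T)
    (ht : kernel.ι f ≫ t = 0) : ∃ s, f ≫ s = t :=
  ((isStrictEpi_iff f).1 hf).2 t ht

/-- Any `k` annihilated by `f` factors through the kernel, so it may stand in for the kernel in the
criterion. -/
theorem isStrictEpi_of_desc {X Y W : E} {f : X ⟶ Y} (k : W ⟶ X) (hk : k ≫ f = 0) (hf : Epi f)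
    (hd : ∀ ⦃T : E⦄ (t : X ⟶ T), k ≫ t = 0 → ∃ s, f ≫ s = t) : IsStrictEpi f :=
  (isStrictEpi_iff f).2 ⟨hf, fun T t ht => hd t (by
    rw [← kernel.lift_ι f k hk, Category.assoc, ht, comp_zero])⟩

theorem isStrictEpi_of_isColimit {X Y W : E} {g : W ⟶ X} {f : X ⟶ Y} (w : g ≫ f = 0)
    (h : IsColimit (CokernelCofork.ofπ f w)) : IsStrictEpi f :=
  isStrictEpi_of_desc g w (Cofork.IsColimit.epi h) fun _ t ht =>
    ⟨_, (CokernelCofork.IsColimit.desc' h t ht).2⟩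

theorem isStrictEpi_of_splitEpi {X Y : E} (f : X ⟶ Y) (s : Y ⟶ X) (h : s ≫ f = 𝟙 Y) :
    IsStrictEpi f :=
  (isStrictEpi_iff f).2 ⟨⟨fun a b hab => by
    rw [← Category.id_comp a, ← Category.id_comp b, ← h, Category.assoc, hab, Category.assoc]⟩,
    -- `f ≫ s - 𝟙 X` lands in the kernel of `f`, so `t` kills it.
    fun T t ht => ⟨s ≫ t, by
      have : kernel.lift f (f ≫ s - 𝟙 X) (by simp [h]) ≫ kernel.ι f ≫ t = 0 := by
        rw [ht, comp_zero]
      rw [kernel.lift_ι_assoc, Preadditive.sub_comp, Category.id_comp, sub_eq_zero] at this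
      simpa using this⟩⟩

/-- The morphism from `X₁` to the kernel is the coimage projection followed by the comparison
morphism and `imageToKer`. The projection is a cokernel, so the composite is a strict epimorphism
exactly when the last two compose to an isomorphism; as `imageToKer` is mono, each of them is then
invertible. -/
theorem strictlyExact_iff (S : ShortComplex E) :
    StrictlyExact S ↔ IsStrictEpi (kernel.lift S.g S.f S.zero) := by
  have h := Abelian.coimage_image_factorisation S.f
  have hi : imageToKer S.f S.g S.zero ≫ kernel.ι S.g = Abelian.image.ι S.f := kernel.lift_ι _ _ _
  have hp : Abelian.coimage.π S.f ≫ Abelian.coimageImageComparison S.f ≫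
      imageToKer S.f S.g S.zero = kernel.lift S.g S.f S.zero := by
    rw [← cancel_mono (kernel.ι S.g)]
    simp [hi]
  constructor
  · rintro ⟨h₁, h₂⟩
    have : IsIso (Abelian.coimageImageComparison S.f) := h₁
    rw [← hp]
    refine isStrictEpi_of_desc (kernel.ι S.f) ?_ inferInstance fun T t ht => ?_
    · rw [hp, ← cancel_mono (kernel.ι S.g)]
      simp
    · refine ⟨inv (imageToKer S.f S.g S.zero) ≫ inv (Abelian.coimageImageComparison S.f) ≫
        cokernel.desc _ t ht, ?_⟩
      simp
  · intro hs
    have := hs.2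
    obtain ⟨s, hs⟩ := hs.desc (Abelian.coimage.π S.f) (by
      have : kernel.ι (kernel.lift S.g S.f S.zero) ≫ S.f = 0 := by
        have := kernel.condition (kernel.lift S.g S.f S.zero) =≫ kernel.ι S.g
        rwa [Category.assoc, kernel.lift_ι, zero_comp] at this
      rw [← kernel.lift_ι S.f _ this, Category.assoc, cokernel.condition, comp_zero])
    have h₁ : Abelian.coimageImageComparison S.f ≫ imageToKer S.f S.g S.zero ≫ s = 𝟙 _ := by
      rw [← cancel_epi (Abelian.coimage.π S.f), reassoc_of% hp, hs, Category.comp_id]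
    have h₂ : s ≫ Abelian.coimageImageComparison S.f ≫ imageToKer S.f S.g S.zero = 𝟙 _ := by
      rw [← cancel_epi (kernel.lift S.g S.f S.zero), reassoc_of% hs, hp, Category.comp_id]
    have : Mono (imageToKer S.f S.g S.zero) := by
      have : Mono (imageToKer S.f S.g S.zero ≫ kernel.ι S.g) := by rw [hi]; infer_instance
      exact mono_of_mono _ (kernel.ι S.g)
    have h₃ : IsIso (imageToKer S.f S.g S.zero) :=
      ⟨s ≫ Abelian.coimageImageComparison S.f, by
        rw [← cancel_mono (imageToKer S.f S.g S.zero)]; simp [h₂], by simpa using h₂⟩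
    refine ⟨?_, h₃⟩
    refine ⟨imageToKer S.f S.g S.zero ≫ s, h₁, ?_⟩
    rw [← cancel_mono (imageToKer S.f S.g S.zero)]
    simp [h₂]

variable (E) in
/-- Projective objects detect strict epimorphisms. -/
class DetectedByProj : Prop where
  enough : EnoughProj E
  cancel {X Y Z : E} (f : X ⟶ Y) (g : Y ⟶ Z) : IsStrictEpi (f ≫ g) → IsStrictEpi g

/-- Only the stability of strict epimorphisms under pullback enters: the pullback of `g ≫ f` along
`f` covers `Y`, and on this cover one can test that the descent of `g ≫ t` along `g ≫ f` is also a
descent of `t` along `f`. -/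
theorem QuasiAbelian.detectedByProj [HasPullbacks E] (hE : QuasiAbelian E) (h : EnoughProj E) :
    DetectedByProj E where
  enough := h
  cancel {X Y Z} g f hgf := by
    have hpb := IsPullback.of_hasPullback (g ≫ f) f
    have hs := hE.strictEpi_baseChange hpb hgf
    have := hs.2
    have := hgf.2
    have hf : Epi f := epi_of_epi g f
    refine (isStrictEpi_iff f).2 ⟨hf, fun T t ht => ?_⟩
    have ht' {W : E} (k : W ⟶ Y) (hk : k ≫ f = 0) : k ≫ t = 0 := by
      rw [← kernel.lift_ι f k hk, Category.assoc, ht, comp_zero]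
    obtain ⟨s, hs⟩ := hgf.desc (g ≫ t) (by
      rw [← Category.assoc]; exact ht' _ (by rw [Category.assoc, kernel.condition]))
    refine ⟨s, ?_⟩
    -- The two morphisms from the pullback to `Y`, through `g` and directly, have a difference that
    -- `f` kills and hence `t` kills.
    rw [← cancel_epi (pullback.snd (g ≫ f) f), ← reassoc_of% (pullback.condition (f := g ≫ f)
      (g := f)), ← Category.assoc g f s, hs, ← sub_eq_zero, ← Category.assoc,
      ← Preadditive.sub_comp]
    exact ht' _ (by simp [pullback.condition])

section Detected

variable (hE : DetectedByProj E)
include hE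

/-- Conversely to lifting, a projective cover of `Y` that factors through `f` passes its strictness
on to `f` by `cancel`. -/
theorem DetectedByProj.isStrictEpi_iff {X Y : E} (f : X ⟶ Y) :
    IsStrictEpi f ↔ ∀ ⦃V : E⦄, IsProj V → ∀ x : V ⟶ Y, ∃ y, y ≫ f = x := by
  refine ⟨fun hf V hV x => hV f hf x, fun h => ?_⟩
  obtain ⟨V, e, hV, he⟩ := hE.enough Y
  obtain ⟨y, rfl⟩ := h hV e
  exact hE.cancel _ _ he

theorem DetectedByProj.strictlyExact_iff (S : ShortComplex E) :
    StrictlyExact S ↔ ∀ ⦃V : E⦄, IsProj V → ∀ x : V ⟶ S.X₂, x ≫ S.g = 0 →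
      ∃ y, y ≫ S.f = x := by
  rw [RelGeom.strictlyExact_iff, hE.isStrictEpi_iff]
  refine forall_congr' fun V => forall_congr' fun hV => ⟨fun h x hx => ?_, fun h x => ?_⟩
  · obtain ⟨y, hy⟩ := h (kernel.lift _ x hx)
    refine ⟨y, ?_⟩
    simpa using hy =≫ kernel.ι S.g
  · obtain ⟨y, hy⟩ := h (x ≫ kernel.ι _) (by simp)
    exact ⟨y, by rw [← cancel_mono (kernel.ι S.g)]; simpa using hy⟩

/-- Morphisms from projectives play the role of elements, and chases with them replace diagram
arguments in the quasi-abelian setting. -/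
theorem DetectedByProj.strictlyAcyclic_iff (K : CochainComplex E ℤ) :
    StrictlyAcyclic K ↔ ∀ ⦃V : E⦄, IsProj V → ∀ (i j k : ℤ), i + 1 = j → j + 1 = k →
      ∀ x : V ⟶ K.X j, x ≫ K.d j k = 0 → ∃ y, y ≫ K.d i j = x := by
  unfold StrictlyAcyclic
  simp only [hE.strictlyExact_iff]
  constructor
  · intro h V hV i j k hi hk x hx
    obtain rfl : (ComplexShape.up ℤ).prev j = i := (ComplexShape.up ℤ).prev_eq' hi
    obtain rfl : (ComplexShape.up ℤ).next j = k := (ComplexShape.up ℤ).next_eq' hk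
    exact h j hV x hx
  · intro h j V hV x hx
    exact h hV _ j _ (by simp) (by simp) x hx

end Detected

end StrictMorphisms

end RelGeom

/-! ### The homotopy category, acyclic complexes and K-projective objects -/

namespace RelGeom

open CochainComplex.HomComplex Pretriangulated

section HomotopyCategoryLemmas

variable {E : Type u} [Category.{v} E] [Preadditive E] [HasKernels E] [HasCokernels E]
  [HasZeroObject E] [HasBinaryBiproducts E]

/-- A morphism of complexes, viewed in the homotopy category. -/
abbrev toK (E : Type u) [Category.{v} E] [Preadditive E] :
    CochainComplex E ℤ ⥤ HomotopyCategory E (ComplexShape.up ℤ) :=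
  HomotopyCategory.quotient E (ComplexShape.up ℤ)

/-- A `V`-point of the cone in degree `j` is a pair of points, of `K` in degree `j + 1` and of `L`
in degree `j`. The criterion spells out that every cocycle of this kind is a coboundary; passing
from `a` to `-a` absorbs the sign in the cone differential. -/
theorem strictQuasiIso_iff [hE : DetectedByProj E] {K L : CochainComplex E ℤ} (φ : K ⟶ L) :
    StrictQuasiIso φ ↔ ∀ ⦃V : E⦄, IsProj V → ∀ (i j k l : ℤ), i + 1 = j → j + 1 = k → k + 1 = l →
      ∀ (a : V ⟶ K.X k) (b : V ⟶ L.X j), a ≫ K.d k l = 0 → a ≫ φ.f k = b ≫ L.d j k →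
        ∃ (a' : V ⟶ K.X j) (b' : V ⟶ L.X i), a' ≫ K.d j k = a ∧
          a' ≫ φ.f j + b' ≫ L.d i j = b := by
  unfold StrictQuasiIso
  rw [hE.strictlyAcyclic_iff]
  open CochainComplex.mappingCone in
  constructor
  · intro h V hV i j k l hij hjk hkl a b ha hab
    obtain ⟨y, hy⟩ := h hV i j k hij hjk (-a ≫ (inl φ).v k j (by lia) + b ≫ (inr φ).f j) (by
      simp [inl_v_d φ k j l (by lia) (by lia), reassoc_of% ha, reassoc_of% hab])
    obtain ⟨a', b', rfl⟩ := decomp_to φ y j hij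
    simp only [Preadditive.add_comp, Category.assoc, inl_v_d φ j i k (by lia) (by lia), inr_f_d,
      Preadditive.comp_sub] at hy
    refine ⟨a', b', ?_, ?_⟩
    · simpa using hy =≫ (fst φ).1.v j k hjk
    · simpa using hy =≫ (snd φ).v j j (add_zero j)
  · intro h V hV i j k hij hjk x hx
    obtain ⟨a, b, rfl⟩ := decomp_to φ x k hjk
    simp only [Preadditive.add_comp, Category.assoc, inl_v_d φ k j (k + 1) (by lia) (by lia),
      inr_f_d, Preadditive.comp_sub] at hx
    obtain ⟨a', b', h₁, h₂⟩ := h hV i j k (k + 1) hij hjk rfl (-a) b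
      (by simpa using hx =≫ (fst φ).1.v k (k + 1) rfl) (by
        have := hx =≫ (snd φ).v k k (add_zero k)
        simp at this
        rw [Preadditive.neg_comp, neg_eq_iff_add_eq_zero, this])
    refine ⟨a' ≫ (inl φ).v j i (by lia) + b' ≫ (inr φ).f i, ?_⟩
    simp only [Preadditive.add_comp, Category.assoc, inl_v_d φ j i k (by lia) (by lia), inr_f_d,
      Preadditive.comp_sub, reassoc_of% h₁]
    rw [← h₂]
    simp
    abel

theorem single_hom_eq_zero_iff {V : E} {K : CochainComplex E ℤ} {j : ℤ} (i : ℤ) (hi : i + 1 = j)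
    (f : (CochainComplex.singleFunctor E j).obj V ⟶ K) :
    (toK E).map f = 0 ↔ ∃ y : V ⟶ K.X i,
      y ≫ K.d i j = (HomologicalComplex.singleObjXSelf (.up ℤ) j V).inv ≫ f.f j := by
  have hf : Cochain.ofHom f = Cochain.fromSingleMk
      ((HomologicalComplex.singleObjXSelf (.up ℤ) j V).inv ≫ f.f j) (add_zero j) := by
    apply (Cochain.fromSingleEquiv (add_zero j)).injective
    rw [Cochain.fromSingleEquiv_fromSingleMk]
    simp [Cochain.fromSingleEquiv]
  constructor
  · intro h
    obtain ⟨z, hz⟩ := Cochain.equivHomotopy _ _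
      (HomotopyCategory.homotopyOfEq f 0 (by rw [h, Functor.map_zero]))
    obtain ⟨y, rfl⟩ := Cochain.fromSingleMk_surjective z i (by lia)
    refine ⟨y, ?_⟩
    rw [hf, Cochain.ofHom_zero, add_zero, Cochain.δ_fromSingleMk y _ 0 j (by lia)] at hz
    exact ((Cochain.fromSingleEquiv (add_zero j)).symm.injective hz).symm
  · rintro ⟨y, hy⟩
    rw [← (toK E).map_zero]
    refine HomotopyCategory.eq_of_homotopy _ _ ((Cochain.equivHomotopy _ _).symm
      ⟨Cochain.fromSingleMk y (by lia), ?_⟩)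
    rw [hf, Cochain.ofHom_zero, add_zero, Cochain.δ_fromSingleMk y (by lia) 0 j (by lia), hy]

variable (E) in
/-- Shifts of projective objects, in the homotopy category. -/
def projSingles : ObjectProperty (KCat E) := fun X =>
  ∃ (V : E) (n : ℤ), IsProj V ∧ Nonempty (X ≅ (HomotopyCategory.singleFunctor E n).obj V)

instance : (projSingles E).IsStableUnderShift ℤ where
  isStableUnderShiftBy m := ⟨by
    rintro X ⟨V, n, hV, ⟨e⟩⟩
    exact ⟨V, n - m, hV, ⟨(shiftFunctor _ m).mapIso e ≪≫
      ((HomotopyCategory.singleFunctors E).shiftIso m (n - m) n (by lia)).app V⟩⟩⟩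

/-- A morphism from `V` placed in degree `j` is a `V`-valued cocycle, null-homotopic iff it is a
coboundary. The point of this description is that the right orthogonal of a shift-stable class is a
triangulated subcategory, so the calculus of Verdier quotients applies to `DCat`. -/
theorem acyclics_eq_rightOrthogonal [hE : DetectedByProj E] :
    acyclics E = (projSingles E).rightOrthogonal := by
  ext K
  obtain ⟨K, rfl⟩ := HomotopyCategory.quotient_obj_surjective K
  change StrictlyAcyclic K ↔ _
  rw [hE.strictlyAcyclic_iff]
  constructor
  · rintro h X f ⟨V, j, hV, ⟨e⟩⟩
    rw [← cancel_epi e.inv, comp_zero]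
    obtain ⟨g, hg⟩ := (toK E).map_surjective (X := (CochainComplex.singleFunctor E j).obj V)
      (e.inv ≫ f)
    refine hg.symm.trans ?_
    obtain ⟨y, hy⟩ := h hV (j - 1) j (j + 1) (by lia) rfl
      ((HomologicalComplex.singleObjXSelf (.up ℤ) j V).inv ≫ g.f j) (by
        erw [Category.assoc, g.comm]
        rw [CochainComplex.singleFunctor_obj_d, zero_comp]
        exact comp_zero)
    exact (single_hom_eq_zero_iff (j - 1) (by lia) g).2 ⟨y, hy⟩
  · intro h V hV i j k hi hk x hx
    have := h ((toK E).map (HomologicalComplex.mkHomFromSingle x (by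
      rintro _ h
      obtain rfl : k = _ := hk.symm.trans h
      exact hx))) ⟨V, j, hV, ⟨Iso.refl _⟩⟩
    obtain ⟨y, hy⟩ := (single_hom_eq_zero_iff i hi _).1 this
    exact ⟨y, by simpa using hy⟩

instance [DetectedByProj E] : (acyclics E).IsTriangulated := by
  rw [acyclics_eq_rightOrthogonal]
  infer_instance

instance [DetectedByProj E] : (acyclics E).IsClosedUnderIsomorphisms := by
  rw [acyclics_eq_rightOrthogonal]
  infer_instance

theorem trW_map_iff [DetectedByProj E] {K L : CochainComplex E ℤ} (φ : K ⟶ L) :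
    (acyclics E).trW ((toK E).map φ) ↔ StrictQuasiIso φ :=
  (acyclics E).trW_iff_of_distinguished _ (HomotopyCategory.mappingCone_triangleh_distinguished φ)

variable (E) in
/-- The objects of the homotopy category without nonzero morphisms to acyclic complexes. -/
abbrev kProj : ObjectProperty (KCat E) := (acyclics E).leftOrthogonal

theorem projSingles_le_kProj [DetectedByProj E] : projSingles E ≤ kProj E := by
  intro X hX Y f hY
  rw [acyclics_eq_rightOrthogonal] at hY
  exact hY f hX

theorem kProj_lift_bijective [DetectedByProj E] {R X Y : KCat E} (hR : kProj E R) {t : X ⟶ Y}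
    (ht : (acyclics E).trW t) : Function.Bijective (fun f : R ⟶ X => f ≫ t) := by
  rw [kProj, ← ObjectProperty.isColocal_trW] at hR
  exact hR _ ht

theorem kProj_toD_bijective [DetectedByProj E] {R : KCat E} (hR : kProj E R) (X : KCat E) :
    Function.Bijective ((toD E).map : (R ⟶ X) → _) :=
  hR.map_bijective_of_isTriangulated (toD E) X

/-- The cone receives no nonzero morphism from a shifted projective `V`: injectivity at `V[-1]`
kills the component in `X[1]`, so the morphism comes from `Y`, and by surjectivity from `X`, whence
it is zero. -/
theorem trW_of_bijective [DetectedByProj E] {X Y : KCat E} (f : X ⟶ Y)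
    (hV : ∀ ⦃V : KCat E⦄, projSingles E V → Function.Bijective (fun g : V ⟶ X => g ≫ f)) :
    (acyclics E).trW f := by
  obtain ⟨Z, g, h, hT⟩ := distinguished_cocone_triangle f
  refine ⟨Z, g, h, hT, ?_⟩
  rw [acyclics_eq_rightOrthogonal]
  intro V x hx
  have hx' : x ≫ h = 0 := by
    obtain ⟨w, hw⟩ := (shiftFunctor (KCat E) (1 : ℤ)).map_surjective
      ((shiftNegShift V (1 : ℤ)).hom ≫ x ≫ h)
    have hw0 : w ≫ f = 0 := by
      apply (shiftFunctor (KCat E) (1 : ℤ)).map_injective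
      rw [Functor.map_comp, hw, Functor.map_zero, Category.assoc, Category.assoc]
      have : h ≫ f⟦(1 : ℤ)⟧' = 0 := comp_distTriang_mor_zero₃₁ _ hT
      rw [this, comp_zero, comp_zero]
    have : w = 0 := (hV ((projSingles E).le_shift (-1 : ℤ) _ hx)).1 (by simpa using hw0)
    rw [← cancel_epi (shiftNegShift V (1 : ℤ)).hom, ← hw, this, Functor.map_zero, comp_zero]
  obtain ⟨y, hy⟩ : ∃ y : V ⟶ Y, x = y ≫ g := Triangle.coyoneda_exact₃ _ hT x hx'
  obtain ⟨z, rfl⟩ := (hV hx).2 y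
  have : f ≫ g = 0 := comp_distTriang_mor_zero₁₂ _ hT
  simp [hy, this]

/-- Morphisms out of shifted projectives are the same before and after localization, so an
isomorphism in `DCat` is already seen as a bijection on them. This makes `trW` saturated and gives
cancellation for quasi-isomorphisms. -/
theorem trW_iff_isIso_toD [DetectedByProj E] {X Y : KCat E} (f : X ⟶ Y) :
    (acyclics E).trW f ↔ IsIso ((toD E).map f) := by
  refine ⟨fun hf => (acyclics E).trW.Q_inverts _ hf, fun hf => trW_of_bijective f fun V hV => ?_⟩
  have h₁ := kProj_toD_bijective (projSingles_le_kProj _ hV) X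
  have h₂ := kProj_toD_bijective (projSingles_le_kProj _ hV) Y
  rw [← h₂.of_comp_iff']
  have : (toD E).map ∘ (fun g : V ⟶ X => g ≫ f) =
      (fun g => g ≫ (toD E).map f) ∘ (toD E).map := by
    ext; simp
  rw [this, Function.Bijective.of_comp_iff _ h₁]
  exact ⟨fun a b h => (cancel_mono ((toD E).map f)).1 h,
    fun b => ⟨b ≫ inv ((toD E).map f), by simp⟩⟩

theorem trW_of_comp_left [DetectedByProj E] {X Y Z : KCat E} {f : X ⟶ Y} {g : Y ⟶ Z}
    (hf : (acyclics E).trW f) (hfg : (acyclics E).trW (f ≫ g)) : (acyclics E).trW g := by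
  rw [trW_iff_isIso_toD] at *
  rw [Functor.map_comp] at hfg
  exact IsIso.of_isIso_comp_left ((toD E).map f) _

theorem trW_comp [DetectedByProj E] {X Y Z : KCat E} {f : X ⟶ Y} {g : Y ⟶ Z}
    (hf : (acyclics E).trW f) (hg : (acyclics E).trW g) : (acyclics E).trW (f ≫ g) :=
  MorphismProperty.comp_mem _ _ _ hf hg

end HomotopyCategoryLemmas

end RelGeom

/-! ### Resolutions of bounded above complexes -/

namespace RelGeom

open CochainComplex.HomComplex Pretriangulated

section Resolutions

variable {E : Type u} [Category.{v} E] [Preadditive E] [HasKernels E] [HasCokernels E]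
  [HasZeroObject E] [HasBinaryBiproducts E]

open Classical in
/-- Components of a contraction of `f`, constructed by descending induction. -/
def contraction {P N : CochainComplex E ℤ} (f : P ⟶ N) : ℕ → ∀ i j : ℤ, P.X i ⟶ N.X j
  | 0, _, _ => 0
  | k + 1, i, j =>
    if h : ∃ y : P.X i ⟶ N.X j, y ≫ N.d j i = f.f i - P.d i (i + 1) ≫ contraction f k (i + 1) i
    then h.choose else 0

/-- The counter `k` is the distance of `i` below `n + 1`, where `P` vanishes; so the recursion may
start from zero and the truncated `k - 1` at `k = 0` is harmless. At each step the right-hand side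
is a cocycle of an acyclic complex with projective source, hence a coboundary, and the default
branch of `contraction` is not taken. -/
theorem contraction_spec [hE : DetectedByProj E] {P N : CochainComplex E ℤ} (n : ℤ)
    (hP : ∀ i, n < i → IsZero (P.X i)) (hproj : ∀ i, IsProj (P.X i)) (hN : StrictlyAcyclic N)
    (f : P ⟶ N) (k : ℕ) (i j : ℤ) (hi : n + 1 = i + k) (hj : j + 1 = i) :
    contraction f k i j ≫ N.d j i =
      f.f i - P.d i (i + 1) ≫ contraction f (k - 1) (i + 1) i := by
  induction k generalizing i j with
  | zero => exact (hP i (by lia)).eq_of_src _ _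
  | succ k ih =>
    have h : ∃ y : P.X i ⟶ N.X j,
        y ≫ N.d j i = f.f i - P.d i (i + 1) ≫ contraction f k (i + 1) i := by
      refine (hE.strictlyAcyclic_iff N).1 hN (hproj i) j i (i + 1) hj rfl _ ?_
      rw [Preadditive.sub_comp, Category.assoc, ih (i + 1) i (by lia) rfl,
        Preadditive.comp_sub, f.comm]
      simp
    rw [contraction, dif_pos h, h.choose_spec, Nat.add_sub_cancel]

theorem kProj_of_isProj [hE : DetectedByProj E] {P : CochainComplex E ℤ} (n : ℤ)
    [hP : P.IsStrictlyLE n] (hproj : ∀ i, IsProj (P.X i)) : kProj E ((toK E).obj P) := by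
  intro N f hN
  obtain ⟨N, rfl⟩ := HomotopyCategory.quotient_obj_surjective N
  obtain ⟨f, rfl⟩ := (toK E).map_surjective f
  rw [CochainComplex.isStrictlyLE_iff] at hP
  have hz (i : ℤ) (hi : n < i) := hP i hi
  rw [← (toK E).map_zero]
  -- Degree `p` is reached after `n + 1 - p` steps; above `n` the source is zero, so the truncation
  -- by `toNat` has no effect.
  refine HomotopyCategory.eq_of_homotopy _ _ ((Cochain.equivHomotopy _ _).symm
    ⟨Cochain.mk fun p q _ => contraction f (n + 1 - p).toNat p q, ?_⟩)
  ext p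
  rw [Cochain.ofHom_zero, add_zero, Cochain.ofHom_v,
    δ_v (-1) 0 (by lia) _ p p (by lia) (p - 1) (p + 1) rfl rfl]
  simp only [Cochain.mk_v]
  by_cases hp : n < p
  · exact (hz p hp).eq_of_src _ _
  · have h := contraction_spec n hz hproj hN f (n + 1 - p).toNat p (p - 1) (by lia) (by lia)
    rw [show (n + 1 - p).toNat - 1 = (n + 1 - (p + 1)).toNat by lia] at h
    change _ ≫ N.d (p - 1) p = _ at h
    simp only [Int.negOnePow_zero, one_smul]
    exact (sub_add_cancel _ _).symm.trans (congrArg (· + _) h.symm)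

end Resolutions

section ResolutionConstruction

variable {E : Type u} [Category.{v} E] [Preadditive E] [HasKernels E] [HasCokernels E]
  [HasBinaryBiproducts E] (N : ChainComplex E ℕ) {cov : E → E} (e : ∀ X, cov X ⟶ X)

/-- A stage in the construction of a resolution. -/
structure ResolutionStage (k : ℕ) where
  Z : E
  ε : N.X (k + 1) ⟶ Z
  π : Z ⟶ N.X k
  w : N.d (k + 2) (k + 1) ≫ ε = 0
  hπ : ε ≫ π = N.d (k + 1) k

variable {N}

/-- The morphism whose kernel is the next stage. -/
abbrev ResolutionStage.toZ {k : ℕ} (S : ResolutionStage N k) : cov S.Z ⊞ N.X (k + 1) ⟶ S.Z :=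
  biprod.fst ≫ e S.Z - biprod.snd ≫ S.ε

/-- The new `Z` is the fibre product of `cov S.Z` and `N.X (k + 1)` over `S.Z`. It represents the
cocycles of the cone of the resolution built so far, so covering it by the next term turns those
cocycles into coboundaries. -/
def ResolutionStage.next {k : ℕ} (S : ResolutionStage N k) : ResolutionStage N (k + 1) where
  Z := kernel (S.toZ e)
  ε := kernel.lift _ (N.d (k + 2) (k + 1) ≫ biprod.inr) (by simp [S.w])
  π := kernel.ι _ ≫ biprod.snd
  w := by
    rw [← cancel_mono (kernel.ι _), Category.assoc, kernel.lift_ι, N.d_comp_d_assoc, zero_comp,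
      zero_comp]
  hπ := by simp

variable (N) in
def resolutionStage : ∀ k, ResolutionStage N k
  | 0 => ⟨N.X 0, N.d 1 0, 𝟙 _, by simp, by simp⟩
  | k + 1 => (resolutionStage k).next e

variable (N) in
/-- The projection of a stage to the previous term of the resolution. -/
def stageFst (k : ℕ) : (resolutionStage N e (k + 1)).Z ⟶ cov (resolutionStage N e k).Z :=
  kernel.ι (ResolutionStage.toZ e (resolutionStage N e k)) ≫ biprod.fst

theorem stageFst_e (k : ℕ) : stageFst N e k ≫ e _ =
    (resolutionStage N e (k + 1)).π ≫ (resolutionStage N e k).ε := by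
  have := kernel.condition (ResolutionStage.toZ e (resolutionStage N e k))
  rw [ResolutionStage.toZ, Preadditive.comp_sub, sub_eq_zero] at this
  exact (Category.assoc _ _ _).trans (this.trans (Category.assoc _ _ _).symm)

theorem stage_ε_fst (k : ℕ) : (resolutionStage N e (k + 1)).ε ≫ stageFst N e k = 0 := by
  have : (resolutionStage N e (k + 1)).ε ≫ kernel.ι (ResolutionStage.toZ e (resolutionStage N e k))
    = N.d (k + 2) (k + 1) ≫ biprod.inr := kernel.lift_ι _ _ _
  refine (Category.assoc _ _ _).symm.trans ((congrArg (· ≫ biprod.fst) this).trans ?_)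
  rw [Category.assoc, biprod.inr_fst, comp_zero]

theorem stage_hom_ext {k : ℕ} {V : E} {x y : V ⟶ (resolutionStage N e (k + 1)).Z}
    (h₁ : x ≫ stageFst N e k = y ≫ stageFst N e k)
    (h₂ : x ≫ (resolutionStage N e (k + 1)).π = y ≫ (resolutionStage N e (k + 1)).π) :
    x = y := by
  refine (cancel_mono (kernel.ι (ResolutionStage.toZ e (resolutionStage N e k)))).1 ?_
  apply biprod.hom_ext
  · exact (Category.assoc _ _ _).trans (h₁.trans (Category.assoc _ _ _).symm)
  · exact (Category.assoc _ _ _).trans (h₂.trans (Category.assoc _ _ _).symm)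

theorem stage_exists_lift {k : ℕ} {V : E} (a : V ⟶ cov (resolutionStage N e k).Z)
    (b : V ⟶ N.X (k + 1)) (h : a ≫ e _ = b ≫ (resolutionStage N e k).ε) :
    ∃ z : V ⟶ (resolutionStage N e (k + 1)).Z, z ≫ stageFst N e k = a ∧
      z ≫ (resolutionStage N e (k + 1)).π = b := by
  have h' : biprod.lift a b ≫ ResolutionStage.toZ e (resolutionStage N e k) = 0 := by
    simp [ResolutionStage.toZ, h]
  refine ⟨kernel.lift _ _ h', ?_, ?_⟩
  · exact (kernel.lift_ι_assoc _ _ _ _).trans (biprod.lift_fst _ _)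
  · exact (kernel.lift_ι_assoc _ _ _ _).trans (biprod.lift_snd _ _)

variable (N) in
/-- The resolution of a bounded above complex with terms among the chosen covers. -/
def resolution : ChainComplex E ℕ :=
  ChainComplex.of (fun k => cov (resolutionStage N e k).Z) (fun k => e _ ≫ stageFst N e k)
    (fun k => by
      rw [Category.assoc, ← Category.assoc (stageFst N e (k + 1)), stageFst_e, Category.assoc,
        stage_ε_fst, comp_zero, comp_zero])

variable (N) in
/-- The cover of a stage by the corresponding term of the resolution. -/
def resolutionCover (k : ℕ) : (resolution N e).X k ⟶ (resolutionStage N e k).Z := e _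

variable (N) in
/-- `stageFst` with values in a term of the resolution. -/
def resolutionFst (k : ℕ) : (resolutionStage N e (k + 1)).Z ⟶ (resolution N e).X k :=
  stageFst N e k

theorem resolution_d (k : ℕ) :
    (resolution N e).d (k + 1) k = resolutionCover N e (k + 1) ≫ resolutionFst N e k :=
  ChainComplex.of_d (fun k => cov (resolutionStage N e k).Z) (fun k => e _ ≫ stageFst N e k) k

theorem resolutionFst_cover (k : ℕ) : resolutionFst N e k ≫ resolutionCover N e k =
    (resolutionStage N e (k + 1)).π ≫ (resolutionStage N e k).ε := stageFst_e e k

variable (N) in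
def resolutionπ : resolution N e ⟶ N where
  f k := resolutionCover N e k ≫ (resolutionStage N e k).π
  comm' := by
    rintro _ k rfl
    rw [resolution_d, Category.assoc, Category.assoc, ← (resolutionStage N e k).hπ,
      reassoc_of% (resolutionFst_cover e k)]

theorem resolution_lift_zero (he : ∀ X, IsStrictEpi (e X)) {V : E} (hV : IsProj V)
    (b : V ⟶ N.X 0) : ∃ a, a ≫ (resolutionπ N e).f 0 = b := by
  obtain ⟨a, ha⟩ := hV _ (he (resolutionStage N e 0).Z) b
  refine ⟨a, ?_⟩
  rw [← ha]
  exact congrArg (a ≫ ·) (Category.comp_id _)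

/-- The pair `(a, b)` is a cocycle of the cone, that is, a point of the next stage; the next term of
the resolution covers this stage by a strict epimorphism, along which `V` lifts. -/
theorem resolution_lift (he : ∀ X, IsStrictEpi (e X)) {V : E} (hV : IsProj V) (k : ℕ)
    (a : V ⟶ (resolution N e).X k) (b : V ⟶ N.X (k + 1))
    (ha : ∀ l, a ≫ (resolution N e).d k l = 0)
    (hab : a ≫ (resolutionπ N e).f k = b ≫ N.d (k + 1) k) :
    ∃ a' : V ⟶ (resolution N e).X (k + 1), a' ≫ (resolution N e).d (k + 1) k = a ∧
      a' ≫ (resolutionπ N e).f (k + 1) = b := by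
  have h : a ≫ resolutionCover N e k = b ≫ (resolutionStage N e k).ε := by
    cases k with
    | zero =>
      refine Eq.trans ?_ hab
      exact congrArg (a ≫ ·) (Category.comp_id _).symm
    | succ k =>
      -- Of the two projections that separate points of the stage, one gives the condition that `a`
      -- is a cocycle and the other the compatibility of `a` with `b`.
      refine stage_hom_ext e ?_ ?_
      · change _ ≫ resolutionFst N e k = _
        have := ha k
        rw [resolution_d] at this
        rw [Category.assoc, this, Category.assoc]
        exact (comp_zero.symm.trans (congrArg (b ≫ ·) (stage_ε_fst e k).symm))
      · rw [Category.assoc, Category.assoc, (resolutionStage N e (k + 1)).hπ]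
        exact hab
  obtain ⟨z, hz₁, hz₂⟩ : ∃ z : V ⟶ _, z ≫ resolutionFst N e k = a ∧ _ := stage_exists_lift e a b h
  obtain ⟨a', ha'⟩ : ∃ a', a' ≫ resolutionCover N e (k + 1) = z := hV _ (he _) z
  refine ⟨a', ?_, ?_⟩
  · rw [resolution_d, reassoc_of% ha', hz₁]
  · rw [← hz₂, ← ha', Category.assoc]
    rfl

end ResolutionConstruction

section Existence

variable {E : Type u} [Category.{v} E] [Preadditive E] [HasKernels E] [HasCokernels E]
  [HasZeroObject E] [HasBinaryBiproducts E]

theorem strictQuasiIso_extendMap_resolutionπ [DetectedByProj E] (N : ChainComplex E ℕ)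
    {cov : E → E} (e : ∀ X, cov X ⟶ X) (he : ∀ X, IsStrictEpi (e X)) (n : ℤ) :
    StrictQuasiIso (HomologicalComplex.extendMap (resolutionπ N e)
      (ComplexShape.embeddingUpIntLE n)) := by
  rw [strictQuasiIso_iff]
  intro V hV i j k l hij hjk hkl a b ha hab
  have hz (K : ChainComplex E ℕ) (j : ℤ) (hj : n < j) :
      IsZero ((K.extend (ComplexShape.embeddingUpIntLE n)).X j) :=
    K.isZero_extend_X _ _ fun m hm => by simp at hm; lia
  by_cases hj : n < j
  · exact ⟨0, 0, (hz _ k (by lia)).eq_of_tgt _ _, (hz _ j hj).eq_of_tgt _ _⟩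
  obtain ⟨m, hm⟩ : ∃ m : ℕ, j = n - m := ⟨(n - j).toNat, by lia⟩
  have hm' : (ComplexShape.embeddingUpIntLE n).f m = j := hm.symm
  cases m with
  | zero =>
    obtain ⟨a', ha'⟩ := resolution_lift_zero e he hV
      (b ≫ (N.extendXIso (ComplexShape.embeddingUpIntLE n) hm').hom)
    refine ⟨a' ≫ ((resolution N e).extendXIso _ hm').inv, 0,
      (hz _ k (by simp at hm; lia)).eq_of_tgt _ _, ?_⟩
    rw [HomologicalComplex.extendMap_f _ _ hm']
    simp [reassoc_of% ha']
  | succ m =>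
    have hk : (ComplexShape.embeddingUpIntLE n).f m = k := by simp at hm ⊢; lia
    obtain ⟨a', h₁, h₂⟩ := resolution_lift e he hV m
      (a ≫ ((resolution N e).extendXIso (ComplexShape.embeddingUpIntLE n) hk).hom)
      (b ≫ (N.extendXIso (ComplexShape.embeddingUpIntLE n) hm').hom) (by
        intro r
        by_cases hr : r + 1 = m
        · have hl : (ComplexShape.embeddingUpIntLE n).f r = l := by simp at hk ⊢; lia
          rw [HomologicalComplex.extend_d_eq _ _ hk hl] at ha
          simpa using ha =≫ ((resolution N e).extendXIso _ hl).hom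
        · rw [HomologicalComplex.shape _ _ _ hr, comp_zero]) (by
        rw [HomologicalComplex.extend_d_eq _ _ hm' hk, HomologicalComplex.extendMap_f _ _ hk] at hab
        simpa using hab =≫ (N.extendXIso _ hk).hom)
    refine ⟨a' ≫ ((resolution N e).extendXIso _ hm').inv, 0, ?_, ?_⟩
    · rw [HomologicalComplex.extend_d_eq _ _ hm' hk]
      simp [reassoc_of% h₁]
    · rw [HomologicalComplex.extendMap_f _ _ hm']
      simp [reassoc_of% h₂]

/-- The class `Q` is a parameter because two choices are needed: all projectives, and free modules
on projectives, whose restriction of scalars can be controlled. -/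
theorem exists_resolution [DetectedByProj E] (Q : ObjectProperty E)
    (hQ : ∀ X : E, ∃ (P : E) (e : P ⟶ X), Q P ∧ IsStrictEpi e) [Q.IsClosedUnderIsomorphisms]
    (N : CochainComplex E ℤ) (n : ℤ) [N.IsStrictlyLE n] :
    ∃ (R : CochainComplex E ℤ) (t : R ⟶ N), R.IsStrictlyLE n ∧ (∀ i, i ≤ n → Q (R.X i)) ∧
      StrictQuasiIso t := by
  choose cov e hcov he using hQ
  let M := N.restriction (ComplexShape.embeddingUpIntLE n)
  have hl : (ComplexShape.embeddingUpIntLE n).HasLift (𝟙 M) := fun j _ i' hi' =>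
     (N.isZero_X_of_isStrictlySupported _ i' (ComplexShape.Embedding.BoundaryGE.notMem
      ‹_› hi')).eq_of_src _ _
  -- A complex that vanishes above `n` is isomorphic to the extension by zero of its restriction,
  -- which is a chain complex indexed by `ℕ`.
  let t : N ⟶ M.extend (ComplexShape.embeddingUpIntLE n) :=
    (ComplexShape.embeddingUpIntLE n).liftExtend (𝟙 M) hl
  have (i : ℤ) : IsIso (t.f i) := by
    by_cases hi : ∃ m, (ComplexShape.embeddingUpIntLE n).f m = i
    · obtain ⟨m, hm⟩ := hi
      rw [ComplexShape.Embedding.isIso_liftExtend_f_iff _ _ _ hm]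
      exact inferInstanceAs (IsIso (𝟙 (M.X m)))
    · simp only [not_exists] at hi
      exact ⟨0, (N.isZero_X_of_isStrictlySupported _ i hi).eq_of_src _ _,
        (M.isZero_extend_X _ i hi).eq_of_src _ _⟩
  have : IsIso t := HomologicalComplex.Hom.isIso_of_components t
  refine ⟨(resolution M e).extend (ComplexShape.embeddingUpIntLE n),
    HomologicalComplex.extendMap (resolutionπ M e) _ ≫ inv t, inferInstance, fun i hi => ?_, ?_⟩
  · obtain ⟨m, hm⟩ : ∃ m : ℕ, i = n - m := ⟨(n - i).toNat, by lia⟩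
    exact Q.prop_of_iso ((resolution M e).extendXIso (ComplexShape.embeddingUpIntLE n)
      (i := m) hm.symm).symm (hcov _)
  · rw [← trW_map_iff, Functor.map_comp]
    exact trW_comp ((trW_map_iff _).2 (strictQuasiIso_extendMap_resolutionπ M e he n))
      (ObjectProperty.trW_of_isIso _ _)

end Existence

end RelGeom

/-! ### Augmented resolutions and objects on which the derived functor is underived -/

namespace RelGeom

open CochainComplex.HomComplex Pretriangulated

section AugmentedComplexes

variable {E : Type u} [Category.{v} E] [Preadditive E] [HasKernels E] [HasCokernels E]

/-- `ε` makes the complex `P`, concentrated in nonpositive degrees, into a resolution of `M`. -/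
structure AugExact (P : CochainComplex E ℤ) {M : E} (ε : P.X 0 ⟶ M) : Prop where
  surj ⦃V : E⦄ (hV : IsProj V) (x : V ⟶ M) : ∃ y, y ≫ ε = x
  zero (i : ℤ) (hi : i + 1 = 0) : P.d i 0 ≫ ε = 0
  exact_zero ⦃V : E⦄ (hV : IsProj V) (i : ℤ) (hi : i + 1 = 0) (y : V ⟶ P.X 0) (hy : y ≫ ε = 0) :
    ∃ z, z ≫ P.d i 0 = y
  exact_neg ⦃V : E⦄ (hV : IsProj V) (i j k : ℤ) (hi : i + 1 = j) (hj : j + 1 = k) (hk : k ≤ 0)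
    (y : V ⟶ P.X j) (hy : y ≫ P.d j k = 0) : ∃ z, z ≫ P.d i j = y

variable [HasZeroObject E] [HasBinaryBiproducts E]

/-- The target is only required to be concentrated in degree zero up to isomorphism, so that it can
be the image under a functor of a complex with one term. -/
theorem strictQuasiIso_iff_augExact [DetectedByProj E] {P K : CochainComplex E ℤ} {M : E}
    [hP : P.IsStrictlyLE 0] (hK : ∀ i, i ≠ 0 → IsZero (K.X i)) (φ : P ⟶ K) (e : K.X 0 ≅ M)
    (ε : P.X 0 ⟶ M) (hε : φ.f 0 ≫ e.hom = ε) :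
    StrictQuasiIso φ ↔ AugExact P ε := by
  have hz (i : ℤ) (hi : 0 < i) : IsZero (P.X i) := P.isZero_of_isStrictlyLE 0 i hi
  rw [strictQuasiIso_iff]
  constructor
  · intro h
    have hzero (i : ℤ) (hi : i + 1 = 0) : P.d i 0 ≫ ε = 0 := by
      rw [← hε, ← φ.comm_assoc, (hK i (by lia)).eq_of_src (K.d i 0) 0]; simp
    refine ⟨fun V hV x => ?_, hzero, fun V hV i hi y hy => ?_, fun V hV i j k hi hj hk y hy => ?_⟩
    · obtain ⟨a, b, -, h⟩ := h hV (-1) 0 1 2 rfl rfl rfl 0 (x ≫ e.inv) (by simp)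
        ((hK 1 (by lia)).eq_of_tgt _ _)
      rw [(hK (-1) (by lia)).eq_of_tgt b 0, zero_comp, add_zero] at h
      exact ⟨a, by rw [← hε, reassoc_of% h]; simp⟩
    · obtain ⟨a, b, h, -⟩ := h hV (i - 1) i 0 1 (by lia) hi rfl y 0
        ((hz 1 (by lia)).eq_of_tgt _ _) (by
          rw [← cancel_mono e.hom, Category.assoc, hε, hy]; simp)
      exact ⟨a, h⟩
    · obtain ⟨a, b, h, -⟩ := h hV (i - 1) i j k (by lia) hi hj y 0 hy
        ((hK j (by lia)).eq_of_tgt _ _)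
      exact ⟨a, h⟩
  · intro h V hV i j k l hij hjk hkl a b ha hab
    obtain hk | hk | hk : 1 ≤ k ∨ k = 0 ∨ k < 0 := by lia
    · rw [(hz k (by lia)).eq_of_tgt a 0]
      by_cases hj : j = 0
      · subst hj
        obtain ⟨y, hy⟩ := h.surj hV (b ≫ e.hom)
        refine ⟨y, 0, (hz k (by lia)).eq_of_tgt _ _, ?_⟩
        rw [← cancel_mono e.hom, ← hy, ← hε]
        simp
      · exact ⟨0, 0, by simp, (hK j hj).eq_of_tgt _ _⟩
    · subst hk
      obtain ⟨z, hz⟩ := h.exact_zero hV j hjk a (by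
        rw [← hε, reassoc_of% hab, (hK j (by lia)).eq_of_src (K.d j 0) 0]; simp)
      exact ⟨z, 0, hz, (hK j (by lia)).eq_of_tgt _ _⟩
    · obtain ⟨z, hz⟩ := h.exact_neg hV j k l hjk hkl (by lia) a ha
      exact ⟨z, 0, hz, (hK j (by lia)).eq_of_tgt _ _⟩

/-- The complex with one object in degree zero. -/
abbrev single0 (M : E) : CochainComplex E ℤ :=
  (HomologicalComplex.single E (ComplexShape.up ℤ) 0).obj M

abbrev single0Iso (M : E) : (single0 M).X 0 ≅ M :=
  HomologicalComplex.singleObjXSelf (ComplexShape.up ℤ) 0 M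

theorem single0_isZero (M : E) (i : ℤ) (hi : i ≠ 0) : IsZero ((single0 M).X i) :=
  HomologicalComplex.isZero_single_obj_X _ _ _ _ hi

theorem AugExact.exists_hom {P : CochainComplex E ℤ} {M : E} {ε : P.X 0 ⟶ M}
    (h : AugExact P ε) : ∃ π : P ⟶ single0 M, π.f 0 ≫ (single0Iso M).hom = ε :=
  ⟨HomologicalComplex.mkHomToSingle ε (fun i hi => h.zero i hi), by simp⟩

end AugmentedComplexes

section Good

variable {E : Type u} [Category.{v} E] [Preadditive E] [HasKernels E] [HasCokernels E]
  [HasZeroObject E] [HasBinaryBiproducts E] [DetectedByProj E]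
  {E' : Type u'} [Category.{v'} E'] [Preadditive E'] [HasKernels E'] [HasCokernels E']
  [HasZeroObject E'] [HasBinaryBiproducts E'] [DetectedByProj E']
  (F : E ⥤ E') [F.Additive]

/-- The functor induced on homotopy categories. -/
abbrev mapK : KCat E ⥤ KCat E' := F.mapHomotopyCategory (ComplexShape.up ℤ)

/-- Complexes on which the left derived functor of `F` is computed by `F`. -/
def Good : ObjectProperty (KCat E) := fun L =>
  ∃ (R : KCat E) (t : R ⟶ L), kProj E R ∧ (acyclics E).trW t ∧ (acyclics E').trW ((mapK F).map t)

variable {F}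

/-- Two K-projective resolutions of `L` are isomorphic over `L` in the homotopy category, so a
single resolution that `F` preserves forces `F` to preserve all of them. -/
theorem Good.trW_map {L R : KCat E} (hL : Good F L) (hR : kProj E R) (t : R ⟶ L)
    (ht : (acyclics E).trW t) : (acyclics E').trW ((mapK F).map t) := by
  obtain ⟨R', t', hR', ht', hF⟩ := hL
  obtain ⟨a, ha⟩ := (kProj_lift_bijective hR ht').2 t
  obtain ⟨b, hb⟩ := (kProj_lift_bijective hR' ht).2 t'
  dsimp at ha hb
  have : IsIso a := ⟨b, (kProj_lift_bijective hR ht).1 (by simp [hb, ha]),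
    (kProj_lift_bijective hR' ht').1 (by simp [hb, ha])⟩
  rw [← ha, Functor.map_comp]
  exact trW_comp (ObjectProperty.trW_of_isIso _ _) hF

theorem Good.of_iso {L L' : KCat E} (hL : Good F L) (e : L ≅ L') : Good F L' := by
  obtain ⟨R, t, hR, ht, hF⟩ := hL
  refine ⟨R, t ≫ e.hom, hR, trW_comp ht (ObjectProperty.trW_of_isIso _ _), ?_⟩
  rw [Functor.map_comp]
  exact trW_comp hF (ObjectProperty.trW_of_isIso _ _)

omit [DetectedByProj E] in
-- Tested on shifted projectives, the claim splits into the two summands. It is used both for the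
-- identity and for `mapK F`.
theorem trW_map_biprod (G : KCat E ⥤ KCat E') [G.Additive] {A A' B B' : KCat E} (a : A ⟶ A')
    (b : B ⟶ B') (ha : (acyclics E').trW (G.map a)) (hb : (acyclics E').trW (G.map b)) :
    (acyclics E').trW (G.map (biprod.map a b)) := by
  refine trW_of_bijective _ fun V hV => ?_
  have h₁ := kProj_lift_bijective (projSingles_le_kProj _ hV) ha
  have h₂ := kProj_lift_bijective (projSingles_le_kProj _ hV) hb
  have tot {X Y : KCat E} {W : KCat E'} (x : W ⟶ G.obj (X ⊞ Y)) :
      x ≫ G.map biprod.fst ≫ G.map biprod.inl + x ≫ G.map biprod.snd ≫ G.map biprod.inr = x := by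
    rw [← Preadditive.comp_add, ← G.map_comp, ← G.map_comp, ← G.map_add, biprod.total, G.map_id,
      Category.comp_id]
  refine ⟨fun x y hxy => ?_, fun y => ?_⟩
  · have e₁ : x ≫ G.map biprod.fst = y ≫ G.map biprod.fst := h₁.1 (by
      have := hxy =≫ G.map biprod.fst
      dsimp only at this ⊢
      rwa [Category.assoc, Category.assoc, ← G.map_comp, biprod.map_fst, G.map_comp,
        ← Category.assoc, ← Category.assoc] at this)
    have e₂ : x ≫ G.map biprod.snd = y ≫ G.map biprod.snd := h₂.1 (by
      have := hxy =≫ G.map biprod.snd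
      dsimp only at this ⊢
      rwa [Category.assoc, Category.assoc, ← G.map_comp, biprod.map_snd, G.map_comp,
        ← Category.assoc, ← Category.assoc] at this)
    rw [← tot x, ← tot y, reassoc_of% e₁, reassoc_of% e₂]
  · obtain ⟨x₁, hx₁⟩ := h₁.2 (y ≫ G.map biprod.fst)
    obtain ⟨x₂, hx₂⟩ := h₂.2 (y ≫ G.map biprod.snd)
    dsimp at hx₁ hx₂
    refine ⟨x₁ ≫ G.map biprod.inl + x₂ ≫ G.map biprod.inr, ?_⟩
    dsimp
    rw [Preadditive.add_comp, Category.assoc, Category.assoc, ← G.map_comp, ← G.map_comp,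
      biprod.inl_map, biprod.inr_map, G.map_comp, G.map_comp, reassoc_of% hx₁, reassoc_of% hx₂,
      tot]

theorem Good.biprod {A B : KCat E} (hA : Good F A) (hB : Good F B) : Good F (A ⊞ B) := by
  obtain ⟨R, t, hR, ht, hF⟩ := hA
  obtain ⟨R', t', hR', ht', hF'⟩ := hB
  refine ⟨R ⊞ R', biprod.map t t', fun X f hX => ?_, trW_map_biprod (𝟭 _) t t' ht ht',
    trW_map_biprod (mapK F) t t' hF hF'⟩
  apply biprod.hom_ext'
  · rw [hR (biprod.inl ≫ f) hX, comp_zero]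
  · rw [hR' (biprod.inr ≫ f) hX, comp_zero]

variable (F) in
/-- Objects on which the left derived functor of `F` is computed by `F`. -/
def GoodObj : ObjectProperty E := fun M => Good F ((toK E).obj (single0 M))

variable (F) in
abbrev mapC : CochainComplex E ℤ ⥤ CochainComplex E' ℤ :=
  F.mapHomologicalComplex (ComplexShape.up ℤ)

instance mapC_isStrictlyLE (P : CochainComplex E ℤ) (n : ℤ) [hP : P.IsStrictlyLE n] :
    ((mapC F).obj P).IsStrictlyLE n := by
  rw [CochainComplex.isStrictlyLE_iff] at hP ⊢
  exact fun i hi => F.map_isZero (hP i hi)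

theorem strictQuasiIso_map_iff_augExact {P : CochainComplex E ℤ} {M : E} [P.IsStrictlyLE 0]
    (π : P ⟶ single0 M) (ε : P.X 0 ⟶ M) (hε : π.f 0 ≫ (single0Iso M).hom = ε) :
    StrictQuasiIso ((mapC F).map π) ↔ AugExact ((mapC F).obj P) (M := F.obj M) (F.map ε) :=
  strictQuasiIso_iff_augExact (K := (mapC F).obj (single0 M))
    (fun i hi => F.map_isZero (single0_isZero M i hi)) _
    (F.mapIso (single0Iso M)) _ (by rw [← hε, F.map_comp]; rfl)

theorem goodObj_of_augExact {P : CochainComplex E ℤ} {M : E} [P.IsStrictlyLE 0]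
    (hproj : ∀ i, IsProj (P.X i)) {ε : P.X 0 ⟶ M} (h : AugExact P ε)
    (hF : AugExact ((mapC F).obj P) (M := F.obj M) (F.map ε)) : GoodObj F M := by
  obtain ⟨π, hπ⟩ := h.exists_hom
  exact ⟨_, (toK E).map π, kProj_of_isProj 0 hproj,
    (trW_map_iff _).2 ((strictQuasiIso_iff_augExact (single0_isZero M) π _ ε hπ).2 h),
    (trW_map_iff _).2 ((strictQuasiIso_map_iff_augExact π ε hπ).2 hF)⟩

theorem GoodObj.augExact_map {P : CochainComplex E ℤ} {M : E} (hM : GoodObj F M)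
    [P.IsStrictlyLE 0] (hproj : ∀ i, IsProj (P.X i)) {ε : P.X 0 ⟶ M} (h : AugExact P ε) :
    AugExact ((mapC F).obj P) (M := F.obj M) (F.map ε) := by
  obtain ⟨π, hπ⟩ := h.exists_hom
  exact (strictQuasiIso_map_iff_augExact π ε hπ).1 ((trW_map_iff _).1 (hM.trW_map
    (kProj_of_isProj 0 hproj) _
    ((trW_map_iff _).2 ((strictQuasiIso_iff_augExact (single0_isZero M) π _ ε hπ).2 h))))

theorem GoodObj.of_iso {M N : E} (hM : GoodObj F M) (e : M ≅ N) : GoodObj F N :=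
  Good.of_iso hM ((HomologicalComplex.single E (ComplexShape.up ℤ) 0 ⋙ toK E).mapIso e)

theorem GoodObj.biprod {M N : E} (hM : GoodObj F M) (hN : GoodObj F N) : GoodObj F (M ⊞ N) := by
  have : (HomologicalComplex.single E (ComplexShape.up ℤ) 0 ⋙ toK E).Additive := inferInstance
  have : PreservesBinaryBiproducts (HomologicalComplex.single E (ComplexShape.up ℤ) 0 ⋙ toK E) :=
    preservesBinaryBiproducts_of_preservesBiproducts _
  exact Good.of_iso (Good.biprod hM hN) (((HomologicalComplex.single E (ComplexShape.up ℤ) 0 ⋙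
    toK E).mapBiprod M N).symm)

theorem IsProj.of_iso {P Q : E} (hP : IsProj P) (e : P ≅ Q) : IsProj Q := fun X Y p hp f => by
  obtain ⟨g, hg⟩ := hP p hp (e.hom ≫ f)
  exact ⟨e.inv ≫ g, by simp [hg]⟩

instance : ObjectProperty.IsClosedUnderIsomorphisms (IsProj (E := E)) where
  of_iso e h := h.of_iso e

theorem isProj_of_isZero {P : E} (hP : IsZero P) : IsProj P :=
  fun _ _ _ _ _ => ⟨0, hP.eq_of_src _ _⟩

variable (Q : ObjectProperty E) [Q.IsClosedUnderIsomorphisms]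

theorem exists_augExact (hQ : ∀ X : E, ∃ (P : E) (e : P ⟶ X), Q P ∧ IsStrictEpi e) (M : E) :
    ∃ (P : CochainComplex E ℤ) (ε : P.X 0 ⟶ M), P.IsStrictlyLE 0 ∧ (∀ i, i ≤ 0 → Q (P.X i)) ∧
      AugExact P ε := by
  have : (single0 M).IsStrictlyLE 0 := by
    rw [CochainComplex.isStrictlyLE_iff]
    exact fun i hi => single0_isZero M i (by lia)
  obtain ⟨R, t, h₁, h₂, h₃⟩ := exists_resolution Q hQ (single0 M) 0
  exact ⟨R, t.f 0 ≫ (single0Iso M).hom, h₁, h₂,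
    (strictQuasiIso_iff_augExact (single0_isZero M) t _ _ rfl).1 h₃⟩

theorem exists_projective_augExact (M : E) :
    ∃ (P : CochainComplex E ℤ) (ε : P.X 0 ⟶ M), P.IsStrictlyLE 0 ∧ (∀ i, IsProj (P.X i)) ∧
      AugExact P ε := by
  obtain ⟨P, ε, h₁, h₂, h₃⟩ := exists_augExact IsProj (DetectedByProj.enough) M
  refine ⟨P, ε, h₁, fun i => ?_, h₃⟩
  by_cases hi : i ≤ 0
  · exact h₂ i hi
  · exact isProj_of_isZero (P.isZero_of_isStrictlyLE 0 i (by lia))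

end Good

end RelGeom

/-! ### Acyclicity of good objects for the derived functor -/

namespace RelGeom

open CochainComplex.HomComplex Pretriangulated

section DerivedFunctor

variable {E : Type u} [Category.{v} E] [Preadditive E] [HasKernels E] [HasCokernels E]
  [HasZeroObject E] [HasBinaryBiproducts E] [DetectedByProj E]
  {E' : Type u'} [Category.{v'} E'] [Preadditive E'] [HasKernels E'] [HasCokernels E']
  [HasZeroObject E'] [HasBinaryBiproducts E'] [DetectedByProj E']
  {F : E ⥤ E'} [F.Additive]

theorem trW_of_distinguished {T T' : Triangle (KCat E)} (φ : T ⟶ T') (hT : T ∈ distTriang (KCat E))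
    (hT' : T' ∈ distTriang (KCat E)) (h₁ : (acyclics E).trW φ.hom₁)
    (h₂ : (acyclics E).trW φ.hom₂) : (acyclics E).trW φ.hom₃ := by
  rw [trW_iff_isIso_toD] at h₁ h₂ ⊢
  exact isIso₃_of_isIso₁₂ ((toD E).mapTriangle.map φ) ((toD E).map_distinguished _ hT)
    ((toD E).map_distinguished _ hT') h₁ h₂

instance : (kProj E).IsTriangulated := by
  unfold kProj
  infer_instance

/-- Lift the first morphism to K-projective resolutions and take the cone of the lift. It resolves
the third term, and since `mapK F` is triangulated, the same comparison of triangles after applying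
`F` shows that this resolution is preserved. -/
theorem Good.of_distinguished {T : Triangle (KCat E)} (hT : T ∈ distTriang (KCat E))
    (h₁ : Good F T.obj₁) (h₂ : Good F T.obj₂) : Good F T.obj₃ := by
  obtain ⟨R, t, hR, ht, hFt⟩ := h₁
  obtain ⟨S, s, hS, hs, hFs⟩ := h₂
  obtain ⟨a, ha⟩ := (kProj_lift_bijective hR hs).2 (t ≫ T.mor₁)
  obtain ⟨Z, b, c, hZ⟩ := distinguished_cocone_triangle a
  let φ := completeDistinguishedTriangleMorphism _ _ hZ hT t s ha
  refine ⟨Z, φ.hom₃, (kProj E).ext_of_isTriangulatedClosed₃ _ hZ hR hS,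
    trW_of_distinguished φ hZ hT ht hs, ?_⟩
  exact trW_of_distinguished ((mapK F).mapTriangle.map φ) ((mapK F).map_distinguished _ hZ)
    ((mapK F).map_distinguished _ hT) hFt hFs

theorem Good.trW_map_of_good {K L : KCat E} (hK : Good F K) (hL : Good F L) (t : K ⟶ L)
    (ht : (acyclics E).trW t) : (acyclics E').trW ((mapK F).map t) := by
  obtain ⟨R, s, hR, hs, hFs⟩ := hK
  have := hL.trW_map hR (s ≫ t) (trW_comp hs ht)
  rw [Functor.map_comp] at this
  exact trW_of_comp_left hFs this

theorem Good.of_trW {K L : KCat E} (hK : Good F K) (t : K ⟶ L) (ht : (acyclics E).trW t)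
    (hFt : (acyclics E').trW ((mapK F).map t)) : Good F L := by
  obtain ⟨R, s, hR, hs, hFs⟩ := hK
  refine ⟨R, s ≫ t, hR, trW_comp hs ht, ?_⟩
  rw [Functor.map_comp]
  exact trW_comp hFs hFt

theorem Good.of_kProj {K : KCat E} (hK : kProj E K) : Good F K :=
  ⟨K, 𝟙 K, hK, ObjectProperty.trW_of_isIso _ _,
    ObjectProperty.trW_of_isIso _ ((mapK F).map (𝟙 K))⟩

theorem GoodObj.of_isProj {P : E} (hP : IsProj P) : GoodObj F P :=
  Good.of_kProj (projSingles_le_kProj _ ⟨P, 0, hP, ⟨Iso.refl _⟩⟩)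

/-- Exactness of `0 ⟶ X ⟶ Y ⟶ Z ⟶ 0`, tested on projective objects. -/
structure ProjExact {X Y Z : E} (f : X ⟶ Y) (g : Y ⟶ Z) : Prop where
  zero : f ≫ g = 0
  inj ⦃V : E⦄ (hV : IsProj V) (x : V ⟶ X) (hx : x ≫ f = 0) : x = 0
  exact ⦃V : E⦄ (hV : IsProj V) (y : V ⟶ Y) (hy : y ≫ g = 0) : ∃ x, x ≫ f = y
  surj ⦃V : E⦄ (hV : IsProj V) (z : V ⟶ Z) : ∃ y, y ≫ g = z

omit [HasZeroObject E] [HasBinaryBiproducts E] [DetectedByProj E] [HasZeroObject E']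
  [HasBinaryBiproducts E'] [DetectedByProj E'] in
theorem isStrictEpi_map [∀ {X Y : E} (f : X ⟶ Y), PreservesColimit (parallelPair f 0) F]
    {X Y : E} {f : X ⟶ Y} (hf : IsStrictEpi f) : IsStrictEpi (F.map f) := by
  have h : IsColimit (CokernelCofork.ofπ f (kernel.condition f)) := by
    have := hf.2
    exact CokernelCofork.IsColimit.ofπ _ _ (fun t ht => (hf.desc t ht).choose)
      (fun t ht => (hf.desc t ht).choose_spec)
      (fun t ht m hm => (cancel_epi f).1 (hm.trans (hf.desc t ht).choose_spec.symm))
  exact isStrictEpi_of_isColimit (by rw [← F.map_comp, kernel.condition, F.map_zero])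
    (CokernelCofork.mapIsColimit _ h F)

/-- `K` is the complex `⋯ ⟶ P⁻¹ ⟶ P⁰ ⟶ Y`, where the last differential is `ε ≫ f`. -/
structure Splice (P K : CochainComplex E ℤ) {X Y : E} (ε : P.X 0 ⟶ X) (f : X ⟶ Y) where
  e₀ : Y ≅ K.X 0
  e (i j : ℤ) (hi : i + 1 = j) (hj : j ≤ 0) : P.X j ≅ K.X i
  d₀ (i : ℤ) (hi : i + 1 = 0) : (e i 0 hi le_rfl).hom ≫ K.d i 0 = ε ≫ f ≫ e₀.hom
  d (i j k : ℤ) (hi : i + 1 = j) (hj : j + 1 = k) (hk : k ≤ 0) :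
    (e i j hi (by lia)).hom ≫ K.d i j = -(P.d j k ≫ (e j k hj hk).hom)

namespace Splice

variable {P K : CochainComplex E ℤ} {X Y Z : E} {ε : P.X 0 ⟶ X} {f : X ⟶ Y} {g : Y ⟶ Z}

def map (F : E ⥤ E') [F.Additive] (S : Splice P K ε f) :
    Splice ((mapC F).obj P) ((mapC F).obj K) (X := F.obj X) (F.map ε) (F.map f) where
  e₀ := F.mapIso S.e₀
  e i j hi hj := F.mapIso (S.e i j hi hj)
  d₀ i hi := by
    change F.map _ ≫ F.map _ = F.map _ ≫ F.map _ ≫ F.map _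
    simp only [← F.map_comp, S.d₀]
  d i j k hi hj hk := by
    change F.map _ ≫ F.map _ = -(F.map _ ≫ F.map _)
    rw [← F.map_comp, ← F.map_comp, ← F.map_neg]
    exact congrArg F.map (S.d i j k hi hj hk)

/-- Splicing a resolution of `X` with an exact sequence from `X` to `Z` resolves `Z`. The only
delicate place is the degree just below zero, where injectivity of `f` on projective points turns a
cocycle of `K` into one annihilated by `ε`. -/
theorem augExact (S : Splice P K ε f) (hε : AugExact P ε) (h : ProjExact f g) :
    AugExact K (S.e₀.inv ≫ g) where
  surj V hV z := by
    obtain ⟨y, hy⟩ := h.surj hV z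
    exact ⟨y ≫ S.e₀.hom, by simp [hy]⟩
  zero i hi := by
    rw [← cancel_epi (S.e i 0 hi le_rfl).hom, reassoc_of% S.d₀ i hi]
    simp [h.zero]
  exact_zero V hV i hi y hy := by
    obtain ⟨x, hx⟩ := h.exact hV (y ≫ S.e₀.inv) (by simpa using hy)
    obtain ⟨p, rfl⟩ := hε.surj hV x
    refine ⟨p ≫ (S.e i 0 hi le_rfl).hom, ?_⟩
    rw [Category.assoc, S.d₀, ← Category.assoc, ← Category.assoc, hx]
    simp
  exact_neg V hV i j k hi hj hk y hy := by
    have key : ∃ p, p ≫ P.d j k = y ≫ (S.e j k hj hk).inv := by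
      obtain rfl | hk' := hk.eq_or_lt
      · refine hε.exact_zero hV j hj _ (h.inj hV _ ?_)
        rw [← cancel_mono S.e₀.hom]
        have := S.d₀ j hj
        rw [← Iso.eq_inv_comp] at this
        rw [this] at hy
        simpa using hy
      · refine hε.exact_neg hV j k (k + 1) hj rfl (by lia) _ ?_
        have := S.d j k (k + 1) hj rfl (by lia)
        rw [← Iso.eq_inv_comp] at this
        rw [this, Preadditive.comp_neg, Preadditive.comp_neg, neg_eq_zero] at hy
        rw [← cancel_mono (S.e k (k + 1) rfl (by lia)).hom]
        simpa using hy
    obtain ⟨p, hp⟩ := key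
    refine ⟨(-p) ≫ (S.e i j hi (by lia)).hom, ?_⟩
    rw [Category.assoc, S.d i j k hi hj hk, Preadditive.neg_comp, Preadditive.comp_neg, neg_neg,
      reassoc_of% hp]
    simp

/-- A converse to `augExact`: once `P.X 0` surjects onto `X` on projective points, exactness of the
spliced complex separates into exactness of the short sequence and exactness of the resolution of
`X`. It is applied to images under `F`, where only the spliced complex is known to be exact at
first. -/
theorem projExact (S : Splice P K ε f) (hsurj : ∀ ⦃V : E⦄, IsProj V → ∀ x : V ⟶ X, ∃ y, y ≫ ε = x)
    (hzero : ∀ i, i + 1 = 0 → P.d i 0 ≫ ε = 0) (hfg : f ≫ g = 0) (h : AugExact K (S.e₀.inv ≫ g)) :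
    ProjExact f g ∧ AugExact P ε := by
  have key₀ ⦃V : E⦄ (hV : IsProj V) (i : ℤ) (hi : i + 1 = 0) (y : V ⟶ P.X 0)
      (hy : y ≫ ε ≫ f = 0) : ∃ z, z ≫ P.d i 0 = y := by
    obtain ⟨z, hz⟩ := h.exact_neg hV (i - 1) i 0 (by lia) hi le_rfl (y ≫ (S.e i 0 hi le_rfl).hom)
      (by rw [Category.assoc, S.d₀, reassoc_of% hy, zero_comp])
    refine ⟨(-z) ≫ (S.e (i - 1) i (by lia) (by lia)).inv, ?_⟩
    have := S.d (i - 1) i 0 (by lia) hi le_rfl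
    rw [← Iso.eq_inv_comp] at this
    rw [← cancel_mono (S.e i 0 hi le_rfl).hom, ← hz, this]
    simp
  refine ⟨⟨hfg, fun V hV x hx => ?_, fun V hV y hy => ?_, fun V hV z => ?_⟩,
    ⟨hsurj, hzero, fun V hV i hi y hy => key₀ hV i hi y (by rw [reassoc_of% hy, zero_comp]),
      fun V hV i j k hi hj hk y hy => ?_⟩⟩
  · obtain ⟨y, rfl⟩ := hsurj hV x
    obtain ⟨z, rfl⟩ := key₀ hV (-1) rfl y (by simpa using hx)
    rw [Category.assoc, hzero _ rfl, comp_zero]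
  · obtain ⟨z, hz⟩ := h.exact_zero hV (-1) rfl (y ≫ S.e₀.hom) (by simpa using hy)
    refine ⟨z ≫ (S.e (-1) 0 rfl le_rfl).inv ≫ ε, ?_⟩
    have := S.d₀ (-1) rfl
    rw [← Iso.eq_inv_comp] at this
    rw [← cancel_mono S.e₀.hom, ← hz, this]
    simp
  · obtain ⟨y, hy⟩ := h.surj hV z
    exact ⟨y ≫ S.e₀.inv, by simpa using hy⟩
  · obtain ⟨z, hz⟩ := h.exact_neg hV (i - 1) i j (by lia) hi (by lia)
      (y ≫ (S.e i j hi (by lia)).hom) (by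
        rw [Category.assoc, S.d i j k hi hj hk, Preadditive.comp_neg, reassoc_of% hy, zero_comp,
          neg_zero])
    refine ⟨(-z) ≫ (S.e (i - 1) i (by lia) (by lia)).inv, ?_⟩
    have := S.d (i - 1) i j (by lia) hi (by lia)
    rw [← Iso.eq_inv_comp] at this
    rw [← cancel_mono (S.e i j hi (by lia)).hom, ← hz, this]
    simp

/-- The mapping cone as a splice. -/
def mappingCone [P.IsStrictlyLE 0] (π : P ⟶ single0 X) (hπ : π.f 0 ≫ (single0Iso X).hom = ε)
    (f : X ⟶ Y) : Splice P (CochainComplex.mappingCone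
      (π ≫ (HomologicalComplex.single E (ComplexShape.up ℤ) 0).map f)) ε f where
  e₀ :=
    { hom := (single0Iso Y).inv ≫ (CochainComplex.mappingCone.inr _).f 0
      inv := (CochainComplex.mappingCone.snd _).v 0 0 (add_zero 0) ≫ (single0Iso Y).hom
      hom_inv_id := by simp
      inv_hom_id := by
        rw [CochainComplex.mappingCone.ext_from_iff _ 1 0 rfl]
        exact ⟨(P.isZero_of_isStrictlyLE 0 1).eq_of_src _ _, by simp⟩ }
  e i j hi hj :=
    { hom := (CochainComplex.mappingCone.inl _).v j i (by lia)
      inv := (CochainComplex.mappingCone.fst _).1.v i j hi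
      hom_inv_id := by simp
      inv_hom_id := by
        rw [CochainComplex.mappingCone.ext_from_iff _ j i hi]
        exact ⟨by simp, (single0_isZero Y i (by lia)).eq_of_src _ _⟩ }
  d₀ i hi := by
    rw [← hπ]
    have := CochainComplex.mappingCone.inl_v_d
      (π ≫ (HomologicalComplex.single E (ComplexShape.up ℤ) 0).map f) 0 i 1 (by lia) rfl
    rw [(P.isZero_of_isStrictlyLE 0 1).eq_of_tgt (P.d 0 1) 0, zero_comp, sub_zero] at this
    refine this.trans ?_
    rw [HomologicalComplex.comp_f, HomologicalComplex.single_map_f_self]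
    simp
  d i j k hi hj hk := by
    have := CochainComplex.mappingCone.inl_v_d
      (π ≫ (HomologicalComplex.single E (ComplexShape.up ℤ) 0).map f) j i k (by lia) (by lia)
    rw [(single0_isZero Y j (by lia)).eq_of_tgt ((π ≫ _).f j) 0, zero_comp, zero_sub] at this
    exact this

end Splice

/-- For a projective resolution `P` of `X`, the cone of `P ⟶ Y` is good, being built from
projectives and `Y`, and it resolves `Z`. A quasi-isomorphism between good objects survives `F`, and
splitting the resulting exact complex gives both conclusions. This is the vanishing of `L₁F Z`
without homology objects. -/
theorem GoodObj.of_projExact [∀ {X Y : E} (f : X ⟶ Y), PreservesColimit (parallelPair f 0) F]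
    {X Y Z : E} {f : X ⟶ Y} {g : Y ⟶ Z} (h : ProjExact f g) (hY : GoodObj F Y)
    (hZ : GoodObj F Z) : GoodObj F X ∧ ProjExact (F.map f) (F.map g) := by
  obtain ⟨P, ε, hP, hproj, hε⟩ := exists_projective_augExact X
  obtain ⟨π, hπ⟩ := hε.exists_hom
  let S := Splice.mappingCone π hπ f
  have hC : (CochainComplex.mappingCone
      (π ≫ (HomologicalComplex.single E (ComplexShape.up ℤ) 0).map f)).IsStrictlyLE 0 := by
    rw [CochainComplex.isStrictlyLE_iff]
    intro i hi
    rw [CochainComplex.mappingCone.isZero_X_iff]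
    exact ⟨P.isZero_of_isStrictlyLE 0 _ (by lia), single0_isZero Y i (by lia)⟩
  have hCG : Good F ((toK E).obj (CochainComplex.mappingCone
      (π ≫ (HomologicalComplex.single E (ComplexShape.up ℤ) 0).map f))) :=
    Good.of_distinguished (HomotopyCategory.mappingCone_triangleh_distinguished _)
      (Good.of_kProj (kProj_of_isProj (P := P) 0 hproj)) hY
  have hA := S.augExact hε h
  obtain ⟨t, ht⟩ := hA.exists_hom
  have hFA := (strictQuasiIso_map_iff_augExact (F := F) t _ ht).1 ((trW_map_iff _).1
    (hCG.trW_map_of_good hZ ((toK E).map t) ((trW_map_iff _).2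
      ((strictQuasiIso_iff_augExact (single0_isZero Z) t _ _ ht).2 hA))))
  -- Right exactness of `F` keeps the augmentation a strict epimorphism, which is the surjectivity
  -- that `projExact` needs.
  have hεs : IsStrictEpi ε := ((‹DetectedByProj E›).isStrictEpi_iff ε).2 hε.surj
  have := (S.map F).projExact (g := F.map g)
    (((‹DetectedByProj E'›).isStrictEpi_iff _).1 (isStrictEpi_map hεs))
    (fun i hi => by
      change F.map _ ≫ F.map _ = 0
      rw [← F.map_comp, hε.zero i hi, F.map_zero])
    (by rw [← F.map_comp, h.zero, F.map_zero]) (by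
      have e : F.map (S.e₀.inv ≫ g) = (S.map F).e₀.inv ≫ F.map g := F.map_comp _ _
      rw [← e]
      exact hFA)
  exact ⟨goodObj_of_augExact hproj hε this.2, this.1⟩

theorem goodObj_of_isZero {X : E} (hX : IsZero X) : GoodObj F X :=
  GoodObj.of_isProj (isProj_of_isZero hX)

theorem projExact_cycles {K : CochainComplex E ℤ} (hK : StrictlyAcyclic K) (i j k : ℤ)
    (hi : i + 1 = j) (hj : j + 1 = k) :
    ProjExact (kernel.ι (K.d i j)) (kernel.lift (K.d j k) (K.d i j) (K.d_comp_d i j k)) where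
  zero := by rw [← cancel_mono (kernel.ι (K.d j k))]; simp
  inj V hV x hx := by rw [← cancel_mono (kernel.ι (K.d i j)), hx, zero_comp]
  exact V hV y hy := ⟨kernel.lift _ y (by
    rw [← kernel.lift_ι (K.d j k) (K.d i j) (K.d_comp_d i j k), reassoc_of% hy, zero_comp]),
    kernel.lift_ι _ _ _⟩
  surj V hV z := by
    obtain ⟨y, hy⟩ := (DetectedByProj.strictlyAcyclic_iff ‹_› K).1 hK hV i j k hi hj
      (z ≫ kernel.ι _) (by simp)
    exact ⟨y, by rw [← cancel_mono (kernel.ι (K.d j k))]; simpa using hy⟩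

/-- All kernels of the differentials are good: they vanish above `n`, and goodness descends one
degree at a time along the short exact sequences of cycles. These sequences stay exact under `F`,
and pasting them gives acyclicity. -/
theorem strictlyAcyclic_map [∀ {X Y : E} (f : X ⟶ Y), PreservesColimit (parallelPair f 0) F]
    {K : CochainComplex E ℤ} (hK : StrictlyAcyclic K) (n : ℤ) [K.IsStrictlyLE n]
    (hgood : ∀ i, GoodObj F (K.X i)) : StrictlyAcyclic ((mapC F).obj K) := by
  have hz (m : ℕ) (i j : ℤ) (hi : i + 1 = j) (hm : n < i + m) :
      GoodObj F (kernel (K.d i j)) := by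
    induction m generalizing i j with
    | zero =>
      have := (K.isZero_of_isStrictlyLE n i (by simpa using hm))
      exact goodObj_of_isZero (this.of_mono (kernel.ι (K.d i j)))
    | succ m ih => exact (GoodObj.of_projExact (projExact_cycles hK i j (j + 1) hi rfl) (hgood i)
        (ih j (j + 1) rfl (by push_cast at hm; lia))).1
  have hz' (i j : ℤ) (hi : i + 1 = j) : GoodObj F (kernel (K.d i j)) :=
    hz (n + 1 - i).toNat i j hi (by lia)
  have hF (i j k : ℤ) (hi : i + 1 = j) (hj : j + 1 = k) := (GoodObj.of_projExact
    (projExact_cycles hK i j k hi hj) (hgood i) (hz' j k hj)).2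
  rw [DetectedByProj.strictlyAcyclic_iff ‹_›]
  intro V hV i j k hi hj x hx
  change V ⟶ F.obj (K.X j) at x
  change x ≫ F.map (K.d j k) = 0 at hx
  change ∃ y : V ⟶ F.obj (K.X i), y ≫ F.map (K.d i j) = x
  have hx' : x ≫ F.map (kernel.lift (K.d k (k + 1)) (K.d j k) (K.d_comp_d j k (k + 1))) = 0 := by
    refine (hF k (k + 1) (k + 2) rfl (by lia)).inj hV _ ?_
    rwa [Category.assoc, ← F.map_comp, kernel.lift_ι]
  obtain ⟨z, rfl⟩ := (hF j k (k + 1) hj rfl).exact hV x hx'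
  obtain ⟨y, rfl⟩ := (hF i j k hi hj).surj hV z
  exact ⟨y, by rw [Category.assoc, ← F.map_comp, kernel.lift_ι]⟩

/-- The cone of a projective resolution is a bounded above acyclic complex whose terms are
biproducts of a projective and a good object, so `F` keeps it acyclic. -/
theorem Good.of_goodObj [∀ {X Y : E} (f : X ⟶ Y), PreservesColimit (parallelPair f 0) F]
    (K : CochainComplex E ℤ) (n : ℤ) [K.IsStrictlyLE n] (hgood : ∀ i, GoodObj F (K.X i)) :
    Good F ((toK E).obj K) := by
  obtain ⟨R, t, hR, hproj, ht⟩ := exists_resolution IsProj DetectedByProj.enough K n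
  have hproj' (i : ℤ) : IsProj (R.X i) := by
    by_cases hi : i ≤ n
    · exact hproj i hi
    · exact isProj_of_isZero (R.isZero_of_isStrictlyLE n i (by lia))
  refine ⟨_, (toK E).map t, kProj_of_isProj n hproj', (trW_map_iff t).2 ht, ?_⟩
  have hC : (CochainComplex.mappingCone t).IsStrictlyLE n := by
    rw [CochainComplex.isStrictlyLE_iff]
    intro i hi
    rw [CochainComplex.mappingCone.isZero_X_iff]
    exact ⟨R.isZero_of_isStrictlyLE n _ (by lia), K.isZero_of_isStrictlyLE n i (by lia)⟩
  have := strictlyAcyclic_map (F := F) ht n fun i => (((GoodObj.of_isProj (hproj' (i + 1))).biprod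
    (hgood i)).of_iso (HomologicalComplex.homotopyCofiber.XIsoBiprod t i (i + 1) rfl).symm)
  exact ObjectProperty.trW.mk _ ((mapK F).map_distinguished _
    (HomotopyCategory.mappingCone_triangleh_distinguished t)) this

/-- Resolutions by good objects, rather than by projectives, suffice to recognise good objects. This
is needed because restriction of scalars is not known to preserve projectives. -/
theorem GoodObj.of_resolution
    [∀ {X Y : E} (f : X ⟶ Y), PreservesColimit (parallelPair f 0) F]
    {L : CochainComplex E ℤ} [L.IsStrictlyLE 0] {M : E} {ε : L.X 0 ⟶ M}
    (hgood : ∀ i ≤ 0, GoodObj F (L.X i)) (h : AugExact L ε)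
    (hF : AugExact ((mapC F).obj L) (M := F.obj M) (F.map ε)) : GoodObj F M := by
  obtain ⟨π, hπ⟩ := h.exists_hom
  refine (Good.of_goodObj L 0 fun i => ?_).of_trW ((toK E).map π)
    ((trW_map_iff _).2 ((strictQuasiIso_iff_augExact (single0_isZero M) π _ ε hπ).2 h))
    ((trW_map_iff _).2 ((strictQuasiIso_map_iff_augExact π ε hπ).2 hF))
  by_cases hi : i ≤ 0
  · exact hgood i hi
  · exact goodObj_of_isZero (L.isZero_of_isStrictlyLE 0 i (by lia))

end DerivedFunctor

end RelGeom

/-! ### Full faithfulness on the bounded above derived category -/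

namespace RelGeom

section FullyFaithful

variable {E : Type u} [Category.{v} E] [Preadditive E] [HasKernels E] [HasCokernels E]
  [HasZeroObject E] [HasBinaryBiproducts E]
  {E' : Type u'} [Category.{v'} E'] [Preadditive E'] [HasKernels E'] [HasCokernels E']
  [HasZeroObject E'] [HasBinaryBiproducts E']

section

variable {F : E ⥤ E'} {G : E' ⥤ E} [F.Additive] [G.Additive] (adj : F ⊣ G)

/-- The unit of an adjunction, on complexes. -/
def unitC (R : CochainComplex E ℤ) : R ⟶ (mapC G).obj ((mapC F).obj R) where
  f i := adj.unit.app (R.X i)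
  comm' i j _ := adj.unit_naturality (R.d i j)

/-- The counit of an adjunction, on complexes. -/
def counitC (K : CochainComplex E' ℤ) : (mapC F).obj ((mapC G).obj K) ⟶ K where
  f i := adj.counit.app (K.X i)
  comm' i j _ := (adj.counit_naturality (K.d i j)).symm

theorem unitC_naturality {R S : CochainComplex E ℤ} (f : R ⟶ S) :
    unitC adj R ≫ (mapC G).map ((mapC F).map f) = f ≫ unitC adj S := by
  ext i
  exact adj.unit_naturality (f.f i)

theorem counitC_naturality {K L : CochainComplex E' ℤ} (f : K ⟶ L) :
    (mapC F).map ((mapC G).map f) ≫ counitC adj L = counitC adj K ≫ f := by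
  ext i
  exact adj.counit_naturality (f.f i)

theorem left_triangleC (R : CochainComplex E ℤ) :
    (mapC F).map (unitC adj R) ≫ counitC adj ((mapC F).obj R) = 𝟙 _ := by
  ext i
  exact adj.left_triangle_components (R.X i)

theorem right_triangleC (K : CochainComplex E' ℤ) :
    unitC adj ((mapC G).obj K) ≫ (mapC G).map (counitC adj K) = 𝟙 _ := by
  ext i
  exact adj.right_triangle_components (K.X i)

theorem unitC_map_counitC {R : CochainComplex E ℤ} {K : CochainComplex E' ℤ}
    (g : R ⟶ (mapC G).obj K) :
    unitC adj R ≫ (mapC G).map ((mapC F).map g ≫ counitC adj K) = g := by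
  rw [Functor.map_comp, ← Category.assoc, unitC_naturality, Category.assoc, right_triangleC,
    Category.comp_id]

theorem adjK_bijective (R : CochainComplex E ℤ) (L : CochainComplex E' ℤ) :
    Function.Bijective (fun f : (toK E').obj ((mapC F).obj R) ⟶ (toK E').obj L =>
      ((toK E).map (unitC adj R) ≫ (mapK G).map f : (toK E).obj R ⟶ (mapK G).obj _)) := by
  let b (g : (toK E).obj R ⟶ (toK E).obj ((mapC G).obj L)) :
    (toK E').obj ((mapC F).obj R) ⟶ (toK E').obj L := (mapK F).map g ≫ (toK E').map (counitC adj L)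
  refine Function.bijective_iff_has_inverse.2 ⟨b, fun f => ?_, fun g => ?_⟩
  · obtain ⟨f, rfl⟩ := (toK E').map_surjective f
    have : (mapC F).map (unitC adj R ≫ (mapC G).map f) ≫ counitC adj L = f := by
      rw [Functor.map_comp, Category.assoc, counitC_naturality, ← Category.assoc, left_triangleC,
        Category.id_comp]
    exact congrArg (toK E').map this
  · obtain ⟨g, rfl⟩ := (toK E).map_surjective g
    exact congrArg (toK E).map (unitC_map_counitC adj g)

end

variable (G : E' ⥤ E) [G.Additive]
  [∀ {X Y : E'} (f : X ⟶ Y), PreservesLimit (parallelPair f 0) G]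
  [∀ {X Y : E'} (f : X ⟶ Y), PreservesColimit (parallelPair f 0) G]

def mapDIso : toD E' ⋙ mapD G ≅ mapK G ⋙ toD E := eqToIso (toD_mapD G)

variable (E) in
/-- A complex as an object of the derived category. -/
abbrev toDC (K : CochainComplex E ℤ) : DCat E := (toD E).obj ((toK E).obj K)

theorem boundedAbove_toDC (K : CochainComplex E ℤ) (n : ℤ) (hK : K.IsStrictlyLE n) :
    boundedAbove E (toDC E K) := ⟨K, n, hK, ⟨Iso.refl _⟩⟩

theorem bijective_map_of_iso {D : Type*} [Category* D] {D' : Type*} [Category* D'] (Φ : D ⥤ D')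
    {X Y X' Y' : D} (e : X ≅ X') (e' : Y ≅ Y')
    (h : Function.Bijective (Φ.map : (X' ⟶ Y') → _)) :
    Function.Bijective (Φ.map : (X ⟶ Y) → _) := by
  refine ⟨fun f g hfg => ?_, fun f => ?_⟩
  · have : e.inv ≫ f ≫ e'.hom = e.inv ≫ g ≫ e'.hom := by apply h.1; simp [hfg]
    simpa using this
  · obtain ⟨g, hg⟩ := h.2 (Φ.map e.inv ≫ f ≫ Φ.map e'.hom)
    exact ⟨e.hom ≫ g ≫ e'.inv, by simp [hg]⟩

theorem mapDMinus_full_faithful_iff : (mapDMinus G).Full ∧ (mapDMinus G).Faithful ↔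
    ∀ (K L : CochainComplex E' ℤ) (n m : ℤ), K.IsStrictlyLE n → L.IsStrictlyLE m →
      Function.Bijective ((mapD G).map : (toDC E' K ⟶ toDC E' L) → _) := by
  constructor
  · rintro ⟨h₁, h₂⟩ K L n m hK hL
    let K' : DMinus E' := ⟨_, boundedAbove_toDC K n hK⟩
    let L' : DMinus E' := ⟨_, boundedAbove_toDC L m hL⟩
    refine ⟨fun f g hfg => ?_, fun f => ?_⟩
    · exact congrArg (boundedAbove E').ι.map ((mapDMinus G).map_injective
        (X := K') (Y := L') (a₁ := ObjectProperty.homMk f) (a₂ := ObjectProperty.homMk g)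
        (ObjectProperty.hom_ext _ hfg))
    · obtain ⟨g, hg⟩ := (mapDMinus G).map_surjective (X := K') (Y := L') (ObjectProperty.homMk f)
      exact ⟨g.hom, congrArg (boundedAbove E).ι.map hg⟩
  · intro h
    have h' (X Y : DMinus E') : Function.Bijective ((mapD G).map : (X.obj ⟶ Y.obj) → _) := by
      obtain ⟨K, n, hK, ⟨e⟩⟩ := X.property
      obtain ⟨L, m, hL, ⟨e'⟩⟩ := Y.property
      exact bijective_map_of_iso _ e e' (h K L n m hK hL)
    refine ⟨⟨fun {X Y} f => ?_⟩, ⟨fun {X Y} f g hfg => ?_⟩⟩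
    · obtain ⟨g, hg⟩ := (h' X Y).2 f.hom
      exact ⟨ObjectProperty.homMk g, ObjectProperty.hom_ext _ hg⟩
    · exact ObjectProperty.hom_ext _ ((h' X Y).1
        (congrArg (boundedAbove E).ι.map hfg))

variable [DetectedByProj E] [DetectedByProj E']

omit [HasZeroObject E] [HasBinaryBiproducts E] [HasZeroObject E'] [HasBinaryBiproducts E']
  [DetectedByProj E] [DetectedByProj E'] in
theorem IsProj.map_leftAdjoint {F : E ⥤ E'} {G : E' ⥤ E}
    [G.Additive] [∀ {X Y : E'} (f : X ⟶ Y), PreservesColimit (parallelPair f 0) G]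
    (adj : F ⊣ G) {P : E} (hP : IsProj P) : IsProj (F.obj P) := by
  intro X Y e he f
  obtain ⟨g, hg⟩ := hP (G.map e) (isStrictEpi_map he) (adj.homEquiv _ _ f)
  refine ⟨(adj.homEquiv _ _).symm g, ?_⟩
  rw [← adj.homEquiv_naturality_right_symm, hg, Equiv.symm_apply_apply]

variable {G} {F : E ⥤ E'} [F.Additive] (adj : F ⊣ G)

include adj in
-- Both `R` and `F R` are bounded above complexes of projectives, so morphisms out of them in the
-- derived categories are homotopy classes, and the adjunction on complexes identifies morphisms `F
-- R ⟶ L` with morphisms `R ⟶ G L`, hence with `G K ⟶ G L`. Under this identification `mapD G`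
-- becomes precomposition with the derived counit `F R ⟶ K`.
theorem mapD_bijective_iff {R : CochainComplex E ℤ} (n : ℤ) [R.IsStrictlyLE n]
    (hR : ∀ i, IsProj (R.X i)) {K : CochainComplex E' ℤ} (π : R ⟶ (mapC G).obj K)
    (hπ : StrictQuasiIso π) (L : CochainComplex E' ℤ) :
    Function.Bijective ((mapD G).map : (toDC E' K ⟶ toDC E' L) → _) ↔
    Function.Bijective (fun u : toDC E' K ⟶ toDC E' L =>
      ((toD E').map ((toK E').map ((mapC F).map π ≫ counitC adj K)) ≫ u : _ ⟶ toDC E' L)) := by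
  have hRK : kProj E ((toK E).obj R) := kProj_of_isProj n hR
  have hFR : kProj E' ((toK E').obj ((mapC F).obj R)) :=
    kProj_of_isProj (P := (mapC F).obj R) n fun i => (hR i).map_leftAdjoint adj
  let un : (toK E).obj R ⟶ (mapK G).obj ((toK E').obj ((mapC F).obj R)) :=
    (toK E).map (unitC adj R)
  let β (L : CochainComplex E' ℤ) (w : toDC E' ((mapC F).obj R) ⟶ toDC E' L) :
      (toD E).obj ((toK E).obj R) ⟶ (mapD G).obj (toDC E' L) :=
    (toD E).map un ≫ (mapDIso G).inv.app _ ≫ (mapD G).map w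
  have hβ (L : CochainComplex E' ℤ) (w : (toK E').obj ((mapC F).obj R) ⟶ (toK E').obj L) :
      β L ((toD E').map w) = (toD E).map (un ≫ (mapK G).map w) ≫ (mapDIso G).inv.app _ := by
    have := (mapDIso G).inv.naturality w
    dsimp only [Functor.comp_map] at this
    simp only [β]
    rw [Functor.map_comp, Category.assoc, this]
  have hβ' : Function.Bijective (β L) := by
    rw [← Function.Bijective.of_comp_iff (β L) (kProj_toD_bijective hFR ((toK E').obj L))]
    have : β L ∘ (toD E').map = fun w => (toD E).map (un ≫ (mapK G).map w) ≫
        (mapDIso G).inv.app ((toK E').obj L) := funext (hβ L)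
    rw [this]
    have h₁ := (kProj_toD_bijective hRK ((mapK G).obj ((toK E').obj L))).comp
      (adjK_bijective adj R L)
    exact (show Function.Bijective (fun x : (toD E).obj ((toK E).obj R) ⟶ _ =>
      x ≫ (mapDIso G).inv.app ((toK E').obj L)) from
      ⟨fun a b h => (cancel_mono _).1 h, fun b => ⟨b ≫ (mapDIso G).hom.app _, by simp⟩⟩).comp h₁
  let s : (toK E').obj ((mapC F).obj R) ⟶ (toK E').obj K :=
    (toK E').map ((mapC F).map π ≫ counitC adj K)
  let t : (toK E).obj R ⟶ (mapK G).obj ((toK E').obj K) := (toK E).map π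
  have hs : un ≫ (mapK G).map s = t := by
    exact congrArg (toK E).map (unitC_map_counitC adj π)
  have ht : IsIso ((toD E).map t) := (trW_iff_isIso_toD _).1 ((trW_map_iff π).2 hπ)
  have key : (β L) ∘ (fun u : toDC E' K ⟶ toDC E' L => (toD E').map s ≫ u) =
      (fun x => ((toD E).map t ≫ (mapDIso G).inv.app _) ≫ x) ∘ (mapD G).map := by
    ext u
    have := hβ K s
    rw [hs] at this
    simp only [Function.comp, ← this, β, Functor.map_comp, Category.assoc]
  rw [← Function.Bijective.of_comp_iff' hβ', key, Function.Bijective.of_comp_iff']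
  exact ⟨fun a b h => (cancel_epi _).1 h, fun b => ⟨inv ((toD E).map t ≫
    (mapDIso G).inv.app _) ≫ b, by simp⟩⟩

include adj in
-- Yoneda with only two test objects, `F R` and `K`, which are both bounded above: surjectivity at
-- the first gives a one-sided inverse of the derived counit, and injectivity at the second makes it
-- two-sided.
theorem strictQuasiIso_of_full_faithful (h : (mapDMinus G).Full ∧ (mapDMinus G).Faithful)
    {R : CochainComplex E ℤ} (n : ℤ) [hR' : R.IsStrictlyLE n] (hR : ∀ i, IsProj (R.X i))
    {K : CochainComplex E' ℤ} (m : ℤ) [hK : K.IsStrictlyLE m]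
    (π : R ⟶ (mapC G).obj K) (hπ : StrictQuasiIso π) :
    StrictQuasiIso ((mapC F).map π ≫ counitC adj K) := by
  rw [mapDMinus_full_faithful_iff] at h
  rw [← trW_map_iff, trW_iff_isIso_toD]
  have h₁ := (mapD_bijective_iff adj n hR π hπ ((mapC F).obj R)).1 (h _ _ m n hK inferInstance)
  have h₂ := (mapD_bijective_iff adj n hR π hπ K).1 (h _ _ m m hK hK)
  obtain ⟨u, hu⟩ := h₁.2 (𝟙 _)
  dsimp only at hu
  refine ⟨u, hu, h₂.1 ?_⟩
  dsimp only
  rw [reassoc_of% hu, Category.comp_id]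

include adj in
theorem full_faithful_of_strictQuasiIso
    (h : ∀ (K : CochainComplex E' ℤ) (n : ℤ), K.IsStrictlyLE n →
      ∃ (R : CochainComplex E ℤ) (π : R ⟶ (mapC G).obj K), R.IsStrictlyLE n ∧
        (∀ i, IsProj (R.X i)) ∧ StrictQuasiIso π ∧
        StrictQuasiIso ((mapC F).map π ≫ counitC adj K)) :
    (mapDMinus G).Full ∧ (mapDMinus G).Faithful := by
  rw [mapDMinus_full_faithful_iff]
  intro K L n m hK hL
  obtain ⟨R, π, hR, hproj, hπ, hs⟩ := h K n hK
  rw [mapD_bijective_iff adj n hproj π hπ L]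
  rw [← trW_map_iff, trW_iff_isIso_toD] at hs
  exact ⟨fun a b h => (cancel_epi _).1 h, fun b => ⟨inv ((toD E').map ((toK E').map
    ((mapC F).map π ≫ counitC adj K))) ≫ b, IsIso.hom_inv_id_assoc _ _⟩⟩

end FullyFaithful

section Composition

variable {E₁ E₂ E₃ : Type*} [Category* E₁] [Category* E₂] [Category* E₃]
  [Preadditive E₁] [Preadditive E₂] [Preadditive E₃] [HasKernels E₁] [HasKernels E₂] [HasKernels E₃]
  [HasCokernels E₁] [HasCokernels E₂] [HasCokernels E₃] [HasZeroObject E₁] [HasZeroObject E₂]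
  [HasZeroObject E₃] [HasBinaryBiproducts E₁] [HasBinaryBiproducts E₂] [HasBinaryBiproducts E₃]
  (G₁ : E₁ ⥤ E₂) (G₂ : E₂ ⥤ E₃) [G₁.Additive] [G₂.Additive]
  [∀ {X Y : E₁} (f : X ⟶ Y), PreservesLimit (parallelPair f 0) G₁]
  [∀ {X Y : E₁} (f : X ⟶ Y), PreservesColimit (parallelPair f 0) G₁]
  [∀ {X Y : E₂} (f : X ⟶ Y), PreservesLimit (parallelPair f 0) G₂]
  [∀ {X Y : E₂} (f : X ⟶ Y), PreservesColimit (parallelPair f 0) G₂]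

def mapDCompLift : toD E₁ ⋙ mapD G₁ ⋙ mapD G₂ ≅ mapK G₁ ⋙ mapK G₂ ⋙ toD E₃ :=
  (Functor.associator _ _ _).symm ≪≫ Functor.isoWhiskerRight (mapDIso G₁) (mapD G₂) ≪≫
    Functor.associator _ _ _ ≪≫ Functor.isoWhiskerLeft (mapK G₁) (mapDIso G₂)

variable (E₁) in
/-- The functor induced by the identity on homotopy categories. -/
def mapKId : mapK (𝟭 E₁) ≅ 𝟭 (KCat E₁) :=
  Quotient.natIsoLift _ (Functor.isoWhiskerRight
    (Functor.mapHomologicalComplexIdIso E₁ (ComplexShape.up ℤ)) (toK E₁) ≪≫ Functor.leftUnitor _ ≪≫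
    (Functor.rightUnitor (toK E₁)).symm)

def mapDCompIso (G₃ : E₁ ⥤ E₃) [G₃.Additive]
    [∀ {X Y : E₁} (f : X ⟶ Y), PreservesLimit (parallelPair f 0) G₃]
    [∀ {X Y : E₁} (f : X ⟶ Y), PreservesColimit (parallelPair f 0) G₃]
    (e : G₃ ≅ G₁ ⋙ G₂) : mapD G₃ ≅ mapD G₁ ⋙ mapD G₂ :=
  Localization.liftNatIso (toD E₁) (acyclics E₁).trW (toD E₁ ⋙ mapD G₃)
    (toD E₁ ⋙ mapD G₁ ⋙ mapD G₂) _ _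
    (mapDIso G₃ ≪≫ Functor.isoWhiskerRight
      (Functor.mapHomotopyCategoryCompIso e.symm _).symm (toD E₃) ≪≫
      Functor.associator _ _ _ ≪≫ (mapDCompLift G₁ G₂).symm)

def mapDCompIsoId (G₂ : E₂ ⥤ E₁) [G₂.Additive]
    [∀ {X Y : E₂} (f : X ⟶ Y), PreservesLimit (parallelPair f 0) G₂]
    [∀ {X Y : E₂} (f : X ⟶ Y), PreservesColimit (parallelPair f 0) G₂]
    (e : 𝟭 E₁ ≅ G₁ ⋙ G₂) : 𝟭 (DCat E₁) ≅ mapD G₁ ⋙ mapD G₂ :=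
  Localization.liftNatIso (toD E₁) (acyclics E₁).trW (toD E₁)
    (toD E₁ ⋙ mapD G₁ ⋙ mapD G₂) _ _
    ((Functor.leftUnitor _).symm ≪≫ Functor.isoWhiskerRight
      ((mapKId E₁).symm ≪≫ (Functor.mapHomotopyCategoryCompIso e.symm _).symm) (toD E₁) ≪≫
      Functor.associator _ _ _ ≪≫ (mapDCompLift G₁ G₂).symm)

theorem mapDMinus_full_faithful_comp (G₃ : E₁ ⥤ E₃) [G₃.Additive]
    [∀ {X Y : E₁} (f : X ⟶ Y), PreservesLimit (parallelPair f 0) G₃]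
    [∀ {X Y : E₁} (f : X ⟶ Y), PreservesColimit (parallelPair f 0) G₃] (e : G₃ ≅ G₁ ⋙ G₂)
    (h₁ : (mapDMinus G₁).Full ∧ (mapDMinus G₁).Faithful)
    (h₂ : (mapDMinus G₂).Full ∧ (mapDMinus G₂).Faithful) :
    (mapDMinus G₃).Full ∧ (mapDMinus G₃).Faithful := by
  obtain ⟨_, _⟩ := h₁
  obtain ⟨_, _⟩ := h₂
  have i : mapDMinus G₃ ≅ mapDMinus G₁ ⋙ mapDMinus G₂ := NatIso.ofComponents
    (fun X => ObjectProperty.isoMk _ ((mapDCompIso G₁ G₂ G₃ e).app X.obj))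
    (fun f => ObjectProperty.hom_ext _ ((mapDCompIso G₁ G₂ G₃ e).hom.naturality f.hom))
  exact ⟨Functor.Full.of_iso i.symm, Functor.Faithful.of_iso i.symm⟩

/-- Serves for restriction along an isomorphism of rings: the two restrictions induce quasi-inverse
equivalences of the derived categories. -/
theorem mapDMinus_full_faithful_of_inverse (G₂ : E₂ ⥤ E₁) [G₂.Additive]
    [∀ {X Y : E₂} (f : X ⟶ Y), PreservesLimit (parallelPair f 0) G₂]
    [∀ {X Y : E₂} (f : X ⟶ Y), PreservesColimit (parallelPair f 0) G₂]
    (e : 𝟭 E₁ ≅ G₁ ⋙ G₂) (e' : 𝟭 E₂ ≅ G₂ ⋙ G₁) :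
    (mapDMinus G₁).Full ∧ (mapDMinus G₁).Faithful := by
  have : (mapD G₁).IsEquivalence :=
    Functor.IsEquivalence.mk' (mapD G₂) (mapDCompIsoId G₁ G₂ e) (mapDCompIsoId G₂ G₁ e').symm
  rw [mapDMinus_full_faithful_iff]
  exact fun K L _ _ _ _ => (Functor.FullyFaithful.ofFullyFaithful (mapD G₁)).map_bijective _ _

end Composition

end RelGeom

/-! ### Free modules, projective modules and extension of scalars -/

namespace RelGeom

section FreeModules

variable {C : Type u} [Category.{v} C] [Preadditive C] [HasFiniteLimits C] [HasFiniteColimits C]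
  [MonoidalCategory C] [SymmetricCategory C] [MonoidalClosed C]

section Free

variable {A : C} [MonObj A]

theorem mod_comp_hom {L M N : CategoryTheory.Mod C A} (f : L ⟶ M) (g : M ⟶ N) :
    (f ≫ g).hom = f.hom ≫ g.hom := rfl

theorem one_free_naturality {V W : C} (f : V ⟶ W) :
    ((λ_ V).inv ≫ η[A] ▷ V) ≫ A ◁ f = f ≫ (λ_ W).inv ≫ η[A] ▷ W := by
  simp only [Category.assoc, ← whisker_exchange]
  simp

theorem whiskerLeft_one_freeAct (V : C) :
    A ◁ ((λ_ V).inv ≫ η[A] ▷ V) ≫ freeAct A V = 𝟙 _ := by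
  have : A ◁ η[A] ▷ V ≫ (α_ A A V).inv = (α_ A _ V).inv ≫ (A ◁ η[A]) ▷ V := by simp
  rw [freeAct, whiskerLeft_comp, Category.assoc, reassoc_of% this, ← comp_whiskerRight,
    MonObj.mul_one]
  simp

theorem freeAct_lift {V : C} {N : CategoryTheory.Mod C A} (h : V ⟶ N.X) :
    A ◁ (A ◁ h ≫ act N) ≫ act N = freeAct A V ≫ A ◁ h ≫ act N := by
  have : μ[A] ▷ V ≫ A ◁ h = (A ⊗ A) ◁ h ≫ μ[A] ▷ N.X := (whisker_exchange _ _).symm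
  rw [freeAct, Category.assoc, reassoc_of% this, mul_act]
  simp

variable (A) in
/-- The identity, as a morphism to the underlying object of the free module. -/
def freeId (V : C) : A ⊗ V ⟶ (freeMod A V).X := 𝟙 (A ⊗ V)

instance (V : C) : IsIso (freeId A V) := inferInstanceAs (IsIso (𝟙 (A ⊗ V)))

variable (A) in
/-- The inclusion of generators. -/
def freeUnit (V : C) : V ⟶ (freeMod A V).X := (λ_ V).inv ≫ η[A] ▷ V ≫ freeId A V

theorem whiskerLeft_freeUnit_act (V : C) :
    A ◁ freeUnit A V ≫ act (freeMod A V) = freeId A V := by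
  refine Eq.trans ?_ (whiskerLeft_one_freeAct V)
  exact congrArg (fun x => A ◁ x ≫ freeAct A V) (congrArg _ (Category.comp_id _))

theorem one_freeId_hom {V : C} {N : CategoryTheory.Mod C A} (f : freeMod A V ⟶ N) :
    freeId A V ≫ f.hom = A ◁ (freeUnit A V ≫ f.hom) ≫ act N := by
  rw [whiskerLeft_comp, Category.assoc, act_hom, ← Category.assoc, whiskerLeft_freeUnit_act]

theorem freeMod_hom_ext {V : C} {N : CategoryTheory.Mod C A} {f g : freeMod A V ⟶ N}
    (h : freeUnit A V ≫ f.hom = freeUnit A V ≫ g.hom) : f = g :=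
  modHom_ext ((cancel_epi (freeId A V)).1 (by rw [one_freeId_hom, h, ← one_freeId_hom]))

/-- The linear extension of a morphism. -/
def freeLift {V : C} {N : CategoryTheory.Mod C A} (h : V ⟶ N.X) : freeMod A V ⟶ N :=
  mkHom (A ◁ h ≫ act N : A ⊗ V ⟶ N.X) (freeAct_lift h)

theorem freeId_freeLift {V : C} {N : CategoryTheory.Mod C A} (h : V ⟶ N.X) :
    freeId A V ≫ (freeLift h).hom = A ◁ h ≫ act N := Category.id_comp _

theorem freeId_freeMap {V W : C} (f : V ⟶ W) :
    freeId A V ≫ (freeMap A f).hom = A ◁ f ≫ freeId A W :=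
  (Category.id_comp (A ◁ f)).trans (Category.comp_id _).symm

theorem freeUnit_freeMap {V W : C} (f : V ⟶ W) :
    freeUnit A V ≫ (freeMap A f).hom = f ≫ freeUnit A W := by
  rw [freeUnit, Category.assoc, Category.assoc, freeId_freeMap, freeUnit]
  simpa using (one_free_naturality (A := A) f) =≫ freeId A W

theorem freeUnit_freeLift {V : C} {N : CategoryTheory.Mod C A} (h : V ⟶ N.X) :
    freeUnit A V ≫ (freeLift h).hom = h := by
  rw [freeUnit, Category.assoc, Category.assoc, freeId_freeLift, ← Category.assoc,
    ← Category.assoc, one_free_naturality, Category.assoc, Category.assoc, one_act,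
    Iso.inv_hom_id, Category.comp_id]

theorem freeUnit_freeMap_freeLift {V W : C} {N : CategoryTheory.Mod C A} (f : V ⟶ W)
    (g : W ⟶ N.X) : freeUnit A V ≫ (freeMap A f ≫ freeLift g).hom =
      freeUnit A V ≫ (freeLift (f ≫ g)).hom := by
  rw [freeUnit_freeLift, mod_comp_hom, ← Category.assoc, freeUnit_freeMap, Category.assoc,
    freeUnit_freeLift]

variable (A) in
/-- The free module functor. -/
def freeFunctor : C ⥤ CategoryTheory.Mod C A where
  obj V := freeMod A V
  map f := freeMap A f
  map_id := freeMap_id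
  map_comp := freeMap_comp

variable (A) in
/-- Free modules are left adjoint to the forgetful functor. -/
def freeAdj : freeFunctor A ⊣ Mod.forget (D := C) A :=
  Adjunction.mkOfHomEquiv
    { homEquiv := fun V _ =>
        { toFun := fun f => freeUnit A V ≫ f.hom
          invFun := fun h => freeLift h
          left_inv := fun _ => freeMod_hom_ext (freeUnit_freeLift _)
          right_inv := fun h => freeUnit_freeLift h }
      homEquiv_naturality_left_symm := fun f g => freeMod_hom_ext
        (freeUnit_freeMap_freeLift f g).symm
      homEquiv_naturality_right := fun _ _ => (Category.assoc _ _ _).symm }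

instance : (freeFunctor A).Additive where
  map_add := freeMap_add _ _

end Free

section Projectives

variable {A : C} [MonObj A]

theorem IsStrictEpi.whiskerLeft (X : C) {V W : C} {f : V ⟶ W} (hf : IsStrictEpi f) :
    IsStrictEpi (X ◁ f) := isStrictEpi_map (F := tensorLeft X) hf

/-- The factorization found in `C` is automatically linear, because `A ◁ f.hom` is still an
epimorphism. -/
theorem isStrictEpi_of_hom {M N : CategoryTheory.Mod C A} {f : M ⟶ N} (hf : IsStrictEpi f.hom) :
    IsStrictEpi f := by
  have := hf.2
  have := (hf.whiskerLeft A).2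
  refine isStrictEpi_of_desc (kerModι f) (kerModι_comp f)
    ⟨fun a b h => modHom_ext ((cancel_epi f.hom).1 (congrArg Mod.Hom.hom h))⟩ fun T t ht => ?_
  obtain ⟨s, hs⟩ := hf.desc t.hom (congrArg Mod.Hom.hom ht)
  refine ⟨mkHom s ?_, modHom_ext hs⟩
  rw [← cancel_epi (A ◁ f.hom), ← whiskerLeft_comp_assoc, hs, act_hom, ← Category.assoc, act_hom,
    Category.assoc, hs]

theorem isStrictEpi_iff_hom {M N : CategoryTheory.Mod C A} {f : M ⟶ N} :
    IsStrictEpi f ↔ IsStrictEpi f.hom :=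
  ⟨fun h => isStrictEpi_map (F := Mod.forget (D := C) A) h, isStrictEpi_of_hom⟩

theorem isProj_freeMod {V : C} (hV : IsProj V) : IsProj (freeMod A V) :=
  hV.map_leftAdjoint (freeAdj A)

/-- The inclusion of generators splits this morphism in `C`, though not linearly. -/
theorem isStrictEpi_freeLift_id (M : CategoryTheory.Mod C A) :
    IsStrictEpi (freeLift (𝟙 M.X) : freeMod A M.X ⟶ M) :=
  isStrictEpi_of_hom (isStrictEpi_of_splitEpi _ (freeUnit A M.X) (freeUnit_freeLift _))

variable [hC : DetectedByProj C]

theorem IsStrictEpi.comp {E : Type u} [Category.{v} E] [Preadditive E] [HasKernels E]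
    [HasCokernels E] (hE : DetectedByProj E) {X Y Z : E} {f : X ⟶ Y} {g : Y ⟶ Z}
    (hf : IsStrictEpi f) (hg : IsStrictEpi g) : IsStrictEpi (f ≫ g) := by
  rw [hE.isStrictEpi_iff] at *
  intro V hV x
  obtain ⟨y, rfl⟩ := hg hV x
  obtain ⟨z, rfl⟩ := hf hV y
  exact ⟨z, by simp⟩

theorem exists_free_strictEpi (M : CategoryTheory.Mod C A) :
    ∃ (V : C) (e : freeMod A V ⟶ M), IsProj V ∧ IsStrictEpi e := by
  obtain ⟨V, e, hV, he⟩ := hC.enough M.X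
  have h : IsStrictEpi (freeMap A e).hom := he.whiskerLeft A
  exact ⟨V, freeMap A e ≫ freeLift (𝟙 M.X), hV, isStrictEpi_of_hom
    (IsStrictEpi.comp (f := (freeMap A e).hom) hC h
      (isStrictEpi_iff_hom.1 (isStrictEpi_freeLift_id M)))⟩

/-- Strict epimorphisms of modules are detected in `C`, and free modules on projectives are
projective. This makes the derived machinery available for modules without first proving that they
form a quasi-abelian category. -/
instance modDetectedByProj : DetectedByProj (CategoryTheory.Mod C A) where
  enough M := by
    obtain ⟨V, e, hV, he⟩ := exists_free_strictEpi M
    exact ⟨_, e, isProj_freeMod hV, he⟩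
  cancel f g h := by
    have h' : IsStrictEpi (f ≫ g).hom := isStrictEpi_iff_hom.1 h
    exact isStrictEpi_of_hom (hC.cancel f.hom g.hom h')

end Projectives

section ExtendScalars

variable {A B D : C} [MonObj A] [MonObj B] [MonObj D] (φ : A ⟶ B) [IsMonHom φ] (ψ : B ⟶ D)
  [IsMonHom ψ]

theorem one_scale (V : C) : ((λ_ (A ⊗ V)).inv ≫ η[B] ▷ (A ⊗ V)) ≫ scale φ V = φ ▷ V := by
  have : η[B] ▷ (A ⊗ V) ≫ (α_ B A V).inv = (α_ _ A V).inv ≫ η[B] ▷ A ▷ V := by simp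
  rw [scale, Category.assoc, reassoc_of% this, ← comp_whiskerRight,
    ← whisker_exchange_assoc, MonObj.one_mul]
  simp

theorem freeUnit_freeScale (V : C) :
    freeUnit B (A ⊗ V) ≫ (freeScale φ V).hom = φ ▷ V ≫ freeId B V := by
  have h : freeId B (A ⊗ V) ≫ (freeScale φ V).hom = scale φ V ≫ freeId B V :=
    (Category.id_comp (scale φ V)).trans (Category.comp_id _).symm
  rw [freeUnit, Category.assoc, Category.assoc, h, ← one_scale φ V]
  simp only [Category.assoc]

/-- Morphisms that are linear along a morphism of monoids. -/
def IsSemilinear {M : CategoryTheory.Mod C A} {N : CategoryTheory.Mod C B} (h : M.X ⟶ N.X) : Prop :=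
  A ◁ h ≫ φ ▷ N.X ≫ act N = act M ≫ h

variable {φ} in
theorem IsSemilinear.comp {M : CategoryTheory.Mod C A} {N N' : CategoryTheory.Mod C B}
    {h : M.X ⟶ N.X} (hh : IsSemilinear φ h) (f : N ⟶ N') : IsSemilinear φ (h ≫ f.hom) := by
  unfold IsSemilinear at *
  rw [whiskerLeft_comp, Category.assoc, whisker_exchange_assoc, act_hom, ← Category.assoc (act M),
    ← hh]
  simp only [Category.assoc]

theorem freeLift_condition {M : CategoryTheory.Mod C A} {N : CategoryTheory.Mod C B}
    {h : M.X ⟶ N.X} (hh : IsSemilinear φ h) :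
    freeMap B (act M) ≫ freeLift h = freeScale φ M.X ≫ freeLift h := by
  apply freeMod_hom_ext
  rw [mod_comp_hom, mod_comp_hom, ← Category.assoc, ← Category.assoc, freeUnit_freeMap,
    freeUnit_freeScale, Category.assoc, Category.assoc, freeUnit_freeLift, freeId_freeLift,
    ← whisker_exchange_assoc]
  exact hh.symm

/-- The `B`-linear extension of a semilinear morphism. -/
def extendLift {M : CategoryTheory.Mod C A} {N : CategoryTheory.Mod C B}
    (h : M.X ⟶ N.X) (hh : IsSemilinear φ h) : extendObj φ M ⟶ N :=
  coequalizer.desc (freeLift h) (freeLift_condition φ hh)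

theorem toExtend_extendLift {M : CategoryTheory.Mod C A} {N : CategoryTheory.Mod C B}
    (h : M.X ⟶ N.X) (hh : IsSemilinear φ h) :
    toExtend φ M ≫ extendLift φ h hh = freeLift h := coequalizer.π_desc _ _

/-- The morphism `M ⟶ B ⊗_A M`. -/
def extendUnit (M : CategoryTheory.Mod C A) : M.X ⟶ (extendObj φ M).X :=
  freeUnit B M.X ≫ (toExtend φ M).hom

theorem extendUnit_semilinear (M : CategoryTheory.Mod C A) : IsSemilinear φ (extendUnit φ M) := by
  have h₁ : freeUnit B (A ⊗ M.X) ≫ (freeMap B (act M) ≫ toExtend φ M).hom =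
      freeUnit B (A ⊗ M.X) ≫ (freeScale φ M.X ≫ toExtend φ M).hom := by rw [toExtend_condition]
  rw [mod_comp_hom, mod_comp_hom, ← Category.assoc, ← Category.assoc, freeUnit_freeMap,
    freeUnit_freeScale, Category.assoc, Category.assoc, one_freeId_hom,
    ← whisker_exchange_assoc] at h₁
  exact h₁.symm

theorem extendObj_hom_ext {M : CategoryTheory.Mod C A} {N : CategoryTheory.Mod C B}
    {f g : extendObj φ M ⟶ N} (h : extendUnit φ M ≫ f.hom = extendUnit φ M ≫ g.hom) :
    f = g := by
  rw [← cancel_epi (toExtend φ M)]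
  apply freeMod_hom_ext
  rw [mod_comp_hom, mod_comp_hom, ← Category.assoc, ← Category.assoc]
  exact h

theorem extendUnit_extendLift {M : CategoryTheory.Mod C A} {N : CategoryTheory.Mod C B}
    (h : M.X ⟶ N.X) (hh : IsSemilinear φ h) : extendUnit φ M ≫ (extendLift φ h hh).hom = h := by
  rw [extendUnit, Category.assoc, ← mod_comp_hom, toExtend_extendLift, freeUnit_freeLift]

theorem extendUnit_naturality {M N : CategoryTheory.Mod C A} (f : M ⟶ N) :
    extendUnit φ M ≫ (extendMap φ f).hom = f.hom ≫ extendUnit φ N := by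
  rw [extendUnit, Category.assoc, ← mod_comp_hom, toExtend_map, mod_comp_hom, ← Category.assoc,
    freeUnit_freeMap, Category.assoc, extendUnit]

/-- Linear morphisms to a restriction are the semilinear morphisms. -/
def toComap {M : CategoryTheory.Mod C A} {N : CategoryTheory.Mod C B}
    (h : M.X ⟶ N.X) (hh : IsSemilinear φ h) : M ⟶ (Mod.comap (D := C) φ).obj N := mkHom h hh

/-- The semilinear morphism underlying a linear morphism to a restriction. -/
def ofComap {M : CategoryTheory.Mod C A} {N : CategoryTheory.Mod C B}
    (h : M ⟶ (Mod.comap (D := C) φ).obj N) : M.X ⟶ N.X := h.hom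

theorem ofComap_semilinear {M : CategoryTheory.Mod C A} {N : CategoryTheory.Mod C B}
    (h : M ⟶ (Mod.comap (D := C) φ).obj N) : IsSemilinear φ (ofComap φ h) := act_hom h

theorem extendLift_naturality {M M' : CategoryTheory.Mod C A} {N : CategoryTheory.Mod C B}
    (f : M ⟶ M') (h : M'.X ⟶ N.X) (hh : IsSemilinear φ h) (hh' : IsSemilinear φ (f.hom ≫ h)) :
    extendLift φ (f.hom ≫ h) hh' = extendMap φ f ≫ extendLift φ h hh := by
  apply extendObj_hom_ext
  rw [extendUnit_extendLift, mod_comp_hom, ← Category.assoc, extendUnit_naturality,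
    Category.assoc, extendUnit_extendLift]

/-- Extension of scalars is left adjoint to restriction. -/
def extendAdj : extendScalars φ ⊣ Mod.comap (D := C) φ :=
  Adjunction.mkOfHomEquiv
    { homEquiv := fun M _ =>
        { toFun := fun f => toComap φ (extendUnit φ M ≫ f.hom) ((extendUnit_semilinear φ M).comp f)
          invFun := fun h => extendLift φ (ofComap φ h) (ofComap_semilinear φ h)
          left_inv := fun _ => extendObj_hom_ext φ (extendUnit_extendLift φ _ _)
          right_inv := fun _ => modHom_ext (extendUnit_extendLift φ _ _) }
      homEquiv_naturality_left_symm := fun f g =>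
        extendLift_naturality φ f (ofComap φ g) (ofComap_semilinear φ g)
          (ofComap_semilinear φ (f ≫ g))
      homEquiv_naturality_right := fun _ _ => modHom_ext (Category.assoc _ _ _).symm }

instance extendScalars_preservesCokernel {M N : CategoryTheory.Mod C A} (f : M ⟶ N) :
    PreservesColimit (parallelPair f 0) (extendScalars φ) :=
  have := (extendAdj φ).leftAdjoint_preservesColimits
  inferInstance

/-- Extension of scalars of a free module is free. -/
def extendFreeIso : freeFunctor A ⋙ extendScalars φ ≅ freeFunctor B :=
  ((freeAdj A).comp (extendAdj φ)).leftAdjointUniq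
    (show freeFunctor B ⊣ Mod.comap (D := C) φ ⋙ Mod.forget (D := C) A from freeAdj B)

def comapCompIso (χ : A ⟶ D) [IsMonHom χ] (h : χ = φ ≫ ψ) :
    Mod.comap (D := C) χ ≅ Mod.comap (D := C) ψ ⋙ Mod.comap (D := C) φ :=
  NatIso.ofComponents
    (fun M =>
      { hom := mkHom (𝟙 M.X) (by
          change A ◁ 𝟙 M.X ≫ φ ▷ M.X ≫ ψ ▷ M.X ≫ act M = (χ ▷ M.X ≫ act M) ≫ 𝟙 M.X
          simp [h])
        inv := mkHom (𝟙 M.X) (by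
          change A ◁ 𝟙 M.X ≫ χ ▷ M.X ≫ act M = (φ ▷ M.X ≫ ψ ▷ M.X ≫ act M) ≫ 𝟙 M.X
          simp [h])
        hom_inv_id := modHom_ext (Category.id_comp (𝟙 M.X))
        inv_hom_id := modHom_ext (Category.id_comp (𝟙 M.X)) })
    (fun {M N} f => modHom_ext ((Category.comp_id f.hom).trans (Category.id_comp f.hom).symm))

def comapIdIso (χ : A ⟶ A) [IsMonHom χ] (h : χ = 𝟙 A) :
    𝟭 (CategoryTheory.Mod C A) ≅ Mod.comap (D := C) χ :=
  NatIso.ofComponents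
    (fun M =>
      { hom := mkHom (𝟙 M.X) (by
          change A ◁ 𝟙 M.X ≫ χ ▷ M.X ≫ act M = act M ≫ 𝟙 M.X
          simp [h])
        inv := mkHom (𝟙 M.X) (by
          change A ◁ 𝟙 M.X ≫ act M = (χ ▷ M.X ≫ act M) ≫ 𝟙 M.X
          simp [h])
        hom_inv_id := modHom_ext (Category.id_comp (𝟙 M.X))
        inv_hom_id := modHom_ext (Category.id_comp (𝟙 M.X)) })
    (fun {M N} f => modHom_ext ((Category.comp_id f.hom).trans (Category.id_comp f.hom).symm))

def extendCompIso (χ : A ⟶ D) [IsMonHom χ] (h : χ = φ ≫ ψ) :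
    extendScalars χ ≅ extendScalars φ ⋙ extendScalars ψ :=
  (extendAdj χ).leftAdjointUniq
    (((extendAdj φ).comp (extendAdj ψ)).ofNatIsoRight (comapCompIso φ ψ χ h).symm)

end ExtendScalars

end FreeModules

end RelGeom

/-! ### Exact functors, free presentations and tensoring a module with an object -/

namespace RelGeom

section ExactFunctors

variable {E : Type u} [Category.{v} E] [Preadditive E] [HasKernels E] [HasCokernels E]
  [HasZeroObject E] [HasBinaryBiproducts E] [DetectedByProj E]
  {E' : Type u'} [Category.{v'} E'] [Preadditive E'] [HasKernels E'] [HasCokernels E']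
  [HasZeroObject E'] [HasBinaryBiproducts E'] [DetectedByProj E']
  {F G : E ⥤ E'} [F.Additive] [G.Additive]

theorem strictQuasiIso_map_iff {K L : CochainComplex E ℤ} (φ : K ⟶ L) :
    StrictQuasiIso ((mapC F).map φ) ↔
      StrictlyAcyclic ((mapC F).obj (CochainComplex.mappingCone φ)) :=
  ((acyclics E').prop_iff_of_iso ((toK E').mapIso
    (CochainComplex.mappingCone.mapHomologicalComplexIso φ F))).symm

theorem StrictQuasiIso.map [∀ {X Y : E} (f : X ⟶ Y), PreservesLimit (parallelPair f 0) F]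
    [∀ {X Y : E} (f : X ⟶ Y), PreservesColimit (parallelPair f 0) F]
    {K L : CochainComplex E ℤ} {φ : K ⟶ L} (h : StrictQuasiIso φ) :
    StrictQuasiIso ((mapC F).map φ) :=
  (strictQuasiIso_map_iff φ).2 (StrictlyAcyclic.map F h)

theorem AugExact.map [∀ {X Y : E} (f : X ⟶ Y), PreservesLimit (parallelPair f 0) F]
    [∀ {X Y : E} (f : X ⟶ Y), PreservesColimit (parallelPair f 0) F]
    {P : CochainComplex E ℤ} [P.IsStrictlyLE 0] {M : E} {ε : P.X 0 ⟶ M} (h : AugExact P ε) :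
    AugExact ((mapC F).obj P) (M := F.obj M) (F.map ε) := by
  obtain ⟨π, hπ⟩ := h.exists_hom
  exact (strictQuasiIso_map_iff_augExact π ε hπ).1
    ((strictQuasiIso_iff_augExact (single0_isZero M) π _ ε hπ).2 h).map

theorem AugExact.of_iso {P : CochainComplex E ℤ} {M : E} {ε : P.X 0 ⟶ M}
    (h : AugExact ((mapC F).obj P) (M := F.obj M) (F.map ε)) (e : F ≅ G) :
    AugExact ((mapC G).obj P) (M := G.obj M) (G.map ε) := by
  have comm {V : E'} {X Y : E} (f : X ⟶ Y) {y : V ⟶ F.obj X} {x : V ⟶ G.obj Y}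
      (hy : y ≫ F.map f = x ≫ e.inv.app Y) : (y ≫ e.hom.app X) ≫ G.map f = x := by
    rw [Category.assoc, ← e.hom.naturality, reassoc_of% hy, Iso.inv_hom_id_app]
    exact Category.comp_id _
  have comm' {V : E'} {X Y : E} (f : X ⟶ Y) {y : V ⟶ G.obj X}
      (hy : y ≫ G.map f = 0) : (y ≫ e.inv.app X) ≫ F.map f = 0 := by
    rw [Category.assoc, ← e.inv.naturality, reassoc_of% hy, zero_comp]
  refine ⟨fun V hV x => ?_, fun i hi => ?_, fun V hV i hi y hy => ?_,
    fun V hV i j k hi hj hk y hy => ?_⟩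
  · obtain ⟨y, hy⟩ := h.surj hV (x ≫ e.inv.app M)
    exact ⟨y ≫ e.hom.app _, comm ε hy⟩
  · have := h.zero i hi
    change F.map _ ≫ F.map _ = 0 at this
    change G.map _ ≫ G.map _ = 0
    rw [← cancel_epi (e.hom.app _), ← G.map_comp, ← e.hom.naturality, F.map_comp, this]
    simp
  · obtain ⟨z, hz⟩ := h.exact_zero hV i hi (y ≫ e.inv.app _) (comm' ε hy)
    exact ⟨z ≫ e.hom.app _, comm (P.d i 0) hz⟩
  · obtain ⟨z, hz⟩ := h.exact_neg hV i j k hi hj hk (y ≫ e.inv.app _) (comm' (P.d j k) hy)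
    exact ⟨z ≫ e.hom.app _, comm (P.d i j) hz⟩

/-- Strict acyclicity says that each differential, corestricted to the next kernel, is a strict
epimorphism. `F` preserves that kernel and reflects strict epimorphisms. -/
theorem StrictlyAcyclic.of_map [∀ {X Y : E} (f : X ⟶ Y), PreservesLimit (parallelPair f 0) F]
    (hF : ∀ ⦃X Y : E⦄ (f : X ⟶ Y), IsStrictEpi (F.map f) → IsStrictEpi f)
    {K : CochainComplex E ℤ} (h : StrictlyAcyclic ((mapC F).obj K)) : StrictlyAcyclic K := by
  intro i
  rw [RelGeom.strictlyExact_iff]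
  apply hF
  rw [DetectedByProj.isStrictEpi_iff ‹_›]
  intro V hV x
  have hm : Mono (F.map (kernel.ι (K.sc i).g)) := by
    rw [← kernelComparison_comp_ι, ← PreservesKernel.iso_hom]
    infer_instance
  obtain ⟨y, hy⟩ := (DetectedByProj.strictlyExact_iff ‹_› _).1 (h i) hV
    (x ≫ F.map (kernel.ι (K.sc i).g)) (by
      refine (Category.assoc _ _ _).trans ?_
      change x ≫ F.map (kernel.ι (K.sc i).g) ≫ F.map (K.sc i).g = 0
      rw [← F.map_comp, kernel.condition, F.map_zero, comp_zero])
  refine ⟨y, ?_⟩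
  rw [← cancel_mono (F.map (kernel.ι (K.sc i).g))]
  refine (Category.assoc _ _ _).trans (Eq.trans ?_ hy)
  rw [← F.map_comp, kernel.lift_ι]
  rfl

theorem StrictQuasiIso.of_map [∀ {X Y : E} (f : X ⟶ Y), PreservesLimit (parallelPair f 0) F]
    (hF : ∀ ⦃X Y : E⦄ (f : X ⟶ Y), IsStrictEpi (F.map f) → IsStrictEpi f)
    {K L : CochainComplex E ℤ} {φ : K ⟶ L} (h : StrictQuasiIso ((mapC F).map φ)) :
    StrictQuasiIso φ :=
  StrictlyAcyclic.of_map hF ((strictQuasiIso_map_iff φ).1 h)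

theorem AugExact.of_map [∀ {X Y : E} (f : X ⟶ Y), PreservesLimit (parallelPair f 0) F]
    (hF : ∀ ⦃X Y : E⦄ (f : X ⟶ Y), IsStrictEpi (F.map f) → IsStrictEpi f)
    {P : CochainComplex E ℤ} [P.IsStrictlyLE 0] {M : E} {ε : P.X 0 ⟶ M}
    (hε : ∀ i, i + 1 = 0 → P.d i 0 ≫ ε = 0)
    (h : AugExact ((mapC F).obj P) (M := F.obj M) (F.map ε)) : AugExact P ε := by
  obtain ⟨π, hπ⟩ : ∃ π : P ⟶ single0 M, π.f 0 ≫ (single0Iso M).hom = ε :=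
    ⟨HomologicalComplex.mkHomToSingle ε (fun i hi => hε i hi), by simp⟩
  exact (strictQuasiIso_iff_augExact (single0_isZero M) π _ ε hπ).1
    (((strictQuasiIso_map_iff_augExact π ε hπ).2 h).of_map hF)

end ExactFunctors

section CompositeFunctors

variable {E E' E'' : Type*} [Category* E] [Category* E'] [Category* E''] [Preadditive E]
  [Preadditive E'] [Preadditive E''] (F : E ⥤ E') (G : E' ⥤ E'') [F.Additive] [G.Additive]

theorem comp_preservesCokernel [∀ {X Y : E} (f : X ⟶ Y), PreservesColimit (parallelPair f 0) F]
    [∀ {X Y : E'} (f : X ⟶ Y), PreservesColimit (parallelPair f 0) G] {X Y : E} (f : X ⟶ Y) :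
    PreservesColimit (parallelPair f 0) (F ⋙ G) :=
  have : PreservesColimit (parallelPair f 0 ⋙ F) G :=
    preservesColimit_of_iso_diagram (K₁ := parallelPair (F.map f) 0) G
      (parallelPair.ext (Iso.refl _) (Iso.refl _) (by simp) (by simp))
  comp_preservesColimit _ _

end CompositeFunctors

section FreePresentations

variable {C : Type u} [Category.{v} C] [Preadditive C] [HasFiniteLimits C] [HasFiniteColimits C]
  [MonoidalCategory C] [SymmetricCategory C] [MonoidalClosed C] {A : C} [MonObj A]

theorem exists_free_presentation (M : CategoryTheory.Mod C A) :
    ∃ (V W : C) (r : freeMod A W ⟶ freeMod A V) (e : freeMod A V ⟶ M) (w : r ≫ e = 0),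
      Nonempty (IsColimit (CokernelCofork.ofπ e w)) := by
  let e : freeMod A M.X ⟶ M := freeLift (𝟙 M.X)
  have he : IsStrictEpi e := isStrictEpi_freeLift_id M
  let s : freeMod A (kernel e).X ⟶ kernel e := freeLift (𝟙 _)
  have hs : Epi s := (isStrictEpi_freeLift_id (kernel e)).2
  have h (T : CategoryTheory.Mod C A) (t : freeMod A M.X ⟶ T) (ht : (s ≫ kernel.ι e) ≫ t = 0) :
      ∃ u, e ≫ u = t := he.desc t (by rw [← cancel_epi s, ← Category.assoc, ht, comp_zero])
  have := he.2
  exact ⟨_, _, s ≫ kernel.ι e, e, by simp, ⟨CokernelCofork.IsColimit.ofπ _ _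
    (fun t ht => (h _ t ht).choose) (fun t ht => (h _ t ht).choose_spec)
    (fun t ht m hm => (cancel_epi e).1 (hm.trans (h _ t ht).choose_spec.symm))⟩⟩

/-- Every module is the cokernel of a morphism between free modules on arbitrary objects of `C`, and
both functors preserve this cokernel. -/
theorem isIso_app_of_isIso_free {D : Type u'} [Category.{v'} D] [Preadditive D]
    {F G : CategoryTheory.Mod C A ⥤ D} [F.Additive] [G.Additive]
    [∀ {X Y : CategoryTheory.Mod C A} (f : X ⟶ Y), PreservesColimit (parallelPair f 0) F]
    [∀ {X Y : CategoryTheory.Mod C A} (f : X ⟶ Y), PreservesColimit (parallelPair f 0) G]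
    (α : F ⟶ G) (h : ∀ V, IsIso (α.app (freeMod A V))) (M : CategoryTheory.Mod C A) :
    IsIso (α.app M) := by
  obtain ⟨V, W, r, e, w, ⟨hc⟩⟩ := exists_free_presentation M
  have hF := CokernelCofork.mapIsColimit _ hc F
  have hG := CokernelCofork.mapIsColimit _ hc G
  have : Epi (F.map e) := Cofork.IsColimit.epi hF
  have : Epi (G.map e) := Cofork.IsColimit.epi hG
  have := h V
  have := h W
  obtain ⟨i, hi⟩ : ∃ i : G.obj M ⟶ F.obj M, G.map e ≫ i = inv (α.app _) ≫ F.map e :=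
    ⟨_, (CokernelCofork.IsColimit.desc' hG (inv (α.app (freeMod A V)) ≫ F.map e) (by
      rw [← cancel_epi (α.app (freeMod A W)), ← NatTrans.naturality_assoc, IsIso.hom_inv_id_assoc,
        ← F.map_comp, w, F.map_zero, comp_zero])).2⟩
  refine ⟨i, ?_, ?_⟩
  · rw [← cancel_epi (F.map e), NatTrans.naturality_assoc, hi, IsIso.hom_inv_id_assoc,
      Category.comp_id]
  · rw [← cancel_epi (G.map e), reassoc_of% hi, NatTrans.naturality, IsIso.inv_hom_id_assoc,
      Category.comp_id]

end FreePresentations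

section TensorObject

variable {C : Type u} [Category.{v} C] [Preadditive C] [HasFiniteLimits C] [HasFiniteColimits C]
  [MonoidalCategory C] [SymmetricCategory C] [MonoidalClosed C]
  {A B : C} [MonObj A] [MonObj B] (φ : A ⟶ B) [IsMonHom φ]

instance tensorRight_preservesCokernel (V : C) {X Y : C} (f : X ⟶ Y) :
    PreservesColimit (parallelPair f 0) (tensorRight V) :=
  preservesColimit_of_natIso _ (BraidedCategory.tensorLeftIsoTensorRight V)

instance tensorRight_additive (V : C) : (tensorRight V).Additive where
  map_add := MonoidalPreadditive.add_whiskerRight _ _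

/-- The action of `A` on `X ⊗ V`. -/
def tensAct {A X : C} (a : A ⊗ X ⟶ X) (V : C) : A ⊗ X ⊗ V ⟶ X ⊗ V := (α_ A X V).inv ≫ a ▷ V

theorem tensAct_one {X : C} {a : A ⊗ X ⟶ X} (h : η[A] ▷ X ≫ a = (λ_ X).hom) (V : C) :
    η[A] ▷ (X ⊗ V) ≫ tensAct a V = (λ_ (X ⊗ V)).hom := by
  have : η[A] ▷ (X ⊗ V) ≫ (α_ A X V).inv = (α_ _ X V).inv ≫ η[A] ▷ X ▷ V := by simp
  rw [tensAct, reassoc_of% this, ← comp_whiskerRight, h]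
  simp

theorem tensAct_mul {X : C} {a : A ⊗ X ⟶ X} (h : μ[A] ▷ X ≫ a = (α_ A A X).hom ≫ A ◁ a ≫ a)
    (V : C) : μ[A] ▷ (X ⊗ V) ≫ tensAct a V =
      (α_ A A (X ⊗ V)).hom ≫ A ◁ tensAct a V ≫ tensAct a V := by
  have : μ[A] ▷ (X ⊗ V) ≫ (α_ A X V).inv = (α_ _ X V).inv ≫ μ[A] ▷ X ▷ V := by simp
  rw [tensAct, reassoc_of% this, ← comp_whiskerRight, h]
  simp

theorem tensAct_naturality {A X Y : C} {a : A ⊗ X ⟶ X} {b : A ⊗ Y ⟶ Y} {f : X ⟶ Y}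
    (h : A ◁ f ≫ b = a ≫ f) (V : C) : A ◁ f ▷ V ≫ tensAct b V = tensAct a V ≫ f ▷ V := by
  rw [tensAct, tensAct, Category.assoc, ← comp_whiskerRight, ← h]
  simp

/-- The module `M ⊗ V`. -/
def tensMod (V : C) (M : CategoryTheory.Mod C A) : CategoryTheory.Mod C A :=
  mkMod (M.X ⊗ V) (tensAct (act M) V) (tensAct_one (one_act M) V) (tensAct_mul (mul_act M) V)

variable (A) in
/-- The functor `M ↦ M ⊗ V`. -/
def tens (V : C) : CategoryTheory.Mod C A ⥤ CategoryTheory.Mod C A where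
  obj M := tensMod V M
  map f := mkHom (f.hom ▷ V : _ ⊗ V ⟶ _ ⊗ V) (tensAct_naturality (act_hom f) V)
  map_id M := modHom_ext (id_whiskerRight M.X V)
  map_comp f g := modHom_ext (comp_whiskerRight f.hom g.hom V)

instance (V : C) : (tens A V).Additive where
  map_add {_ _ f g} := modHom_ext (MonoidalPreadditive.add_whiskerRight f.hom g.hom (X := V))

instance tens_preservesCokernel (V : C) {M N : CategoryTheory.Mod C A} (f : M ⟶ N) :
    PreservesColimit (parallelPair f 0) (tens A V) :=
  have : PreservesColimit (parallelPair f 0 ⋙ Mod.forget (D := C) A) (tensorRight V) :=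
    preservesColimit_of_iso_diagram (K₁ := parallelPair f.hom 0) (tensorRight V)
      (parallelPair.ext (Iso.refl M.X) (Iso.refl N.X)
        ((Category.comp_id _).trans (Category.id_comp _).symm)
        ((Category.comp_id _).trans (Category.id_comp _).symm))
  have : PreservesColimit (parallelPair f 0) (tens A V ⋙ Mod.forget A) :=
    inferInstanceAs (PreservesColimit (parallelPair f 0) (Mod.forget A ⋙ tensorRight V))
  have : ReflectsColimit (parallelPair ((tens A V).map f) 0)
      (Mod.forget (D := C) A) := reflectsColimit_of_reflectsIsomorphisms _ _
  have : ReflectsColimit (parallelPair f 0 ⋙ tens A V) (Mod.forget (D := C) A) :=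
    reflectsColimit_of_iso_diagram (K₁ := parallelPair ((tens A V).map f) 0)
      (K₂ := parallelPair f 0 ⋙ tens A V) _
      (parallelPair.ext (Iso.refl _) (Iso.refl _) (by simp) (by simp))
  preservesColimit_of_reflects_of_preserves (tens A V) (Mod.forget A)

/-- The tensor product of a free module with an object is free. -/
def tensFreeIso (W V : C) : (tens A V).obj (freeMod A W) ≅ freeMod A (W ⊗ V) where
  hom := mkHom ((α_ A W V).hom : (A ⊗ W) ⊗ V ⟶ A ⊗ W ⊗ V) (by
    change A ◁ (α_ A W V).hom ≫ (α_ A A (W ⊗ V)).inv ≫ μ[A] ▷ (W ⊗ V) =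
      ((α_ A (A ⊗ W) V).inv ≫ ((α_ A A W).inv ≫ μ[A] ▷ W) ▷ V) ≫ (α_ A W V).hom
    simp)
  inv := mkHom ((α_ A W V).inv : A ⊗ W ⊗ V ⟶ (A ⊗ W) ⊗ V) (by
    change A ◁ (α_ A W V).inv ≫ (α_ A (A ⊗ W) V).inv ≫ ((α_ A A W).inv ≫ μ[A] ▷ W) ▷ V =
      ((α_ A A (W ⊗ V)).inv ≫ μ[A] ▷ (W ⊗ V)) ≫ (α_ A W V).inv
    simp)
  hom_inv_id := modHom_ext (α_ A W V).hom_inv_id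
  inv_hom_id := modHom_ext (α_ A W V).inv_hom_id

end TensorObject

end RelGeom

/-! ### Flatness, and good modules from free modules -/

namespace RelGeom

section FreeOn

variable {C : Type u} [Category.{v} C] [Preadditive C] [HasFiniteLimits C] [HasFiniteColimits C]
  [MonoidalCategory C] [SymmetricCategory C] [MonoidalClosed C]
  {A B : C} [MonObj A] [MonObj B] (φ : A ⟶ B) [IsMonHom φ]

/-- The module `M` is free on `e`. -/
def IsFreeOn {V : C} {M : CategoryTheory.Mod C A} (e : V ⟶ M.X) : Prop :=
  IsIso (freeLift e : freeMod A V ⟶ M)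

theorem freeLift_comp {V : C} {M N : CategoryTheory.Mod C A} (e : V ⟶ M.X) (f : M ⟶ N) :
    freeLift e ≫ f = freeLift (e ≫ f.hom) := by
  apply freeMod_hom_ext
  rw [mod_comp_hom, ← Category.assoc, freeUnit_freeLift, freeUnit_freeLift]

theorem isFreeOn_freeUnit (V : C) : IsFreeOn (freeUnit A V) := by
  have : freeLift (freeUnit A V) = 𝟙 (freeMod A V) := freeMod_hom_ext (by
    rw [freeUnit_freeLift]
    exact (Category.comp_id _).symm)
  unfold IsFreeOn
  rw [this]
  infer_instance

theorem IsFreeOn.comp {V : C} {M N : CategoryTheory.Mod C A} {e : V ⟶ M.X} (he : IsFreeOn e)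
    (f : M ⟶ N) [IsIso f] : IsFreeOn (e ≫ f.hom) := by
  unfold IsFreeOn at *
  rw [← freeLift_comp]
  infer_instance

theorem IsFreeOn.isIso {V : C} {M N : CategoryTheory.Mod C A} {e : V ⟶ M.X} (he : IsFreeOn e)
    (f : M ⟶ N) (hf : IsFreeOn (e ≫ f.hom)) : IsIso f := by
  unfold IsFreeOn at *
  rw [← freeLift_comp] at hf
  exact IsIso.of_isIso_comp_left (freeLift e) f

/-- A version of `extendFreeIso` that keeps track of generators, so that a given comparison morphism
can be shown invertible by following them. -/
theorem isFreeOn_extend_freeMod (V : C) :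
    IsFreeOn (freeUnit A V ≫ extendUnit φ (freeMod A V)) := by
  let k : freeMod A V ⟶ (Mod.comap (D := C) φ).obj (freeMod B V) := freeLift (freeUnit B V)
  have hk : freeUnit A V ≫ ofComap φ k = freeUnit B V :=
    freeUnit_freeLift (A := A) (N := (Mod.comap (D := C) φ).obj (freeMod B V)) (freeUnit B V)
  refine ⟨extendLift φ (ofComap φ k) (ofComap_semilinear φ k), ?_, ?_⟩
  · rw [freeLift_comp, Category.assoc, extendUnit_extendLift, hk]
    apply freeMod_hom_ext
    rw [freeUnit_freeLift]
    exact (Category.comp_id _).symm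
  · apply extendObj_hom_ext
    rw [mod_comp_hom, ← Category.assoc, extendUnit_extendLift]
    have : toComap φ _ ((ofComap_semilinear φ k).comp
        (freeLift (freeUnit A V ≫ extendUnit φ (freeMod A V)))) =
        toComap φ _ (extendUnit_semilinear φ (freeMod A V)) := by
      apply freeMod_hom_ext
      change freeUnit A V ≫ ofComap φ k ≫ (freeLift _).hom = _
      rw [← Category.assoc, hk, freeUnit_freeLift]
      rfl
    exact (congrArg (ofComap φ) this).trans (Category.comp_id _).symm

theorem IsFreeOn.extend {V : C} {M : CategoryTheory.Mod C A} {e : V ⟶ M.X} (he : IsFreeOn e) :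
    IsFreeOn (e ≫ extendUnit φ M) := by
  have : IsIso (freeLift e : freeMod A V ⟶ M) := he
  have : IsIso (extendMap φ (freeLift e : freeMod A V ⟶ M)) :=
    inferInstanceAs (IsIso ((extendScalars φ).map (freeLift e : freeMod A V ⟶ M)))
  have := (isFreeOn_extend_freeMod φ V).comp (extendMap φ (freeLift e : freeMod A V ⟶ M))
  rwa [Category.assoc, extendUnit_naturality, ← Category.assoc, freeUnit_freeLift] at this

theorem IsFreeOn.tens {W : C} {M : CategoryTheory.Mod C A} {e : W ⟶ M.X} (he : IsFreeOn e)
    (V : C) : IsFreeOn (M := (tens A V).obj M) (e ▷ V) := by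
  have : IsIso (freeLift e : freeMod A W ⟶ M) := he
  have h := (isFreeOn_freeUnit (A := A) (W ⊗ V)).comp
    ((tensFreeIso W V).inv ≫ (RelGeom.tens A V).map (freeLift e))
  have h₁ : freeUnit A (W ⊗ V) ≫ ((tensFreeIso (A := A) W V).inv).hom =
      (freeUnit A W ▷ V : W ⊗ V ⟶ (freeMod A W).X ⊗ V) := by
    change ((λ_ (W ⊗ V)).inv ≫ η[A] ▷ (W ⊗ V) ≫ 𝟙 (A ⊗ W ⊗ V)) ≫ (α_ A W V).inv =
      ((λ_ W).inv ≫ η[A] ▷ W ≫ 𝟙 (A ⊗ W)) ▷ V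
    simp
  have h₂ : (freeUnit A W ▷ V : W ⊗ V ⟶ (freeMod A W).X ⊗ V) ≫
      (freeLift e : freeMod A W ⟶ M).hom ▷ V = e ▷ V := by
    rw [← comp_whiskerRight, freeUnit_freeLift]
  rw [mod_comp_hom, ← Category.assoc, h₁] at h
  exact (congrArg IsFreeOn h₂).mp h

theorem IsSemilinear.tens {M : CategoryTheory.Mod C A} {N : CategoryTheory.Mod C B}
    {h : M.X ⟶ N.X} (hh : IsSemilinear φ h) (V : C) :
    IsSemilinear φ (M := (tens A V).obj M) (N := (tens B V).obj N) (h ▷ V) := by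
  have := tensAct_naturality (b := φ ▷ N.X ≫ act N) hh V
  refine Eq.trans ?_ this
  change A ◁ h ▷ V ≫ φ ▷ (N.X ⊗ V) ≫ tensAct (act N) V = _
  simp [tensAct]

/-- The canonical morphism `B ⊗_A (M ⊗ V) ⟶ (B ⊗_A M) ⊗ V`. -/
def extendTens (V : C) : tens A V ⋙ extendScalars φ ⟶ extendScalars φ ⋙ tens B V where
  app M := extendLift φ (M := (tens A V).obj M) (N := (tens B V).obj (extendObj φ M))
    (extendUnit φ M ▷ V) ((extendUnit_semilinear φ M).tens φ V)
  naturality M N f := by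
    apply extendObj_hom_ext
    have h₁ := extendUnit_extendLift φ (M := (tens A V).obj M)
      (N := (tens B V).obj (extendObj φ M)) (extendUnit φ M ▷ V)
      ((extendUnit_semilinear φ M).tens φ V)
    have h₂ := extendUnit_extendLift φ (M := (tens A V).obj N)
      (N := (tens B V).obj (extendObj φ N)) (extendUnit φ N ▷ V)
      ((extendUnit_semilinear φ N).tens φ V)
    have h₃ := extendUnit_naturality φ ((tens A V).map f)
    have h₄ := congrArg (fun x => x ▷ V) (extendUnit_naturality φ f)
    rw [comp_whiskerRight, comp_whiskerRight] at h₄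
    change extendUnit φ ((tens A V).obj M) ≫ (extendMap φ ((tens A V).map f)).hom ≫ _ =
      extendUnit φ ((tens A V).obj M) ≫ _ ≫ ((tens B V).map (extendMap φ f)).hom
    rw [← Category.assoc, h₃, Category.assoc, h₂, ← Category.assoc, h₁]
    exact h₄.symm

/-- Both composites preserve cokernels, so free modules suffice; on the free module on `W` both are
free on `W ⊗ V`, and the comparison matches generators. -/
def extendTensIso (V : C) : tens A V ⋙ extendScalars φ ≅ extendScalars φ ⋙ tens B V :=
  have {M N : CategoryTheory.Mod C A} (f : M ⟶ N) :
      PreservesColimit (parallelPair f 0) (tens A V ⋙ extendScalars φ) :=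
    comp_preservesCokernel _ _ f
  have {M N : CategoryTheory.Mod C A} (f : M ⟶ N) :
      PreservesColimit (parallelPair f 0) (extendScalars φ ⋙ tens B V) :=
    comp_preservesCokernel _ _ f
  have : ∀ M, IsIso ((extendTens φ V).app M) := isIso_app_of_isIso_free _ fun W => by
    have h₁ := ((isFreeOn_freeUnit (A := A) W).tens V).extend φ
    refine h₁.isIso _ ?_
    have h₂ := ((isFreeOn_freeUnit (A := A) W).extend φ).tens V
    rw [comp_whiskerRight] at h₂
    have h₃ := congrArg (fun x => freeUnit A W ▷ V ≫ x) (extendUnit_extendLift φ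
      (M := (tens A V).obj (freeMod A W)) (N := (tens B V).obj (extendObj φ (freeMod A W)))
      (extendUnit φ (freeMod A W) ▷ V) ((extendUnit_semilinear φ (freeMod A W)).tens φ V))
    exact (congrArg IsFreeOn ((Category.assoc _ _ _).trans h₃)).mpr h₂
  NatIso.ofComponents (fun M => asIso ((extendTens φ V).app M))
    (fun f => (extendTens φ V).naturality f)

end FreeOn

section Flat

variable {C : Type u} [Category.{v} C] [Preadditive C] [HasFiniteLimits C] [HasFiniteColimits C]
  [MonoidalCategory C] [SymmetricCategory C] [MonoidalClosed C] [HasZeroObject C]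
  [HasBinaryBiproducts C] [DetectedByProj C]

/-- Flat objects. -/
def IsFlat (U : C) : Prop := PreservesFiniteLimits (tensorLeft U)

theorem IsFlat.of_iso {U U' : C} (h : IsFlat U) (e : U ≅ U') : IsFlat U' :=
  have : PreservesFiniteLimits (tensorLeft U) := h
  preservesFiniteLimits_of_natIso ((tensoringLeft C).mapIso e)

theorem IsFlat.tensor {U W : C} (hU : IsFlat U) (hW : IsFlat W) : IsFlat (U ⊗ W) :=
  have : PreservesFiniteLimits (tensorLeft U) := hU
  have : PreservesFiniteLimits (tensorLeft W) := hW
  preservesFiniteLimits_of_natIso (tensorLeftTensor U W).symm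

theorem IsFlat.preserves_tensorRight {U : C} (h : IsFlat U) :
    PreservesFiniteLimits (tensorRight U) :=
  have : PreservesFiniteLimits (tensorLeft U) := h
  preservesFiniteLimits_of_natIso (BraidedCategory.tensorLeftIsoTensorRight U)

theorem IsFlat.projExact {U : C} (h : IsFlat U) {X Y : C} {g : X ⟶ Y} (hg : IsStrictEpi g) :
    ProjExact (kernel.ι g ▷ U) (g ▷ U) := by
  have := h.preserves_tensorRight
  have hl := KernelFork.mapIsLimit _ (kernelIsKernel g) (tensorRight U)
  have hm : Mono (kernel.ι g ▷ U) := Fork.IsLimit.mono hl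
  refine ⟨by rw [← comp_whiskerRight, kernel.condition, MonoidalPreadditive.zero_whiskerRight],
    fun V hV x hx => ?_, fun V hV y hy => ?_,
    ((‹DetectedByProj C›).isStrictEpi_iff _).1 (isStrictEpi_map (F := tensorRight U) hg)⟩
  · rw [← cancel_mono (kernel.ι g ▷ U), hx, zero_comp]
  · exact ⟨_, (KernelFork.IsLimit.lift' hl y hy).2⟩

/-- An acyclic complex of flat objects that is bounded above remains acyclic after tensoring. -/
theorem strictlyAcyclic_tensorLeft (hflat : ProjFlat C) {D : CochainComplex C ℤ}
    (hD : StrictlyAcyclic D) (n : ℤ) [D.IsStrictlyLE n] (hDflat : ∀ i, IsFlat (D.X i)) (X : C) :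
    StrictlyAcyclic ((mapC (tensorLeft X)).obj D) := by
  -- Dimension shifting by descending induction on the degree `j`, with `X` varying. Cover `X` by a
  -- projective `P`. A cocycle `x` lifts to `y` over `P`, and its differential comes from a cocycle
  -- over the kernel of the cover, which by induction is the differential of some `w`. Correcting
  -- `y` by `w` gives a cocycle over the flat object `P`, hence a coboundary.
  have main (m : ℕ) (i j k : ℤ) (hij : i + 1 = j) (hjk : j + 1 = k) (hm : n < j + m) (X : C)
      {V : C} (hV : IsProj V) (x : V ⟶ X ⊗ D.X j) (hx : x ≫ X ◁ D.d j k = 0) :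
      ∃ y : V ⟶ X ⊗ D.X i, y ≫ X ◁ D.d i j = x := by
    induction m generalizing i j k X x with
    | zero =>
      have : IsZero (X ⊗ D.X j) :=
        (tensorLeft X).map_isZero (D.isZero_of_isStrictlyLE n j (by simpa using hm))
      exact ⟨0, this.eq_of_tgt _ _⟩
    | succ m ih =>
      obtain ⟨P, g, hP, hg⟩ := (‹DetectedByProj C›).enough X
      obtain ⟨y, rfl⟩ := ((hDflat j).projExact hg).surj hV x
      obtain ⟨z, hz⟩ := ((hDflat k).projExact hg).exact hV (y ≫ P ◁ D.d j k) (by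
        rw [Category.assoc, whisker_exchange, ← Category.assoc, hx])
      have hz' : z ≫ kernel g ◁ D.d k (k + 1) = 0 := by
        refine ((hDflat (k + 1)).projExact hg).inj hV _ ?_
        rw [Category.assoc, whisker_exchange, ← Category.assoc, hz, Category.assoc,
          ← whiskerLeft_comp, D.d_comp_d, MonoidalPreadditive.whiskerLeft_zero, comp_zero]
      obtain ⟨w, rfl⟩ := ih j k (k + 1) hjk rfl (by push_cast at hm; lia) (kernel g) z hz'
      have : PreservesFiniteLimits (tensorLeft P) := hflat P hP
      obtain ⟨t, ht⟩ : ∃ t : V ⟶ P ⊗ D.X i, t ≫ P ◁ D.d i j = y - w ≫ kernel.ι g ▷ D.X j :=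
        ((‹DetectedByProj C›).strictlyAcyclic_iff _).1
        (StrictlyAcyclic.map (tensorLeft P) hD) hV i j k hij hjk (y - w ≫ kernel.ι g ▷ D.X j) (by
          change (y - w ≫ kernel.ι g ▷ D.X j) ≫ P ◁ D.d j k = 0
          rw [Preadditive.sub_comp, ← hz, Category.assoc, Category.assoc, whisker_exchange,
            sub_self])
      refine ⟨t ≫ g ▷ D.X i, ?_⟩
      rw [Category.assoc, ← whisker_exchange, ← Category.assoc, ht, Preadditive.sub_comp,
        Category.assoc, ← comp_whiskerRight, kernel.condition,
        MonoidalPreadditive.zero_whiskerRight, comp_zero, sub_zero]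
  rw [(‹DetectedByProj C›).strictlyAcyclic_iff]
  exact fun V hV i j k hi hj x hx => main (n + 1 - j).toNat i j k hi hj (by lia) X hV x hx

/-- The cone of the augmentation is acyclic and bounded above with flat terms, namely projectives
and `U`, so tensoring with an arbitrary `X` keeps it acyclic. -/
theorem AugExact.tensor_left (hflat : ProjFlat C) {T : CochainComplex C ℤ} [T.IsStrictlyLE 0]
    (hT : ∀ i, IsProj (T.X i)) {U : C} (hU : IsFlat U) {ε : T.X 0 ⟶ U} (h : AugExact T ε)
    (X : C) : AugExact ((mapC (tensorLeft X)).obj T) (M := X ⊗ U) (X ◁ ε) := by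
  obtain ⟨π, hπ⟩ := h.exists_hom
  -- The splice along the identity is used only to identify the terms of the cone.
  let S := Splice.mappingCone π hπ (𝟙 U)
  have hπ' : (π ≫ (HomologicalComplex.single C (ComplexShape.up ℤ) 0).map (𝟙 U)).f 0 ≫
      (single0Iso U).hom = ε := by
    rw [CategoryTheory.Functor.map_id, Category.comp_id, hπ]
  refine (strictQuasiIso_map_iff_augExact (F := MonoidalCategory.tensorLeft X) _ ε hπ').1
    ((strictQuasiIso_map_iff _).2 ?_)
  have hz (i : ℤ) (hi : 0 < i) : IsZero ((CochainComplex.mappingCone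
      (π ≫ (HomologicalComplex.single C (ComplexShape.up ℤ) 0).map (𝟙 U))).X i) := by
    rw [CochainComplex.mappingCone.isZero_X_iff]
    exact ⟨T.isZero_of_isStrictlyLE 0 _ (by lia), single0_isZero U i (by lia)⟩
  have : (CochainComplex.mappingCone
      (π ≫ (HomologicalComplex.single C (ComplexShape.up ℤ) 0).map (𝟙 U))).IsStrictlyLE 0 := by
    rw [CochainComplex.isStrictlyLE_iff]
    exact hz
  refine strictlyAcyclic_tensorLeft hflat
    ((strictQuasiIso_iff_augExact (single0_isZero U) _ _ ε hπ').2 h) 0 (fun i => ?_) X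
  obtain hi | rfl | hi := lt_trichotomy i 0
  · exact IsFlat.of_iso (hflat _ (hT (i + 1))) (S.e i (i + 1) rfl (by lia))
  · exact hU.of_iso S.e₀
  · exact hflat _ (isProj_of_isZero (hz i hi))

variable {A B D : C} [MonObj A] [MonObj B] [MonObj D] (φ : A ⟶ B) [IsMonHom φ]

theorem isStrictEpi_of_forget ⦃M N : CategoryTheory.Mod C A⦄ (f : M ⟶ N)
    (h : IsStrictEpi ((Mod.forget (D := C) A).map f)) : IsStrictEpi f := isStrictEpi_of_hom h

theorem AugExact.freeFunctor (hflat : ProjFlat C) {T : CochainComplex C ℤ} [T.IsStrictlyLE 0]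
    (hT : ∀ i, IsProj (T.X i)) {U : C} (hU : IsFlat U) {ε : T.X 0 ⟶ U} (h : AugExact T ε) :
    AugExact ((mapC (freeFunctor A)).obj T) (M := freeMod A U) (freeMap A ε) := by
  refine AugExact.of_map (F := Mod.forget (D := C) A) isStrictEpi_of_forget (fun i hi => ?_)
    (h.tensor_left hflat hT hU A)
  change (RelGeom.freeFunctor A).map _ ≫ (RelGeom.freeFunctor A).map ε = 0
  rw [← Functor.map_comp, h.zero i hi, Functor.map_zero]

/-- A projective resolution of a flat `U` stays a resolution after tensoring with `A` and with `B`.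
Flatness in place of projectivity matters because the result is applied to a tensor product of two
projectives, which is flat but not known to be projective. -/
theorem goodObj_freeMod (hflat : ProjFlat C) {U : C} (hU : IsFlat U) :
    GoodObj (extendScalars φ) (freeMod A U) := by
  obtain ⟨T, ε, hT, hproj, h⟩ := exists_projective_augExact U
  refine goodObj_of_augExact (P := (mapC (freeFunctor A)).obj T)
    (fun i => isProj_freeMod (hproj i)) (h.freeFunctor hflat hproj hU) ?_
  exact AugExact.of_iso (F := freeFunctor B) (G := freeFunctor A ⋙ extendScalars φ)
    (h.freeFunctor hflat hproj hU) (extendFreeIso φ).symm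

variable (A) in
/-- Modules isomorphic to a free module on a projective object. -/
def IsFreeProj : ObjectProperty (CategoryTheory.Mod C A) := fun M =>
  ∃ V : C, IsProj V ∧ Nonempty (freeMod A V ≅ M)

instance : (IsFreeProj A).IsClosedUnderIsomorphisms where
  of_iso := by
    rintro M N e ⟨V, hV, ⟨i⟩⟩
    exact ⟨V, hV, ⟨i ≪≫ e⟩⟩

theorem IsFreeProj.isProj {M : CategoryTheory.Mod C A} (h : IsFreeProj A M) : IsProj M := by
  obtain ⟨V, hV, ⟨i⟩⟩ := h
  exact (isProj_freeMod hV).of_iso i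

variable (A) in
theorem isFreeProj_enough (M : CategoryTheory.Mod C A) :
    ∃ (P : CategoryTheory.Mod C A) (e : P ⟶ M), IsFreeProj A P ∧ IsStrictEpi e := by
  obtain ⟨V, e, hV, he⟩ := exists_free_strictEpi M
  exact ⟨_, e, ⟨V, hV, ⟨Iso.refl _⟩⟩, he⟩

theorem AugExact.tens {P : CochainComplex (CategoryTheory.Mod C A) ℤ} [P.IsStrictlyLE 0]
    {M : CategoryTheory.Mod C A} {ε : P.X 0 ⟶ M} (h : AugExact P ε) {V : C} (hV : IsFlat V) :
    AugExact ((mapC (tens A V)).obj P) (M := (tens A V).obj M) ((tens A V).map ε) := by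
  have := hV.preserves_tensorRight
  refine AugExact.of_map (F := Mod.forget (D := C) A) isStrictEpi_of_forget (fun i hi => ?_)
    ((h.map (F := Mod.forget (D := C) A)).map (F := tensorRight V))
  change (RelGeom.tens A V).map _ ≫ (RelGeom.tens A V).map ε = 0
  rw [← Functor.map_comp, h.zero i hi, Functor.map_zero]

variable (ψ : A ⟶ D) [IsMonHom ψ]

/-- Restriction of a free module is a tensor product of the restricted ring. -/
def comapFreeIso (V : C) : (tens A V).obj ((Mod.comap (D := C) ψ).obj (Mod.regular D)) ≅
    (Mod.comap (D := C) ψ).obj (freeMod D V) where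
  hom := mkHom (𝟙 (D ⊗ V)) (by
    change A ◁ 𝟙 (D ⊗ V) ≫ ψ ▷ (D ⊗ V) ≫ (α_ D D V).inv ≫ μ[D] ▷ V =
      ((α_ A D V).inv ≫ (ψ ▷ D ≫ μ[D]) ▷ V) ≫ 𝟙 (D ⊗ V)
    simp)
  inv := mkHom (𝟙 (D ⊗ V)) (by
    change A ◁ 𝟙 (D ⊗ V) ≫ (α_ A D V).inv ≫ (ψ ▷ D ≫ μ[D]) ▷ V =
      (ψ ▷ (D ⊗ V) ≫ (α_ D D V).inv ≫ μ[D] ▷ V) ≫ 𝟙 (D ⊗ V)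
    simp)
  hom_inv_id := modHom_ext (Category.comp_id (𝟙 (D ⊗ V)))
  inv_hom_id := modHom_ext (Category.comp_id (𝟙 (D ⊗ V)))

/-- Resolve `D` over `A` by free modules on projectives and tensor with the flat object `V`. The
terms are free on flat objects, hence good; extension of scalars commutes with `- ⊗ V`, so goodness
of `D` keeps the resolution exact after extension to `B`. -/
theorem goodObj_comap_freeMod (hflat : ProjFlat C)
    (hD : GoodObj (extendScalars φ) ((Mod.comap (D := C) ψ).obj (Mod.regular D)))
    {M : CategoryTheory.Mod C D} (hM : IsFreeProj D M) :
    GoodObj (extendScalars φ) ((Mod.comap (D := C) ψ).obj M) := by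
  obtain ⟨V, hV, ⟨i⟩⟩ := hM
  obtain ⟨R, ε, hR, hfree, h⟩ := exists_augExact (IsFreeProj A) (isFreeProj_enough A)
    ((Mod.comap (D := C) ψ).obj (Mod.regular D))
  have hproj (i : ℤ) : IsProj (R.X i) := by
    by_cases hi : i ≤ 0
    · exact (hfree i hi).isProj
    · exact isProj_of_isZero (R.isZero_of_isStrictlyLE 0 i (by lia))
  have hV' : IsFlat V := hflat V hV
  refine (GoodObj.of_resolution (L := (mapC (tens A V)).obj R) (fun i hi => ?_) (h.tens hV')
    ?_).of_iso (comapFreeIso ψ V ≪≫ (Mod.comap (D := C) ψ).mapIso i)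
  · obtain ⟨W, hW, ⟨e⟩⟩ := hfree i hi
    exact (goodObj_freeMod φ hflat ((show IsFlat W from hflat W hW).tensor hV')).of_iso
      ((tensFreeIso W V).symm ≪≫ (tens A V).mapIso e)
  · exact AugExact.of_iso (F := extendScalars φ ⋙ tens B V) (G := tens A V ⋙ extendScalars φ)
      ((hD.augExact_map hproj h).tens hV') (extendTensIso φ V).symm

end Flat

end RelGeom

/-! ### Quotients and tensor products of commutative monoids -/

namespace RelGeom

section Quotient

variable {C : Type u} [Category.{v} C] [Preadditive C] [HasFiniteLimits C] [HasFiniteColimits C]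
  [MonoidalCategory C] [SymmetricCategory C] [MonoidalClosed C]

theorem epi_whiskerLeft (X : C) {Y Z : C} (f : Y ⟶ Z) [Epi f] : Epi (X ◁ f) :=
  inferInstanceAs (Epi ((tensorLeft X).map f))

theorem epi_whiskerRight {Y Z : C} (f : Y ⟶ Z) [Epi f] (X : C) : Epi (f ▷ X) := by
  have := epi_whiskerLeft X f
  have h : f ▷ X = (β_ Y X).hom ≫ X ◁ f ≫ (β_ Z X).inv := by simp
  rw [h]
  infer_instance

theorem epi_tensorHom {X Y Z W : C} (f : X ⟶ Y) (g : Z ⟶ W) [Epi f] [Epi g] : Epi (f ⊗ₘ g) := by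
  have := epi_whiskerRight f Z
  have := epi_whiskerLeft Y g
  rw [MonoidalCategory.tensorHom_def]
  infer_instance

variable {N M Q : C} [MonObj M] [IsCommMonObj M] {d : N ⟶ M} {q : M ⟶ Q} {w : d ≫ q = 0}

/-- The multiplication descends to the quotient by an ideal. -/
theorem exists_mul_quotient (hq : IsColimit (CokernelCofork.ofπ q w))
    (hd : d ▷ M ≫ μ[M] ≫ q = 0) : ∃ m : Q ⊗ Q ⟶ Q, (q ⊗ₘ q) ≫ m = μ[M] ≫ q := by
  have : Epi q := Cofork.IsColimit.epi hq
  obtain ⟨a, ha⟩ : ∃ a : Q ⊗ M ⟶ Q, q ▷ M ≫ a = μ[M] ≫ q :=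
    ⟨_, (CokernelCofork.IsColimit.desc' (CokernelCofork.mapIsColimit _ hq (tensorRight M))
      (μ[M] ≫ q) hd).2⟩
  -- Commutativity of `M` turns the ideal condition on one side into the condition on the other.
  have hd' : Q ◁ d ≫ a = 0 := by
    have := epi_whiskerRight q N
    rw [← cancel_epi (q ▷ N), ← whisker_exchange_assoc, ha, comp_zero]
    have h : M ◁ d ≫ μ[M] ≫ q = (β_ M N).hom ≫ d ▷ M ≫ μ[M] ≫ q := by
      rw [← BraidedCategory.braiding_naturality_right_assoc, IsCommMonObj.mul_comm_assoc]
    rw [h, hd, comp_zero]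
  obtain ⟨m, hm⟩ : ∃ m : Q ⊗ Q ⟶ Q, Q ◁ q ≫ m = a :=
    ⟨_, (CokernelCofork.IsColimit.desc' (CokernelCofork.mapIsColimit _ hq (tensorLeft Q)) a hd').2⟩
  exact ⟨m, by rw [MonoidalCategory.tensorHom_def, Category.assoc, hm, ha]⟩

/-- The monoid structure on a quotient that is compatible with a multiplication. -/
abbrev monObjOfEpi (q : M ⟶ Q) [Epi q] (m : Q ⊗ Q ⟶ Q) (hm : (q ⊗ₘ q) ≫ m = μ[M] ≫ q) :
    MonObj Q where
  one := η[M] ≫ q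
  mul := m
  one_mul := by
    have := epi_whiskerLeft (𝟙_ C) q
    rw [← cancel_epi ((𝟙_ C) ◁ q), comp_whiskerRight, Category.assoc, whisker_exchange_assoc,
      ← tensorHom_def'_assoc, hm]
    simp
  mul_one := by
    have := epi_whiskerRight q (𝟙_ C)
    rw [← cancel_epi (q ▷ (𝟙_ C)), whiskerLeft_comp, Category.assoc, ← whisker_exchange_assoc,
      ← tensorHom_def_assoc, hm]
    simp
  mul_assoc := by
    have := epi_tensorHom q q
    have := epi_tensorHom (q ⊗ₘ q) q
    rw [← cancel_epi ((q ⊗ₘ q) ⊗ₘ q), associator_naturality_assoc, ← tensorHom_id, ← id_tensorHom,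
      tensorHom_comp_tensorHom_assoc, tensorHom_comp_tensorHom_assoc, hm, Category.comp_id]
    have h₁ : (μ[M] ≫ q) ⊗ₘ q = μ[M] ▷ M ≫ (q ⊗ₘ q) := by
      rw [← tensorHom_id, tensorHom_comp_tensorHom, Category.id_comp]
    have h₂ : q ⊗ₘ (μ[M] ≫ q) = M ◁ μ[M] ≫ (q ⊗ₘ q) := by
      rw [← id_tensorHom, tensorHom_comp_tensorHom, Category.id_comp]
    rw [h₁, h₂, Category.assoc, Category.assoc, hm, MonObj.mul_assoc_assoc]

theorem exists_commMon_quotient (hq : IsColimit (CokernelCofork.ofπ q w))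
    (hd : d ▷ M ≫ μ[M] ≫ q = 0) :
    ∃ (_ : MonObj Q), IsCommMonObj Q ∧ IsMonHom q := by
  have : Epi q := Cofork.IsColimit.epi hq
  have := epi_tensorHom q q
  obtain ⟨m, hm⟩ := exists_mul_quotient hq hd
  refine ⟨monObjOfEpi q m hm, @IsCommMonObj.mk _ _ _ _ _ (monObjOfEpi q m hm) ?_,
    @IsMonHom.mk _ _ _ _ _ _ (monObjOfEpi q m hm) _ rfl hm.symm⟩
  change (β_ Q Q).hom ≫ m = m
  rw [← cancel_epi (q ⊗ₘ q), BraidedCategory.braiding_naturality_assoc, hm,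
    IsCommMonObj.mul_comm_assoc]

theorem isMonHom_of_epi [MonObj Q] [IsMonHom q] [Epi q] {D : C} [MonObj D] (h : Q ⟶ D)
    [IsMonHom (q ≫ h)] : IsMonHom h where
  one_hom := by
    rw [← IsMonHom.one_hom q, Category.assoc, IsMonHom.one_hom]
  mul_hom := by
    have := epi_tensorHom q q
    rw [← cancel_epi (q ⊗ₘ q), ← Category.assoc, ← IsMonHom.mul_hom, Category.assoc,
      IsMonHom.mul_hom, tensorHom_comp_tensorHom_assoc]

end Quotient

section Tensor

variable {C : Type u} [Category.{v} C] [MonoidalCategory C] [SymmetricCategory C]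
  {R S T D : C} [MonObj R] [MonObj S] [MonObj T] [MonObj D]

theorem isMonHom_tensor_mul [IsCommMonObj D] (f : S ⟶ D) (g : T ⟶ D) [IsMonHom f] [IsMonHom g] :
    IsMonHom ((f ⊗ₘ g) ≫ μ[D]) where
  one_hom := by
    rw [MonObj.tensorObj.one_def, Category.assoc, tensorHom_comp_tensorHom_assoc,
      IsMonHom.one_hom, IsMonHom.one_hom, MonoidalCategory.tensorHom_def, Category.assoc,
      MonObj.mul_one]
    simp [← unitors_equal]
  mul_hom := by
    rw [MonObj.tensorObj.mul_def, Category.assoc, tensorHom_comp_tensorHom_assoc,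
      IsMonHom.mul_hom, IsMonHom.mul_hom, ← tensorHom_comp_tensorHom_assoc,
      ← tensorμ_natural_assoc, MonObj.mul_mul_mul_comm, tensorHom_comp_tensorHom_assoc]

variable (S T) in
/-- The first inclusion into the tensor product of monoids. -/
def tensorInl : S ⟶ S ⊗ T := (ρ_ S).inv ≫ S ◁ η[T]

variable (S T) in
/-- The second inclusion into the tensor product of monoids. -/
def tensorInr : T ⟶ S ⊗ T := (λ_ T).inv ≫ η[S] ▷ T

theorem isMonHom_one : IsMonHom η[T] where
  one_hom := Category.id_comp _
  mul_hom := by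
    rw [MonoidalCategory.tensorHom_def, Category.assoc, MonObj.mul_one]
    change (λ_ (𝟙_ C)).hom ≫ _ = _
    simp [unitors_equal]

instance : IsMonHom (tensorInl S T) :=
  have : IsMonHom η[T] := isMonHom_one
  inferInstanceAs (IsMonHom ((ρ_ S).inv ≫ S ◁ η[T]))

instance : IsMonHom (tensorInr S T) :=
  have : IsMonHom η[S] := isMonHom_one
  inferInstanceAs (IsMonHom ((λ_ T).inv ≫ η[S] ▷ T))

theorem tensorInl_tensor_mul (f : S ⟶ D) (g : T ⟶ D) [IsMonHom g] :
    tensorInl S T ≫ (f ⊗ₘ g) ≫ μ[D] = f := by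
  simp [tensorInl, tensorHom_def', ← whiskerLeft_comp_assoc, IsMonHom.one_hom,
    whisker_exchange_assoc]

theorem tensorInr_tensor_mul (f : S ⟶ D) (g : T ⟶ D) [IsMonHom f] :
    tensorInr S T ≫ (f ⊗ₘ g) ≫ μ[D] = g := by
  simp [tensorInr, MonoidalCategory.tensorHom_def, ← comp_whiskerRight_assoc, IsMonHom.one_hom,
    ← whisker_exchange_assoc]

theorem whiskerRight_tensorInl_mul : tensorInl S T ▷ (S ⊗ T) ≫ μ[S ⊗ T] =
    (α_ S S T).inv ≫ μ[S] ▷ T := by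
  have h : tensorInl S T = (ρ_ S).inv ≫ (𝟙 S ⊗ₘ η[T]) := by simp [tensorInl]
  rw [h, comp_whiskerRight, Category.assoc, MonObj.tensorObj.mul_def, tensorμ_natural_left_assoc,
    tensorHom_comp_tensorHom, id_whiskerRight, Category.id_comp, MonObj.one_mul]
  have h' : (ρ_ S).inv ▷ (S ⊗ T) ≫ tensorμ S (𝟙_ C) S T ≫ (S ⊗ S) ◁ (λ_ T).hom =
      (α_ S S T).inv := by
    simp only [tensorμ, braiding_tensorUnit_left]
    monoidal
  rw [tensorHom_def', reassoc_of% h']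

theorem whiskerRight_tensorInr_mul : tensorInr S T ▷ (S ⊗ T) ≫ μ[S ⊗ T] =
    (α_ T S T).inv ≫ (β_ T S).hom ▷ T ≫ (α_ S T T).hom ≫ S ◁ μ[T] := by
  have h : tensorInr S T = (λ_ T).inv ≫ (η[S] ⊗ₘ 𝟙 T) := by simp [tensorInr]
  rw [h, comp_whiskerRight, Category.assoc, MonObj.tensorObj.mul_def, tensorμ_natural_left_assoc,
    tensorHom_comp_tensorHom, id_whiskerRight, Category.id_comp, MonObj.one_mul]
  simp [tensorμ, MonoidalCategory.tensorHom_def]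

theorem tensorInl_tensorInr_mul : (tensorInl S T ⊗ₘ tensorInr S T) ≫ μ[S ⊗ T] = 𝟙 _ := by
  rw [tensorHom_def', Category.assoc, whiskerRight_tensorInl_mul, tensorInr]
  simp [associator_inv_naturality_middle_assoc, ← comp_whiskerRight, -whisker_assoc]

end Tensor

end RelGeom

/-! ### Pushouts of commutative monoids and underived base change -/

namespace RelGeom

section BaseChange

variable {C : Type u} [Category.{v} C] [Preadditive C] [HasFiniteLimits C] [HasFiniteColimits C]
  [MonoidalCategory C] [SymmetricCategory C] [MonoidalClosed C]
  {R S T D : C} [MonObj R] [MonObj S] [MonObj T] [MonObj D]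

/-- The square of commutative monoids formed by `φ`, `ψ`, `i`, `j` is a pushout. -/
structure IsCommMonPushout (φ : R ⟶ S) (ψ : R ⟶ T) (i : S ⟶ D) (j : T ⟶ D) : Prop where
  w : φ ≫ i = ψ ≫ j
  desc {Q : C} [MonObj Q] [IsCommMonObj Q] (f : S ⟶ Q) (g : T ⟶ Q) [IsMonHom f] [IsMonHom g] :
    φ ≫ f = ψ ≫ g → ∃ t : D ⟶ Q, IsMonHom t ∧ i ≫ t = f ∧ j ≫ t = g
  hom_ext {Q : C} [MonObj Q] [IsCommMonObj Q] (s t : D ⟶ Q) [IsMonHom s] [IsMonHom t] :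
    i ≫ s = i ≫ t → j ≫ s = j ≫ t → s = t

variable {φ : R ⟶ S} {ψ : R ⟶ T} {i : S ⟶ D} {j : T ⟶ D}
  [IsMonHom φ] [IsMonHom ψ] [IsMonHom i] [IsMonHom j]

theorem IsSemilinear.comap (w : φ ≫ i = ψ ≫ j) {M : CategoryTheory.Mod C T}
    {N : CategoryTheory.Mod C D} {h : M.X ⟶ N.X} (hh : IsSemilinear j h) :
    IsSemilinear φ (M := (Mod.comap (D := C) ψ).obj M) (N := (Mod.comap (D := C) i).obj N) h := by
  unfold IsSemilinear at *
  change R ◁ h ≫ φ ▷ N.X ≫ i ▷ N.X ≫ act N = (ψ ▷ M.X ≫ act M) ≫ h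
  rw [← comp_whiskerRight_assoc, w, Category.assoc, ← hh, comp_whiskerRight_assoc,
    whisker_exchange_assoc]

/-- The base change morphism. -/
def baseChange (w : φ ≫ i = ψ ≫ j) :
    Mod.comap (D := C) ψ ⋙ extendScalars φ ⟶ extendScalars j ⋙ Mod.comap (D := C) i where
  app M := extendLift φ (M := (Mod.comap (D := C) ψ).obj M)
    (N := (Mod.comap (D := C) i).obj (extendObj j M)) (extendUnit j M)
    ((extendUnit_semilinear j M).comap w)
  naturality M N f := by
    apply extendObj_hom_ext
    have h₁ := extendUnit_extendLift φ (M := (Mod.comap (D := C) ψ).obj M)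
      (N := (Mod.comap (D := C) i).obj (extendObj j M)) (extendUnit j M)
      ((extendUnit_semilinear j M).comap w)
    have h₂ := extendUnit_extendLift φ (M := (Mod.comap (D := C) ψ).obj N)
      (N := (Mod.comap (D := C) i).obj (extendObj j N)) (extendUnit j N)
      ((extendUnit_semilinear j N).comap w)
    have h₃ := extendUnit_naturality φ ((Mod.comap (D := C) ψ).map f)
    have h₄ := extendUnit_naturality j f
    refine (Category.assoc _ _ _).symm.trans ((congrArg (· ≫ _) h₃).trans
      ((Category.assoc _ _ _).trans ((congrArg (f.hom ≫ ·) h₂).trans ?_)))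
    exact h₄.symm.trans ((congrArg (· ≫ (extendMap j f).hom) h₁).symm.trans (Category.assoc _ _ _))

theorem extendUnit_baseChange (w : φ ≫ i = ψ ≫ j) (M : CategoryTheory.Mod C T) :
    extendUnit φ ((Mod.comap (D := C) ψ).obj M) ≫ ((baseChange w).app M).hom = extendUnit j M :=
  extendUnit_extendLift φ (M := (Mod.comap (D := C) ψ).obj M)
      (N := (Mod.comap (D := C) i).obj (extendObj j M)) (extendUnit j M)
      ((extendUnit_semilinear j M).comap w)

theorem isSemilinear_hom (f : T ⟶ D) [IsMonHom f] :
    IsSemilinear f (M := Mod.regular T) (N := Mod.regular D) f := by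
  change T ◁ f ≫ f ▷ D ≫ μ[D] = μ[T] ≫ f
  rw [IsMonHom.mul_hom, tensorHom_def', Category.assoc]

/-- The canonical morphism `S ⊗_R T ⟶ D`. -/
def tensorRing (w : φ ≫ i = ψ ≫ j) :
    extendObj φ ((Mod.comap (D := C) ψ).obj (Mod.regular T)) ⟶
      (Mod.comap (D := C) i).obj (Mod.regular D) :=
  extendLift φ (M := (Mod.comap (D := C) ψ).obj (Mod.regular T))
    (N := (Mod.comap (D := C) i).obj (Mod.regular D)) j ((isSemilinear_hom j).comap w)

variable (S ψ) in
/-- The morphism `S ⊗ R ⊗ T ⟶ S ⊗ T` given by the action of `R` on `T`. -/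
def coscale : S ⊗ R ⊗ T ⟶ S ⊗ T := S ◁ (ψ ▷ T ≫ μ[T])

variable (R S T) in
/-- The permutation of the first two factors. -/
def swapLeft : R ⊗ S ⊗ T ⟶ S ⊗ R ⊗ T := (α_ R S T).inv ≫ (β_ R S).hom ▷ T ≫ (α_ S R T).hom

instance : IsIso (swapLeft R S T) := by unfold swapLeft; infer_instance

theorem tensorInl_scale [IsCommMonObj S] : (φ ≫ tensorInl S T) ▷ (S ⊗ T) ≫ μ[S ⊗ T] =
    swapLeft R S T ≫ scale φ T := by
  have h : φ ▷ S ≫ μ[S] = (β_ R S).hom ≫ S ◁ φ ≫ μ[S] := by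
    rw [← BraidedCategory.braiding_naturality_left_assoc, IsCommMonObj.mul_comm]
  rw [comp_whiskerRight, Category.assoc, whiskerRight_tensorInl_mul, swapLeft, scale,
    Category.assoc, Category.assoc, Iso.hom_inv_id_assoc, ← comp_whiskerRight, ← h]
  simp

theorem tensorInr_coscale : (ψ ≫ tensorInr S T) ▷ (S ⊗ T) ≫ μ[S ⊗ T] =
    swapLeft R S T ≫ coscale S ψ := by
  rw [comp_whiskerRight, Category.assoc, whiskerRight_tensorInr_mul, swapLeft, coscale]
  simp only [whiskerLeft_comp, Category.assoc]
  rw [← associator_naturality_middle_assoc, ← comp_whiskerRight_assoc,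
    ← BraidedCategory.braiding_naturality_left, comp_whiskerRight_assoc]
  simp

/-- Up to a permutation of factors, `coscale S ψ - scale φ T` is multiplication by the difference of
the two morphisms from `R` to `S ⊗ T`. By associativity, a morphism that kills these products kills
the ideal they generate. -/
theorem coscale_sub_scale_ideal [IsCommMonObj S] {Q : C} {q : S ⊗ T ⟶ Q}
    (hq : (coscale S ψ - scale φ T) ≫ q = 0) :
    (coscale S ψ - scale φ T) ▷ (S ⊗ T) ≫ μ[S ⊗ T] ≫ q = 0 := by
  have hρ : ((ψ ≫ tensorInr S T) - (φ ≫ tensorInl S T)) ▷ (S ⊗ T) ≫ μ[S ⊗ T] =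
      swapLeft R S T ≫ (coscale S ψ - scale φ T) := by
    rw [Preadditive.comp_sub, ← tensorInl_scale, ← tensorInr_coscale, ← Preadditive.sub_comp]
    congr 1
    exact (tensorRight (S ⊗ T)).map_sub
  have h₁ : coscale S ψ - scale φ T = inv (swapLeft R S T) ≫
      ((ψ ≫ tensorInr S T) - (φ ≫ tensorInl S T)) ▷ (S ⊗ T) ≫ μ[S ⊗ T] := by
    rw [hρ, IsIso.inv_hom_id_assoc]
  have h₂ : ((ψ ≫ tensorInr S T) - (φ ≫ tensorInl S T)) ▷ (S ⊗ T) ≫ μ[S ⊗ T] ≫ q = 0 := by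
    rw [reassoc_of% hρ, hq, comp_zero]
  rw [h₁, comp_whiskerRight_assoc, comp_whiskerRight_assoc, MonObj.mul_assoc_assoc,
    associator_naturality_left_assoc, ← whisker_exchange_assoc, h₂]
  simp

/-- The pushout of commutative monoids is the relative tensor product. -/
theorem IsCommMonPushout.isIso [IsCommMonObj S] [IsCommMonObj T] [IsCommMonObj D]
    (h : IsCommMonPushout φ ψ i j) {Q : C} {q : S ⊗ T ⟶ Q}
    {w : (coscale S ψ - scale φ T) ≫ q = 0} (hq : IsColimit (CokernelCofork.ofπ q w))
    (e : Q ⟶ D) (he : q ≫ e = (i ⊗ₘ j) ≫ μ[D]) : IsIso e := by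
  have : Epi q := Cofork.IsColimit.epi hq
  obtain ⟨_, _, _⟩ := exists_commMon_quotient hq (coscale_sub_scale_ideal w)
  have hρ : (φ ≫ tensorInl S T) ≫ q = (ψ ≫ tensorInr S T) ≫ q := by
    -- Each morphism from `R` is recovered from multiplication by it, by evaluating at the unit of
    -- `S ⊗ T`.
    have h₁ : (φ ≫ tensorInl S T) = (ρ_ R).inv ≫ R ◁ η[S ⊗ T] ≫ (φ ≫ tensorInl S T) ▷ (S ⊗ T) ≫
      μ[S ⊗ T] := by
      rw [whisker_exchange_assoc, MonObj.mul_one]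
      simp
    have h₂ : (ψ ≫ tensorInr S T) = (ρ_ R).inv ≫ R ◁ η[S ⊗ T] ≫ (ψ ≫ tensorInr S T) ▷ (S ⊗ T) ≫
      μ[S ⊗ T] := by
      rw [whisker_exchange_assoc, MonObj.mul_one]
      simp
    rw [Preadditive.sub_comp, sub_eq_zero] at w
    rw [h₁, h₂, tensorInl_scale, tensorInr_coscale]
    simp only [Category.assoc]
    rw [w]
  obtain ⟨t, _, ht₁, ht₂⟩ := h.desc (tensorInl S T ≫ q) (tensorInr S T ≫ q)
    (by simpa only [Category.assoc] using hρ)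
  have : IsMonHom (q ≫ e) := he ▸ isMonHom_tensor_mul i j
  have : IsMonHom e := isMonHom_of_epi (q := q) e
  -- The morphism `t` given by the universal property of `D` is inverse to `e`: on the side of `Q`
  -- because the two inclusions multiply to the identity of `S ⊗ T`, on the side of `D` by
  -- uniqueness.
  refine ⟨t, ?_, ?_⟩
  · rw [← cancel_epi q, reassoc_of% he, IsMonHom.mul_hom t, tensorHom_comp_tensorHom_assoc,
      ht₁, ht₂, ← tensorHom_comp_tensorHom_assoc, ← IsMonHom.mul_hom q,
      reassoc_of% (tensorInl_tensorInr_mul (S := S) (T := T))]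
    exact (Category.comp_id q).symm
  · apply h.hom_ext
    · rw [reassoc_of% ht₁, he, tensorInl_tensor_mul, Category.comp_id]
    · rw [reassoc_of% ht₂, he, tensorInr_tensor_mul, Category.comp_id]

/-- The forgetful functor to `C` preserves the cokernel that defines extension of scalars, so the
underlying object is the quotient ring of `S ⊗ T` treated in `IsCommMonPushout.isIso`. -/
theorem isIso_tensorRing [IsCommMonObj S] [IsCommMonObj T] [IsCommMonObj D]
    (h : IsCommMonPushout φ ψ i j) : IsIso (tensorRing h.w) := by
  let N := (Mod.comap (D := C) ψ).obj (Mod.regular T)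
  have hc := CokernelCofork.mapIsColimit _ (Preadditive.isColimitCokernelCoforkOfCofork
    (coequalizerIsCoequalizer (freeMap S (act N)) (freeScale φ N.X))) (Mod.forget (D := C) S)
  let q : S ⊗ T ⟶ (extendObj φ N).X := (toExtend φ N).hom
  have hsub : (freeMap S (act N) - freeScale φ N.X).hom = coscale S ψ - scale φ T :=
    (Mod.forget (D := C) S).map_sub
  have w : (coscale S ψ - scale φ T) ≫ q = 0 := by
    rw [Preadditive.sub_comp, sub_eq_zero]
    exact congrArg Mod.Hom.hom (toExtend_condition φ N)
  have hq : Epi q := Cofork.IsColimit.epi hc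
  have hdesc {Z : C} (k : S ⊗ T ⟶ Z) (hk : (coscale S ψ - scale φ T) ≫ k = 0) :
      ∃ l, q ≫ l = k :=
    ⟨_, (CokernelCofork.IsColimit.desc' hc k ((congrArg (· ≫ k) hsub).trans hk)).2⟩
  have hiso : IsIso ((Mod.forget (D := C) S).map (tensorRing h.w)) := by
    refine h.isIso (q := q) (w := w) (CokernelCofork.IsColimit.ofπ _ _
      (fun k hk => (hdesc k hk).choose) (fun k hk => (hdesc k hk).choose_spec)
      (fun k hk m hm => (cancel_epi q).1 (hm.trans (hdesc k hk).choose_spec.symm))) _ ?_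
    refine (congrArg Mod.Hom.hom (toExtend_extendLift φ (M := N)
      (N := (Mod.comap (D := C) i).obj (Mod.regular D)) j
      ((isSemilinear_hom j).comap h.w))).trans ?_
    change S ◁ j ≫ i ▷ D ≫ μ[D] = (i ⊗ₘ j) ≫ μ[D]
    rw [tensorHom_def', Category.assoc]
  exact isIso_of_reflects_iso _ (Mod.forget (D := C) S)

/-- Both sides preserve cokernels in `M`, so one may take `M = T ⊗ V`. There the comparison is the
chain `S ⊗_R (T ⊗ V) ≅ (S ⊗_R T) ⊗ V ≅ D ⊗ V`, with `tensorRing` in the middle. -/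
theorem isIso_baseChange [IsCommMonObj S] [IsCommMonObj T] [IsCommMonObj D]
    (h : IsCommMonPushout φ ψ i j) (M : CategoryTheory.Mod C T) :
    IsIso ((baseChange h.w).app M) := by
  have {M N : CategoryTheory.Mod C T} (f : M ⟶ N) :
      PreservesColimit (parallelPair f 0) (Mod.comap (D := C) ψ ⋙ extendScalars φ) :=
    comp_preservesCokernel _ _ f
  have {M N : CategoryTheory.Mod C T} (f : M ⟶ N) :
      PreservesColimit (parallelPair f 0) (extendScalars j ⋙ Mod.comap (D := C) i) :=
    comp_preservesCokernel _ _ f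
  refine isIso_app_of_isIso_free _ (fun V => ?_) M
  have := isIso_tensorRing h
  let E : freeMod D V ⟶ extendObj j (freeMod T V) :=
    freeLift (freeUnit T V ≫ extendUnit j (freeMod T V))
  have : IsIso E := isFreeOn_extend_freeMod j V
  let N₀ := (Mod.comap (D := C) ψ).obj (Mod.regular T)
  have hjV : IsSemilinear j (M := freeMod T V) (N := freeMod D V) (j ▷ V) :=
    (isSemilinear_hom j).tens j V
  have hE : toComap j _ (hjV.comp E) = toComap j _ (extendUnit_semilinear j (freeMod T V)) := by
    apply freeMod_hom_ext
    refine (Category.assoc _ _ _).symm.trans (Eq.trans (congrArg (· ≫ E.hom) ?_)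
      (freeUnit_freeLift (freeUnit T V ≫ extendUnit j (freeMod T V))))
    change ((λ_ V).inv ≫ η[T] ▷ V ≫ 𝟙 (T ⊗ V)) ≫ j ▷ V = (λ_ V).inv ≫ η[D] ▷ V ≫ 𝟙 (D ⊗ V)
    simp [← comp_whiskerRight, IsMonHom.one_hom]
  let k := (extendScalars φ).mapIso (comapFreeIso ψ V)
  let l₁ : extendObj φ ((RelGeom.tens R V).obj N₀) ≅ (RelGeom.tens S V).obj (extendObj φ N₀) :=
    (extendTensIso φ V).app N₀
  let l₂ : (RelGeom.tens S V).obj (extendObj φ N₀) ≅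
    (RelGeom.tens S V).obj ((Mod.comap (D := C) i).obj (Mod.regular D)) :=
    (RelGeom.tens S V).mapIso (asIso (tensorRing h.w))
  let l₃ : (Mod.comap (D := C) i).obj (freeMod D V) ≅
    (Mod.comap (D := C) i).obj (extendObj j (freeMod T V)) :=
    (Mod.comap (D := C) i).mapIso (asIso E)
  let l := l₁ ≪≫ l₂ ≪≫ comapFreeIso i V ≪≫ l₃
  have hk : k.hom ≫ (baseChange h.w).app (freeMod T V) = l.hom := by
    apply extendObj_hom_ext
    have h₁ : extendUnit φ ((RelGeom.tens R V).obj N₀) ≫ k.hom.hom =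
        (comapFreeIso ψ V).hom.hom ≫ extendUnit φ ((Mod.comap (D := C) ψ).obj (freeMod T V)) :=
      extendUnit_naturality φ _
    have h₂ : extendUnit φ ((RelGeom.tens R V).obj N₀) ≫ l₁.hom.hom = extendUnit φ N₀ ▷ V :=
      extendUnit_extendLift φ (M := (RelGeom.tens R V).obj N₀)
        (N := (RelGeom.tens S V).obj (extendObj φ N₀)) (extendUnit φ N₀ ▷ V)
        ((extendUnit_semilinear φ N₀).tens φ V)
    have h₃ : (extendUnit φ N₀ ▷ V) ≫ l₂.hom.hom = j ▷ V :=
      (comp_whiskerRight _ _ _).symm.trans (congrArg (· ▷ V) (extendUnit_extendLift φ (M := N₀)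
        (N := (Mod.comap (D := C) i).obj (Mod.regular D)) j ((isSemilinear_hom j).comap h.w)))
    have h₄ : j ▷ V ≫ E.hom = extendUnit j (freeMod T V) := congrArg Mod.Hom.hom hE
    have h₅ := extendUnit_baseChange h.w (freeMod T V)
    change extendUnit φ ((RelGeom.tens R V).obj N₀) ≫ k.hom.hom ≫ _ =
      extendUnit φ ((RelGeom.tens R V).obj N₀) ≫ l₁.hom.hom ≫ l₂.hom.hom ≫ 𝟙 (D ⊗ V) ≫ E.hom
    refine (Category.assoc _ _ _).symm.trans ((congrArg (· ≫ _) h₁).trans ?_)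
    refine ((congrArg (· ≫ _) (Category.id_comp _)).trans h₅).trans ?_
    refine h₄.symm.trans ?_
    refine Eq.trans ?_ (Category.assoc _ _ _)
    refine Eq.trans ?_ (congrArg (· ≫ _) h₂.symm)
    refine Eq.trans ?_ (Category.assoc _ _ _)
    refine Eq.trans ?_ (congrArg (· ≫ _) h₃.symm)
    exact congrArg (j ▷ V ≫ ·) (Category.id_comp _).symm
  have : IsIso (k.hom ≫ (baseChange h.w).app (freeMod T V)) := by
    rw [hk]
    exact l.isIso_hom
  exact IsIso.of_isIso_comp_left k.hom _

end BaseChange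

end RelGeom

/-! ### Derived base change for homotopy epimorphisms -/

namespace RelGeom

section HomotopyMono

variable {C : Type u} [Category.{v} C] [Preadditive C] [HasFiniteLimits C] [HasFiniteColimits C]
  [MonoidalCategory C] [SymmetricCategory C] [MonoidalClosed C]
  {R S T D : C} [MonObj R] [MonObj S] [MonObj T] [MonObj D]

theorem extendUnit_counit (φ : R ⟶ S) [IsMonHom φ] (N : CategoryTheory.Mod C S) :
    extendUnit φ ((Mod.comap (D := C) φ).obj N) ≫ ((extendAdj φ).counit.app N).hom = 𝟙 N.X := by
  have h : (extendAdj φ).counit.app N = extendLift φ (ofComap φ (𝟙 ((Mod.comap (D := C) φ).obj N)))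
      (ofComap_semilinear φ _) := by
    simp [extendAdj]
    rfl
  rw [h]
  exact extendUnit_extendLift φ _ _

variable [HasZeroObject C] [HasBinaryBiproducts C] [DetectedByProj C] {φ : R ⟶ S} {ψ : R ⟶ T}
  {i : S ⟶ D} {j : T ⟶ D} [IsMonHom φ] [IsMonHom ψ] [IsMonHom i] [IsMonHom j]
  [IsCommMonObj S] [IsCommMonObj T] [IsCommMonObj D]

/-- The base change isomorphism. -/
def baseChangeIso (h : IsCommMonPushout φ ψ i j) :
    Mod.comap (D := C) ψ ⋙ extendScalars φ ≅ extendScalars j ⋙ Mod.comap (D := C) i :=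
  have := isIso_baseChange h
  NatIso.ofComponents (fun M => asIso ((baseChange h.w).app M))
    (fun f => (baseChange h.w).naturality f)

theorem isStrictEpi_of_comap (f : R ⟶ S) [IsMonHom f] ⦃M N : CategoryTheory.Mod C S⦄ (g : M ⟶ N)
    (h : IsStrictEpi ((Mod.comap (D := C) f).map g)) : IsStrictEpi g :=
  isStrictEpi_of_hom ((isStrictEpi_iff_hom (f := (Mod.comap (D := C) f).map g)).1 h)

theorem isProj_of_isFreeProj {P : CochainComplex (CategoryTheory.Mod C T) ℤ} {n : ℤ}
    [P.IsStrictlyLE n] (h : ∀ k ≤ n, IsFreeProj T (P.X k)) (k : ℤ) : IsProj (P.X k) := by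
  by_cases hk : k ≤ n
  · exact (h k hk).isProj
  · exact isProj_of_isZero (P.isZero_of_isStrictlyLE n k (by lia))

/-- Restrict to `R` a resolution of `M` by free `T`-modules on projectives. Its terms are good for
`φ`, and by base change its extension along `φ` is the restriction of its extension along `j`, which
is a resolution because `M` is good for `j`. -/
theorem GoodObj.comap (hflat : ProjFlat C) (h : IsCommMonPushout φ ψ i j)
    (hT : GoodObj (extendScalars φ) ((Mod.comap (D := C) ψ).obj (Mod.regular T)))
    {M : CategoryTheory.Mod C T} (hM : GoodObj (extendScalars j) M) :
    GoodObj (extendScalars φ) ((Mod.comap (D := C) ψ).obj M) := by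
  obtain ⟨P, ε, hP, hfree, hε⟩ := exists_augExact (IsFreeProj T) (isFreeProj_enough T) M
  exact GoodObj.of_resolution (L := (mapC (Mod.comap (D := C) ψ)).obj P)
    (fun k hk => goodObj_comap_freeMod φ ψ hflat hT (hfree k hk))
    (hε.map (F := Mod.comap (D := C) ψ))
    (AugExact.of_iso (F := extendScalars j ⋙ Mod.comap (D := C) i)
      (G := Mod.comap (D := C) ψ ⋙ extendScalars φ)
      ((hM.augExact_map (isProj_of_isFreeProj hfree) hε).map (F := Mod.comap (D := C) i))
      (baseChangeIso h).symm)

/-- A morphism to the restriction of a complex along one side of a commutative square, as a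
morphism to the restriction along the other side. -/
def swapRestriction (w : φ ≫ i = ψ ≫ j) {P : CochainComplex (CategoryTheory.Mod C T) ℤ}
    {K : CochainComplex (CategoryTheory.Mod C D) ℤ} (π : P ⟶ (mapC (Mod.comap (D := C) j)).obj K) :
    (mapC (Mod.comap (D := C) ψ)).obj P ⟶
      (mapC (Mod.comap (D := C) φ)).obj ((mapC (Mod.comap (D := C) i)).obj K) where
  f k := toComap φ (M := (Mod.comap (D := C) ψ).obj (P.X k))
    (N := (Mod.comap (D := C) i).obj (K.X k)) (ofComap j (π.f k))
    ((ofComap_semilinear j (π.f k)).comap w)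
  comm' k l _ := by
    have h : (π.f k).hom ≫ (K.d k l).hom = (P.d k l).hom ≫ (π.f l).hom :=
      congrArg Mod.Hom.hom (π.comm k l)
    exact modHom_ext h

theorem strictQuasiIso_swapRestriction (w : φ ≫ i = ψ ≫ j)
    {P : CochainComplex (CategoryTheory.Mod C T) ℤ}
    {K : CochainComplex (CategoryTheory.Mod C D) ℤ} {π : P ⟶ (mapC (Mod.comap (D := C) j)).obj K}
    (h : StrictQuasiIso π) : StrictQuasiIso (swapRestriction w π) := by
  refine StrictQuasiIso.of_map (F := Mod.forget (D := C) R) isStrictEpi_of_forget ?_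
  exact h.map (F := Mod.forget (D := C) T)

/-- The base change isomorphism, on complexes. -/
def baseChangeC (w : φ ≫ i = ψ ≫ j) (P : CochainComplex (CategoryTheory.Mod C T) ℤ) :
    (mapC (extendScalars φ)).obj ((mapC (Mod.comap (D := C) ψ)).obj P) ⟶
      (mapC (Mod.comap (D := C) i)).obj ((mapC (extendScalars j)).obj P) where
  f k := (baseChange w).app (P.X k)
  comm' k l _ := ((baseChange w).naturality (P.d k l)).symm

theorem isIso_baseChangeC (h : IsCommMonPushout φ ψ i j)
    (P : CochainComplex (CategoryTheory.Mod C T) ℤ) : IsIso (baseChangeC h.w P) :=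
  have (k : ℤ) : IsIso ((baseChangeC h.w P).f k) := isIso_baseChange h (P.X k)
  HomologicalComplex.Hom.isIso_of_components _

/-- Composed with `extendUnit`, both sides become the morphism underlying `π`. This relates the
derived counits along `φ` and along `j`. -/
theorem baseChangeC_counit (w : φ ≫ i = ψ ≫ j) {P : CochainComplex (CategoryTheory.Mod C T) ℤ}
    {K : CochainComplex (CategoryTheory.Mod C D) ℤ} (π : P ⟶ (mapC (Mod.comap (D := C) j)).obj K) :
    (mapC (extendScalars φ)).map (swapRestriction w π) ≫
      counitC (extendAdj φ) ((mapC (Mod.comap (D := C) i)).obj K) =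
    baseChangeC w P ≫ (mapC (Mod.comap (D := C) i)).map
      ((mapC (extendScalars j)).map π ≫ counitC (extendAdj j) K) := by
  refine HomologicalComplex.hom_ext _ _ fun k => ?_
  let N := (Mod.comap (D := C) i).obj (K.X k)
  let M := (Mod.comap (D := C) ψ).obj (P.X k)
  let f : M ⟶ (Mod.comap (D := C) φ).obj N := (swapRestriction w π).f k
  let f' : P.X k ⟶ (Mod.comap (D := C) j).obj (K.X k) := π.f k
  have h₁ : extendUnit φ M ≫ (extendMap φ f).hom =
      f.hom ≫ extendUnit φ ((Mod.comap (D := C) φ).obj N) := extendUnit_naturality φ f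
  have h₂ := extendUnit_counit φ N
  have h₃ : extendUnit φ M ≫ ((RelGeom.baseChange w).app (P.X k)).hom = extendUnit j (P.X k) :=
    extendUnit_baseChange w (P.X k)
  have h₄ : extendUnit j (P.X k) ≫ (extendMap j f').hom =
      f'.hom ≫ extendUnit j ((Mod.comap (D := C) j).obj (K.X k)) := extendUnit_naturality j f'
  have h₅ := extendUnit_counit j (K.X k)
  refine extendObj_hom_ext φ (M := M) (N := N) ?_
  refine Eq.trans (b := f.hom) ?_ ?_
  · refine (Category.assoc _ _ _).symm.trans ((congrArg (· ≫ _) h₁).trans ?_)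
    exact (Category.assoc _ _ _).trans ((congrArg (f.hom ≫ ·) h₂).trans (Category.comp_id _))
  · symm
    refine (Category.assoc _ _ _).symm.trans ((congrArg (· ≫ _) h₃).trans ?_)
    refine (Category.assoc _ _ _).symm.trans ((congrArg (· ≫ _) h₄).trans ?_)
    exact (Category.assoc _ _ _).trans ((congrArg (f'.hom ≫ ·) h₅).trans (Category.comp_id _))

/-- Homotopy epimorphisms of rings. -/
def IsHomotopyEpi (f : R ⟶ S) [IsMonHom f] : Prop :=
  (mapDMinus (Mod.comap (D := C) f)).Full ∧ (mapDMinus (Mod.comap (D := C) f)).Faithful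

/-- The derived counit along `j` is tested after restriction along `i`. There base change identifies
`j^* P` with `φ^*` of the restriction of `P`, so the counit becomes the derived counit of `φ` at the
restriction of `K`, which is invertible by hypothesis. -/
theorem IsHomotopyEpi.baseChange (hflat : ProjFlat C) (h : IsCommMonPushout φ ψ i j)
    (hT : GoodObj (extendScalars φ) ((Mod.comap (D := C) ψ).obj (Mod.regular T)))
    (hφ : IsHomotopyEpi φ) : IsHomotopyEpi j := by
  refine full_faithful_of_strictQuasiIso (extendAdj j) fun K n hK => ?_
  obtain ⟨P, π, hP, hfree, hπ⟩ := exists_resolution (IsFreeProj T) (isFreeProj_enough T)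
    ((mapC (Mod.comap (D := C) j)).obj K) n
  refine ⟨P, π, hP, isProj_of_isFreeProj hfree, hπ,
    StrictQuasiIso.of_map (F := Mod.comap (D := C) i) (isStrictEpi_of_comap i) ?_⟩
  obtain ⟨Q, s, hQ, hproj, hs⟩ := exists_resolution IsProj DetectedByProj.enough
    ((mapC (Mod.comap (D := C) ψ)).obj P) n
  have hproj' (k : ℤ) : IsProj (Q.X k) := by
    by_cases hk : k ≤ n
    · exact hproj k hk
    · exact isProj_of_isZero (Q.isZero_of_isStrictlyLE n k (by lia))
  have hs' := (trW_map_iff s).2 hs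
  -- The restricted free resolution need not be projective over `R`, but its terms are good, so it
  -- computes the derived pullback along `φ` as well as `Q` does.
  have h₁ : StrictQuasiIso ((mapC (extendScalars φ)).map s) := by
    rw [← trW_map_iff]
    refine Good.trW_map (Good.of_goodObj ((mapC (Mod.comap (D := C) ψ)).obj P) n fun k => ?_)
      (kProj_of_isProj n hproj') ((toK _).map s) hs'
    by_cases hk : k ≤ n
    · exact goodObj_comap_freeMod φ ψ hflat hT (hfree k hk)
    · exact goodObj_of_isZero ((Mod.comap (D := C) ψ).map_isZero
        (P.isZero_of_isStrictlyLE n k (by lia)))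
  -- Since `φ ≫ i = ψ ≫ j`, `Q` is also a projective resolution of the restriction of `K` to `R`
  -- through `S`.
  have h₂ : StrictQuasiIso (s ≫ swapRestriction h.w π) := by
    rw [← trW_map_iff, Functor.map_comp]
    exact trW_comp hs' ((trW_map_iff _).2 (strictQuasiIso_swapRestriction h.w hπ))
  have h₃ := strictQuasiIso_of_full_faithful (extendAdj φ) hφ n hproj' n _ h₂
  rw [Functor.map_comp, Category.assoc, baseChangeC_counit, ← trW_map_iff, Functor.map_comp,
    Functor.map_comp] at h₃
  have := isIso_baseChangeC h P
  rw [← trW_map_iff]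
  exact trW_of_comp_left (ObjectProperty.trW_of_isIso _ _)
    (trW_of_comp_left ((trW_map_iff _).2 h₁) h₃)

end HomotopyMono

end RelGeom

/-! ### Affine schemes, homotopy monomorphisms and RR-quasi-coherent modules -/

namespace RelGeom

section Scheme

variable {C : Type u} [Category.{v} C] [Preadditive C] [HasFiniteLimits C] [HasFiniteColimits C]
  [MonoidalCategory C] [SymmetricCategory C] [MonoidalClosed C]

/-- The morphism of affine schemes given by a morphism of commutative monoids. -/
def specMap {X : Aff C} {Q : C} [MonObj Q] [IsCommMonObj Q] (f : X.unop.X ⟶ Q) [hf : IsMonHom f] :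
    Opposite.op (CommMon.mk Q) ⟶ X :=
  (CommMon.homMk (A := X.unop) (B := CommMon.mk Q)
    (@Mon.Hom.mk _ _ _ X.unop.toMon (CommMon.mk Q).toMon f hf)).op

theorem aff_hom_ext {X Y : Aff C} {p q : Y ⟶ X} (h : ringHom p = ringHom q) : p = q :=
  Quiver.Hom.unop_inj (CommMon.hom_ext _ _ h)

theorem isCommMonPushout_of_isPullback {W X Y Z : Aff C} {fst : W ⟶ Y} {snd : W ⟶ Z} {p : Y ⟶ X}
    {q : Z ⟶ X} (h : IsPullback fst snd p q) :
    IsCommMonPushout (ringHom p) (ringHom q) (ringHom fst) (ringHom snd) where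
  w := congrArg (fun f : W ⟶ X => ringHom f) h.w
  desc {Q} _ _ f g _ _ hfg := by
    have hfg' : specMap f ≫ p = specMap g ≫ q := aff_hom_ext hfg
    exact ⟨ringHom (h.lift _ _ hfg'), inferInstance,
      congrArg (fun f : _ ⟶ Y => ringHom f) (h.lift_fst _ _ hfg'),
      congrArg (fun f : _ ⟶ Z => ringHom f) (h.lift_snd _ _ hfg')⟩
  hom_ext {Q} _ _ s t _ _ h₁ h₂ := by
    have h₁' : specMap s ≫ fst = specMap t ≫ fst := aff_hom_ext h₁
    have h₂' : specMap s ≫ snd = specMap t ≫ snd := aff_hom_ext h₂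
    exact congrArg (fun f : _ ⟶ W => ringHom f) (h.hom_ext h₁' h₂')

/-- Pullback along a composition. -/
def pullbackCompIso {X Y Z : Aff C} (q : Z ⟶ Y) (p : Y ⟶ X) :
    pullbackFunctor (q ≫ p) ≅ pullbackFunctor p ⋙ pullbackFunctor q :=
  extendCompIso (ringHom p) (ringHom q) (ringHom (q ≫ p)) rfl

/-- Pullback along the identity. -/
def pullbackIdIso (X : Aff C) : pullbackFunctor (𝟙 X) ≅ 𝟭 (ModOn X) :=
  (extendAdj (ringHom (𝟙 X))).leftAdjointUniq
    (Adjunction.id.ofNatIsoRight (comapIdIso (ringHom (𝟙 X)) rfl))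

theorem isIso_of_isIso_pullback {X Y : Aff C} (p : Y ⟶ X) [IsIso p] {M N : ModOn X} (f : M ⟶ N)
    (hf : IsIso ((pullbackFunctor p).map f)) : IsIso f := by
  have e : pullbackFunctor p ⋙ pullbackFunctor (inv p) ≅ 𝟭 (ModOn X) :=
    (pullbackCompIso (inv p) p).symm ≪≫ eqToIso (by rw [IsIso.inv_hom_id]) ≪≫ pullbackIdIso X
  refine (NatIso.isIso_map_iff e f).1 ?_
  exact inferInstanceAs (IsIso ((pullbackFunctor (inv p)).map ((pullbackFunctor p).map f)))

variable [HasZeroObject C] [HasBinaryBiproducts C] [DetectedByProj C]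

theorem IsHomotopyMono.comp {X Y Z : Aff C} {q : Z ⟶ Y} {p : Y ⟶ X} (hq : IsHomotopyMono q)
    (hp : IsHomotopyMono p) : IsHomotopyMono (q ≫ p) :=
  mapDMinus_full_faithful_comp (pushforward q) (pushforward p) (pushforward (q ≫ p))
    (comapCompIso (ringHom p) (ringHom q) (ringHom (q ≫ p)) rfl) hq hp

theorem isHomotopyMono_of_isIso {X Y : Aff C} (p : Y ⟶ X) [IsIso p] : IsHomotopyMono p :=
  mapDMinus_full_faithful_of_inverse (pushforward p) (pushforward (inv p))
    (comapIdIso (ringHom (inv p) ≫ ringHom p)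
        (congrArg (fun f : Y ⟶ Y => ringHom f) (IsIso.hom_inv_id p)) ≪≫
      comapCompIso (ringHom (inv p)) (ringHom p) _ rfl)
    (comapIdIso (ringHom p ≫ ringHom (inv p))
        (congrArg (fun f : X ⟶ X => ringHom f) (IsIso.inv_hom_id p)) ≪≫
      comapCompIso (ringHom p) (ringHom (inv p)) _ rfl)

/-- `Transversal` asks for one projective resolution that stays a resolution; the passage from an
arbitrary K-projective one is the independence of the choice. -/
theorem transversal_iff_goodObj {X Y : Aff C} (p : Y ⟶ X) (M : ModOn X) :
    Transversal p M ↔ GoodObj (pullbackFunctor p) M := by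
  constructor
  · rintro ⟨P, π, hP, hproj, hπ, hF⟩
    exact ⟨_, (toK _).map π, kProj_of_isProj 0 hproj, (trW_map_iff _).2 hπ, (trW_map_iff _).2 hF⟩
  · intro h
    obtain ⟨P, ε, hP, hproj, hε⟩ := exists_projective_augExact M
    obtain ⟨π, hπ⟩ := hε.exists_hom
    exact ⟨P, π, hP, hproj, (strictQuasiIso_iff_augExact (single0_isZero M) π _ ε hπ).2 hε,
      (strictQuasiIso_map_iff_augExact π ε hπ).2 (h.augExact_map hproj hε)⟩

variable {A : ObjectProperty (Aff C)}

/-- RR for `p` makes `p^* P` a projective resolution of `p^* M`, and RR for the composite `q ≫ p`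
says that its further pullback along `q` is still exact. -/
theorem IsRR.pullback {X Y : Aff C} {p : Y ⟶ X} {M : ModOn X} (hY : A Y) (hp : IsHomotopyMono p)
    (hM : IsRR A X M) : IsRR A Y ((pullbackFunctor p).obj M) := by
  intro Z q hZ hq
  rw [transversal_iff_goodObj]
  have h₁ := (transversal_iff_goodObj _ _).1 (hM p hY hp)
  have h₂ := (transversal_iff_goodObj _ _).1 (hM (q ≫ p) hZ (hq.comp hp))
  obtain ⟨P, ε, hP, hproj, hε⟩ := exists_projective_augExact M
  exact goodObj_of_augExact (P := (mapC (pullbackFunctor p)).obj P)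
    (fun i => (hproj i).map_leftAdjoint (extendAdj (ringHom p))) (h₁.augExact_map hproj hε)
    (AugExact.of_iso (F := pullbackFunctor (q ≫ p)) (G := pullbackFunctor p ⋙ pullbackFunctor q)
      (h₂.augExact_map hproj hε) (pullbackCompIso q p))

section Pullback

variable (hflat : ProjFlat C) (hA : IsHomotopyZariskiTransversal A) {W X Y Z : Aff C}
  {fst : W ⟶ Y} {snd : W ⟶ Z} {p : Y ⟶ X} {q : Z ⟶ X} (h : IsPullback fst snd p q)

include hflat hA h

/-- Transversality of `A` is exactly the goodness of the ring of `Z` over `X` that derived base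
change requires. -/
theorem IsHomotopyMono.of_isPullback (hX : A X) (hY : A Y) (hZ : A Z) (hp : IsHomotopyMono p) :
    IsHomotopyMono snd :=
  IsHomotopyEpi.baseChange hflat (isCommMonPushout_of_isPullback h)
    ((transversal_iff_goodObj _ _).1 (hA.transversal p q hX hY hZ hp)) hp

omit h in
-- For a homotopy monomorphism `p` to `X`, base change reduces the claim to `M` being good for the
-- projection to `Z`, which is again a homotopy monomorphism in `A`.
theorem IsRR.pushforward (q : Z ⟶ X) (hX : A X) (hZ : A Z) {M : ModOn Z} (hM : IsRR A Z M) :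
    IsRR A X ((RelGeom.pushforward q).obj M) := by
  intro Y p hY hp
  obtain ⟨W, fst, snd, hW, h⟩ := hA.fiberProduct p q hY hZ hX
  rw [transversal_iff_goodObj]
  exact GoodObj.comap hflat (isCommMonPushout_of_isPullback h)
    ((transversal_iff_goodObj _ _).1 (hA.transversal p q hX hY hZ hp))
    ((transversal_iff_goodObj _ _).1 (hM snd hW (hp.of_isPullback hflat hA h hX hY hZ)))

omit hflat hA in
theorem isIso_pullback_pushforward {M N : ModOn Z} (f : M ⟶ N)
    (hf : IsIso ((pullbackFunctor snd).map f)) :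
    IsIso ((pullbackFunctor p).map ((RelGeom.pushforward q).map f)) := by
  refine (NatIso.isIso_map_iff (baseChangeIso (isCommMonPushout_of_isPullback h)) f).2 ?_
  exact inferInstanceAs (IsIso ((RelGeom.pushforward fst).map ((pullbackFunctor snd).map f)))

omit h hflat hA in
theorem isIso_of_isIso_pushforward (q : Z ⟶ X) {M N : ModOn Z} (f : M ⟶ N)
    (hf : IsIso ((RelGeom.pushforward q).map f)) : IsIso f := by
  have : IsIso ((Mod.forget (D := C) Z.unop.X).map f) :=
    inferInstanceAs (IsIso ((Mod.forget (D := C) X.unop.X).map ((RelGeom.pushforward q).map f)))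
  exact isIso_of_reflects_iso f (Mod.forget (D := C) Z.unop.X)

end Pullback

end Scheme

end RelGeom

/-! ### The formal homotopy Zariski pretopology -/

namespace RelGeom

section Topology

variable {C : Type u} [Category.{v} C] [Preadditive C] [HasFiniteLimits C] [HasFiniteColimits C]
  [MonoidalCategory C] [SymmetricCategory C] [MonoidalClosed C]
  {A : ObjectProperty (Aff C)}

theorem isPullback_fullSubcategory {W X Y Z : A.FullSubcategory} {fst : W ⟶ Y} {snd : W ⟶ Z}
    {p : Y ⟶ X} {q : Z ⟶ X} (h : IsPullback fst.hom snd.hom p.hom q.hom) :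
    IsPullback fst snd p q :=
  IsPullback.of_map A.ι (ObjectProperty.hom_ext _ h.w) h

theorem IsHomotopyZariskiTransversal.exists_isPullback (hA : IsHomotopyZariskiTransversal A)
    {X Y Z : A.FullSubcategory} (p : Y ⟶ X) (q : Z ⟶ X) :
    ∃ (W : A.FullSubcategory) (fst : W ⟶ Y) (snd : W ⟶ Z),
      IsPullback fst.hom snd.hom p.hom q.hom := by
  obtain ⟨W, fst, snd, hW, h⟩ := hA.fiberProduct p.hom q.hom Y.property Z.property X.property
  exact ⟨⟨W, hW⟩, ObjectProperty.homMk fst, ObjectProperty.homMk snd, h⟩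

theorem IsHomotopyZariskiTransversal.hasPullbacks (hA : IsHomotopyZariskiTransversal A) :
    HasPullbacks A.FullSubcategory :=
  have {X Y Z : A.FullSubcategory} (p : Y ⟶ X) (q : Z ⟶ X) : HasLimit (cospan p q) := by
    obtain ⟨W, fst, snd, h⟩ := hA.exists_isPullback p q
    exact (isPullback_fullSubcategory h).hasPullback
  hasPullbacks_of_hasLimit_cospan _

/-- Fibre products of objects of `A` can be formed in `Aff C` inside `A`, so a pullback in the
subcategory is isomorphic to an ambient one. -/
theorem IsHomotopyZariskiTransversal.isPullback_hom (hA : IsHomotopyZariskiTransversal A)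
    {W X Y Z : A.FullSubcategory} {fst : W ⟶ Y} {snd : W ⟶ Z} {p : Y ⟶ X} {q : Z ⟶ X}
    (h : IsPullback fst snd p q) : IsPullback fst.hom snd.hom p.hom q.hom := by
  obtain ⟨W', fst', snd', h'⟩ := hA.exists_isPullback p q
  have h'' := isPullback_fullSubcategory h'
  exact IsPullback.of_iso' h' (A.ι.mapIso (h.isoIsPullback _ _ h'')) (Iso.refl _) (Iso.refl _)
    (Iso.refl _)
    ((congrArg A.ι.map (h.isoIsPullback_hom_fst _ _ h'')).trans (Category.comp_id fst.hom).symm)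
    ((congrArg A.ι.map (h.isoIsPullback_hom_snd _ _ h'')).trans (Category.comp_id snd.hom).symm)
    ((Category.id_comp _).trans (Category.comp_id _).symm)
    ((Category.id_comp _).trans (Category.comp_id _).symm)

/-- The pullbacks of RR-quasi-coherent modules along the morphisms in `J` jointly detect
isomorphisms. -/
def JointlyConservative {X : A.FullSubcategory} (J : Set (Σ Y : A.FullSubcategory, Y ⟶ X)) : Prop :=
  ∀ ⦃M N : ModOn X.obj⦄ (f : M ⟶ N), IsRR A X.obj M → IsRR A X.obj N →
    (∀ a ∈ J, IsIso ((pullbackFunctor a.2.hom).map f)) → IsIso f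

variable (A) in
/-- The covering presieves of the formal homotopy Zariski topology. -/
def coveringPresieves (X : A.FullSubcategory) : Set (Presieve X) := fun S =>
  (∀ ⦃Y : A.FullSubcategory⦄ (p : Y ⟶ X), S p → IsHomotopyMono p.hom) ∧
    ∃ J : Set (Σ Y : A.FullSubcategory, Y ⟶ X), J.Finite ∧ (∀ a ∈ J, S a.2) ∧ JointlyConservative J

theorem conservativeFamily_iff {X : A.FullSubcategory} {I : Type*} {Y : I → A.FullSubcategory}
    (p : ∀ i, Y i ⟶ X) (J : Finset I) :
    ConservativeFamily (fun i : J => (IsRR A X.obj).ι ⋙ pullbackFunctor (p i).hom) ↔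
      JointlyConservative ((fun i => (⟨Y i, p i⟩ : Σ Y : A.FullSubcategory, Y ⟶ X)) '' J) := by
  constructor
  · intro h M N f hM hN hf
    let f' : (⟨M, hM⟩ : (IsRR A X.obj).FullSubcategory) ⟶ ⟨N, hN⟩ := ObjectProperty.homMk f
    have : IsIso f' := (h f').2 fun i => hf _ ⟨i, i.2, rfl⟩
    exact inferInstanceAs (IsIso ((IsRR A X.obj).ι.map f'))
  · intro h M N f
    refine ⟨fun _ _ => inferInstance, fun hf => ?_⟩
    have : IsIso ((IsRR A X.obj).ι.map f) := by
      refine h f.hom M.property N.property ?_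
      rintro _ ⟨i, hi, rfl⟩
      exact hf ⟨i, hi⟩
    exact (IsRR A X.obj).fullyFaithfulι.isIso_of_isIso_map f

theorem ofArrows_mem_coveringPresieves_iff {X : A.FullSubcategory} {I : Type*}
    {Y : I → A.FullSubcategory} (p : ∀ i, Y i ⟶ X) :
    Presieve.ofArrows Y p ∈ coveringPresieves A X ↔ IsCoveringFamily A p := by
  constructor
  · rintro ⟨h₁, J, hJ, hS, hcons⟩
    refine ⟨fun i => h₁ _ ⟨i⟩, ?_⟩
    have hr : J ⊆ (fun i => (⟨Y i, p i⟩ : Σ Y : A.FullSubcategory, Y ⟶ X)) '' Set.univ := by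
      rintro ⟨Z, q⟩ hq
      obtain ⟨i⟩ := hS _ hq
      exact ⟨i, trivial, rfl⟩
    -- A finite set of arrows of the family is the image of a finite set of indices, one chosen for
    -- each arrow.
    obtain ⟨I', -, hI', rfl⟩ := (Set.exists_subset_image_finite_and (p := (· = J))).1
      ⟨J, hr, hJ, rfl⟩
    refine ⟨hI'.toFinset, ?_⟩
    rw [conservativeFamily_iff, hI'.coe_toFinset]
    exact hcons
  · rintro ⟨h₁, J, hJ⟩
    refine ⟨?_, _, J.finite_toSet.image _, ?_, (conservativeFamily_iff p J).1 hJ⟩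
    · rintro _ _ ⟨i⟩
      exact h₁ i
    · rintro _ ⟨i, -, rfl⟩
      exact ⟨i⟩

variable [HasZeroObject C] [HasBinaryBiproducts C] [DetectedByProj C]

theorem singleton_mem_coveringPresieves {X Y : A.FullSubcategory} (f : Y ⟶ X) [IsIso f] :
    Presieve.singleton f ∈ coveringPresieves A X := by
  have : IsIso f.hom := inferInstanceAs (IsIso (A.ι.map f))
  refine ⟨?_, {⟨Y, f⟩}, Set.finite_singleton _, ?_, fun M N g _ _ hg => ?_⟩
  · rintro _ _ ⟨⟩
    exact isHomotopyMono_of_isIso f.hom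
  · rintro _ rfl
    exact ⟨⟩
  · exact isIso_of_isIso_pullback f.hom g (hg _ rfl)

/-- To show that `g` on `Y` is invertible, push it forward to `X`, where the given covering is
conservative on RR modules. Base change turns its pullbacks there into pushforwards of the pullbacks
of `g`, and pushforward reflects isomorphisms. -/
theorem pullbackArrows_mem_coveringPresieves [HasPullbacks A.FullSubcategory] (hflat : ProjFlat C)
    (hA : IsHomotopyZariskiTransversal A) {X Y : A.FullSubcategory} (f : Y ⟶ X) {S : Presieve X}
    (hS : S ∈ coveringPresieves A X) : Presieve.pullbackArrows f S ∈ coveringPresieves A Y := by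
  obtain ⟨h₁, J, hJ, hJS, hcons⟩ := hS
  refine ⟨?_, (fun a => ⟨pullback a.2 f, pullback.snd a.2 f⟩) '' J, hJ.image _, ?_,
    fun M N g hM hN hg => ?_⟩
  · rintro _ _ ⟨Z, p, hp⟩
    exact (h₁ p hp).of_isPullback hflat hA (hA.isPullback_hom (IsPullback.of_hasPullback p f))
      X.property Z.property (ObjectProperty.FullSubcategory.property _)
  · rintro _ ⟨a, ha, rfl⟩
    exact ⟨a.1, a.2, hJS a ha⟩
  · refine isIso_of_isIso_pushforward f.hom g (hcons _
      (hM.pushforward hflat hA f.hom X.property Y.property)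
      (hN.pushforward hflat hA f.hom X.property Y.property) fun a ha => ?_)
    exact isIso_pullback_pushforward (hA.isPullback_hom (IsPullback.of_hasPullback a.2 f)) g
      (hg _ ⟨a, ha, rfl⟩)

/-- The finite family consists of composites over the finitely many chosen members. Conservativity
is applied twice, first on the members and then on `X`; on the members it requires the pulled back
modules to be RR. -/
theorem bind_mem_coveringPresieves {X : A.FullSubcategory} {S : Presieve X}
    {T : ∀ ⦃Y : A.FullSubcategory⦄ (f : Y ⟶ X), S f → Presieve Y}
    (hS : S ∈ coveringPresieves A X)
    (hT : ∀ ⦃Y : A.FullSubcategory⦄ (f : Y ⟶ X) (h : S f), T f h ∈ coveringPresieves A Y) :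
    S.bind T ∈ coveringPresieves A X := by
  obtain ⟨h₁, J, hJ, hJS, hcons⟩ := hS
  choose h₂ K hK hKT hKcons using hT
  have := hJ.to_subtype
  refine ⟨?_, ⋃ a : J, (fun b => ⟨b.1, b.2 ≫ a.1.2⟩) '' K a.1.2 (hJS a a.2),
    Set.finite_iUnion fun a => (hK _ _).image _, ?_, fun M N g hM hN hg => ?_⟩
  · rintro _ _ ⟨Y, q, p, hp, hq, rfl⟩
    exact (h₂ p hp q hq).comp (h₁ p hp)
  · intro _ h
    obtain ⟨a, b, hb, rfl⟩ := Set.mem_iUnion.1 h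
    exact ⟨_, b.2, a.1.2, hJS a a.2, hKT _ _ b hb, rfl⟩
  · refine hcons g hM hN fun a ha => hKcons a.2 (hJS a ha) _
      (hM.pullback a.1.property (h₁ _ (hJS a ha))) (hN.pullback a.1.property (h₁ _ (hJS a ha)))
      fun b hb => ?_
    have := hg ⟨b.1, b.2 ≫ a.2⟩ (Set.mem_iUnion.2 ⟨⟨a, ha⟩, b, hb, rfl⟩)
    exact (NatIso.isIso_map_iff (pullbackCompIso b.2.hom a.2.hom) g).1 this

/-- The formal homotopy Zariski topology. -/
def formalHomotopyZariski [HasPullbacks A.FullSubcategory] (hflat : ProjFlat C)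
    (hA : IsHomotopyZariskiTransversal A) : Pretopology A.FullSubcategory where
  coverings := coveringPresieves A
  has_isos _ _ f _ := singleton_mem_coveringPresieves f
  pullbacks _ _ f _ hS := pullbackArrows_mem_coveringPresieves hflat hA f hS
  transitive _ _ _ hS hT := bind_mem_coveringPresieves hS hT

end Topology

end RelGeom

/-! ### The main theorem -/

theorem mainTheorem9 {C : Type u} [Category.{v} C] [Preadditive C] [HasFiniteLimits C]
    [HasFiniteColimits C] [MonoidalCategory C] [SymmetricCategory C] [MonoidalClosed C]
    (hC : RelGeom.QuasiAbelian C) (hproj : RelGeom.EnoughProj C) (hflat : RelGeom.ProjFlat C)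
    (A : ObjectProperty (RelGeom.Aff C)) (hA : RelGeom.IsHomotopyZariskiTransversal A) :
    (∀ (X Y : RelGeom.Aff C) (p : Y ⟶ X) (M : RelGeom.ModOn X), A X → A Y →
      RelGeom.IsHomotopyMono p → RelGeom.IsRR A X M →
        RelGeom.IsRR A Y ((RelGeom.pullbackFunctor p).obj M)) ∧
    ∃ (_ : HasPullbacks A.FullSubcategory) (T : Pretopology A.FullSubcategory),
      ∀ (X : A.FullSubcategory) (I : Type (max u v)) (Y : I → A.FullSubcategory)
        (p : ∀ i, Y i ⟶ X),
        Presieve.ofArrows Y p ∈ T.coverings X ↔ RelGeom.IsCoveringFamily A p := by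
  have : HasZeroObject C := ⟨⊤_ C, (IsZero.iff_id_eq_zero _).2 (Subsingleton.elim _ _)⟩
  have : HasBinaryBiproducts C := HasBinaryBiproducts.of_hasBinaryProducts
  have : RelGeom.DetectedByProj C := hC.detectedByProj hproj
  have : HasPullbacks A.FullSubcategory := hA.hasPullbacks
  exact ⟨fun X Y p M hX hY hp hM => hM.pullback hY hp, ‹_›,
    RelGeom.formalHomotopyZariski hflat hA,
    fun X I Y p => RelGeom.ofArrows_mem_coveringPresieves_iff p⟩
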